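/- Let $k$ be an algebraically closed field of characteristic $p>0$, $p\ne 3$ (for instance $k=\overline{\mathbb F}_p$). A smooth projective connected curve $Y$ over $k$ is called trielliptic if it is a $\mathbb{Z}/3\mathbb{Z}$-Galois cover of $\mathbb{P}^1_k$; its signature is the pair $(\dim\mathcal L_1,\dim\mathcal L_2)$, where $\mathcal L_i$ is the $\zeta_3^i$-eigenspace in $H^0(Y,\Omega^1)$ of a generator of $\mathbb{Z}/3\mathbb{Z}$. The $p$-rank of $Y$ is the integer $f$ such that the Jacobian of $Y$ has exactly $p^f$ $p$-torsion $k$-points. $Y$ is called superspecial if the Cartier operator vanishes on $H^0(Y,\Omega^1)$. (1) Suppose that $p$ is odd and $p\equiv 2 \bmod 3$. Then the smooth projective curve over $k$ with affine equation $$y^3=(x^2-1)(x^2+1)^2$$ is, via $x$, a trielliptic curve of genus $2$ and signature $(1,1)$; the Cartier operator vanishes on $H^0(Y,\Omega^1)$, so $Y$ is superspecial, and $Y$ has $p$-rank $0$. In particular, there exists a smooth trielliptic curve over $k$ of genus $2$ and $p$-rank $0$. (2) Suppose that $p=2$. Then there does not exist a smooth trielliptic curve over $k$ of genus $2$ and $2$-rank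 $0$. -/

import Mathlib

open scoped TensorProduct IntermediateField

/-!
Smooth projective connected curves over an algebraically closed field `k` are treated as complete
abstract nonsingular curves.  A field extension `F / k` which is finitely generated of
transcendence degree one is the function field of exactly one such curve `Y`; the closed points of
`Y` are the discrete valuation rings of `F / k`, and the local ring of `Y` at a point is the
corresponding valuation ring.  Morphisms of curves are inclusions of function fields.
-/

universe u v

namespace TriCurve

section Curves

variable (k : Type u) (F : Type v) [Field k] [Field F] [Algebra k F]

/-- `F` is the function field of a smooth projective connected curve over the (algebraically
closed) field `k`: it is a finite extension of `k(t)` for some `t` transcendental over `k`. -/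
def IsCurve : Prop :=
  ∃ t : F, Transcendental k t ∧ FiniteDimensional k⟮t⟯ F

/-- A closed point of the curve with function field `F`: a discrete valuation ring of `F`
containing `k` with field of fractions `F`.  The ring is the local ring of the curve at the
point. -/
structure Point where
  /-- the local ring at the point -/
  localRing : ValuationSubring F
  algebraMap_mem : ∀ c : k, algebraMap k F c ∈ localRing
  isDVR : IsDiscreteValuationRing localRing

attribute [instance] Point.isDVR

variable {k F}

/-- The order of vanishing at `P` of a rational function `f`, normalized so that a uniformizer has
order `1` (and with the convention that the order of `0` is `0`). -/
noncomputable def Point.ord (P : Point k F) (f : F) : ℤ :=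
  -WithZero.log ((IsDiscreteValuationRing.maximalIdeal P.localRing).valuation F f)

theorem Point.ord_mul (P : Point k F) {f g : F} (hf : f ≠ 0) (hg : g ≠ 0) :
    P.ord (f * g) = P.ord f + P.ord g := by
  unfold Point.ord
  rw [map_mul, WithZero.log_mul (by simpa using hf) (by simpa using hg)]
  ring

theorem Point.ord_one (P : Point k F) : P.ord 1 = 0 := by
  simp [Point.ord]

theorem Point.ord_inv (P : Point k F) (f : F) : P.ord f⁻¹ = -P.ord f := by
  simp [Point.ord]

/-- The submodule of rational differentials that are regular at `P`: the image in `Ω[F⁄k]` of the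
module of differentials of the local ring at `P`. -/
noncomputable def Point.regularDifferentials (P : Point k F) : Submodule k (Ω[F⁄k]) :=
  Submodule.span k
    {ω | ∃ a ∈ P.localRing, ∃ b ∈ P.localRing, ω = a • KaehlerDifferential.D k F b}

variable (k F)

/-- The space `H⁰(Y, Ω¹)` of differentials that are regular everywhere. -/
noncomputable def holomorphicDifferentials : Submodule k (Ω[F⁄k]) :=
  ⨅ P : Point k F, P.regularDifferentials

/-- The genus `dim H⁰(Y, Ω¹)`. -/
noncomputable def genus : ℕ := Module.finrank k (holomorphicDifferentials k F)

/-- Divisors: finite formal integral combinations of points. -/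
abbrev Divisor : Type v := Point k F →₀ ℤ

/-- The degree of a divisor (all residue fields are `k`, since `k` is algebraically closed). -/
noncomputable def Divisor.degree : Divisor k F →+ ℤ :=
  Finsupp.liftAddHom fun _ => AddMonoidHom.id ℤ

/-- The group of principal divisors. -/
noncomputable def principalDivisors : AddSubgroup (Divisor k F) where
  carrier := {D | ∃ f : F, f ≠ 0 ∧ ∀ P, D P = P.ord f}
  zero_mem' := ⟨1, one_ne_zero, fun P => by simp [P.ord_one]⟩
  add_mem' := by
    rintro D E ⟨f, hf, hD⟩ ⟨g, hg, hE⟩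
    exact ⟨f * g, mul_ne_zero hf hg, fun P => by
      rw [Finsupp.add_apply, hD, hE, P.ord_mul hf hg]⟩
  neg_mem' := by
    rintro D ⟨f, hf, hD⟩
    exact ⟨f⁻¹, inv_ne_zero hf, fun P => by rw [Finsupp.neg_apply, hD, P.ord_inv]⟩

/-- The group `Pic⁰(Y)` of `k`-points of the Jacobian of `Y`: divisors of degree zero modulo
principal divisors. -/
abbrev Jacobian : Type v :=
  (Divisor.degree k F).ker ⧸ (principalDivisors k F).addSubgroupOf (Divisor.degree k F).ker

/-- The curve has `p`-rank `f`: the number of `p`-torsion points of its Jacobian is `p ^ f`. -/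
def HasPRank (p f : ℕ) : Prop :=
  Nat.card {c : Jacobian k F // p • c = 0} = p ^ f

/-- `C` is the Cartier operator on rational differentials in characteristic `p`: the additive
operator that is `p⁻¹`-linear, kills exact differentials and sends `f ^ (p - 1) df` to `df`. -/
structure IsCartierOperator (p : ℕ) (C : Ω[F⁄k] →+ Ω[F⁄k]) : Prop where
  pow_smul : ∀ (g : F) (ω : Ω[F⁄k]), C (g ^ p • ω) = g • C ω
  exact : ∀ f : F, C (KaehlerDifferential.D k F f) = 0
  pow_sub_one_smul : ∀ f : F,
    C (f ^ (p - 1) • KaehlerDifferential.D k F f) = KaehlerDifferential.D k F f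

/-- The curve is superspecial: there is exactly one Cartier operator on its rational differentials
(which holds for every curve) and it vanishes on `H⁰(Y, Ω¹)`. -/
def IsSuperspecial (p : ℕ) : Prop :=
  (∃! C : Ω[F⁄k] →+ Ω[F⁄k], IsCartierOperator k F p C) ∧
    ∀ C : Ω[F⁄k] →+ Ω[F⁄k], IsCartierOperator k F p C →
      ∀ ω ∈ holomorphicDifferentials k F, C ω = 0

end Curves

section Trielliptic

variable {k : Type u} {F : Type v} [Field k] [Field F] [Algebra k F]

/-- The automorphism `σ` (the image of `1` under an action `ℤ/3ℤ ↪ Aut(Y)`) has order three and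
the quotient of `Y` by it is the projective line with coordinate `x`; so `x : Y → ℙ¹` is a
`ℤ/3ℤ`-cover. -/
structure IsTriellipticCover (σ : F ≃ₐ[k] F) (x : F) : Prop where
  orderOf_eq : orderOf σ = 3
  transcendental : Transcendental k x
  fixedField_eq : IntermediateField.fixedField (Subgroup.zpowers σ) = k⟮x⟯

variable (k F) in
/-- The smooth projective curve with function field `F` is trielliptic: it is a `ℤ/3ℤ`-cover of
the projective line. -/
def IsTrielliptic : Prop :=
  IsCurve k F ∧ ∃ (σ : F ≃ₐ[k] F) (x : F), IsTriellipticCover σ x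

/-- The action `f dg ↦ σ(f) d(σ(g))` of an automorphism on rational differentials. -/
noncomputable def differentialAction (σ : F ≃ₐ[k] F) : Ω[F⁄k] →ₗ[k] Ω[F⁄k] :=
  (KaehlerDifferential.ideal k F).mapCotangent (KaehlerDifferential.ideal k F)
    (Algebra.TensorProduct.map σ.toAlgHom σ.toAlgHom) (by
      intro z hz
      have h : ∀ z : F ⊗[k] F, Algebra.TensorProduct.lmul' k (S := F)
          (Algebra.TensorProduct.map σ.toAlgHom σ.toAlgHom z) =
          σ (Algebra.TensorProduct.lmul' k (S := F) z) := by
        intro z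
        induction z with
        | zero => simp
        | tmul a b => simp
        | add a b ha hb => simp only [map_add, ha, hb]
      have hz' : Algebra.TensorProduct.lmul' k (S := F) z = 0 := hz
      change Algebra.TensorProduct.lmul' k (S := F) _ = 0
      simpa [hz'] using h z)

theorem differentialAction_smul_D (σ : F ≃ₐ[k] F) (f g : F) :
    differentialAction σ (f • KaehlerDifferential.D k F g) =
      σ f • KaehlerDifferential.D k F (σ g) := by
  have key : ∀ (a b : F), a • KaehlerDifferential.D k F b =
      (KaehlerDifferential.ideal k F).toCotangent
        (((a ⊗ₜ[k] 1 : F ⊗[k] F)) • ⟨1 ⊗ₜ b - b ⊗ₜ 1,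
          KaehlerDifferential.one_smul_sub_smul_one_mem_ideal k b⟩) := by
    intro a b
    exact (algebraMap_smul (F ⊗[k] F) a (KaehlerDifferential.D k F b)).symm
  rw [key, key]
  refine (Ideal.mapCotangent_toCotangent _ _ _ _ _).trans ?_
  congr 1
  ext
  simp [mul_sub, Algebra.TensorProduct.tmul_mul_tmul]

/-- The `ζ ^ i`-eigenspace of `σ` on `H⁰(Y, Ω¹)`. -/
noncomputable def eigendifferentials (σ : F ≃ₐ[k] F) (ζ : k) (i : ℕ) :
    Submodule k (Ω[F⁄k]) :=
  holomorphicDifferentials k F ⊓ Module.End.eigenspace (differentialAction σ) (ζ ^ i)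

/-- The signature type of `σ` with respect to a primitive cube root of unity `ζ` is `(r, s)`. -/
def HasSignature (σ : F ≃ₐ[k] F) (ζ : k) (r s : ℕ) : Prop :=
  Module.finrank k (eigendifferentials σ ζ 1) = r ∧
    Module.finrank k (eigendifferentials σ ζ 2) = s

end Trielliptic

end TriCurve

/-! Both parts rest on an explicit model `y ^ 3 = f(x) g(x) ^ 2` with `f * g` squarefree and `deg f
+ 2 deg g = 3 m`, so that infinity is unramified (`Model`). Put `z = y ^ 2 / g(x)`. The points are
analysed by Kummer theory: over a root of `f` or `g` the cover is totally and tamely ramified, with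
uniformizer `y` or `z`. Elsewhere, Newton approximation of a cube root shows that `x - a` (or `x⁻¹`)
is a uniformizer. Since regular differentials at a point are the local ring times `dt` for a
uniformizer `t`, and `σ` splits differentials into eigencomponents, the holomorphic ones are exactly
`(A(x) / y + B(x) / z) dx` with `deg A < m - 1` and `deg B < 2 m - deg g - 1`
(`Model.holomorphicDifferentials_eq_range`). The genus and the signature follow.

Part (1). Here `f = X² - 1`, `g = X² + 1`, `m = 2`, and `dx / y`, `dx / z` form a basis. Write `p =
3 q + 2`. Up to a `p`-th power factor, `y⁻¹` is the polynomial `f ^ (2 q + 1) * g ^ q`, and `z⁻¹` is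
the same with `f` and `g` exchanged. The Cartier operator sees only the coefficient of `X ^ (p -
1)`, which is the middle one. As `q` is odd, both polynomials change sign under reversal, so this
coefficient vanishes (`coeff_eq_zero_of_antipalindromic`, `Model.cartier_eq_zero`). For the
`p`-rank: if `p E = div f`, then `df / f` is holomorphic and fixed by the Cartier operator, hence
zero; so `f` is a `p`-th power and `E` is principal (`hasPRank_zero_of_cartier`).

Part (2). Every trielliptic curve has a model, and genus two forces `m = deg f = deg g = 2`. In
characteristic two the scalar `w` can be chosen so that `f - w ^ 3 g` has no linear term, hence is a
square `s ^ 2`. With `u = y / g(x)` and `q = u - w`, the product of the conjugates of `q` is `s ^ 2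
/ g`. The conjugates have no common zeros, so the zeros of `q` have even order, while its simple
poles over the roots of `g` cancel in `q / σ q`. Thus `div (q / σ q) = 2 (E - σE)`. If the 2-rank
were zero, `q / σ q` would be a constant times a square, hence a square `h ^ 2`. Differentiating `q
= h ^ 2 σ q` gives `h ^ 2 ζ = 1`, so `σ q = ζ q`, contradicting `σ q - ζ q = w (ζ - 1) ≠ 0`
(`TorsionData.not_hasPRank_zero`). -/

namespace TriCurve

/-! ### Orders of functions at points, and a criterion for discrete valuation rings -/

section Ord

variable {k : Type u} {F : Type v} [Field k] [Field F] [Algebra k F] (P : Point k F)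

theorem Point.ord_nonneg_iff {f : F} (hf : f ≠ 0) : 0 ≤ P.ord f ↔ f ∈ P.localRing := by
  have hv : (IsDiscreteValuationRing.maximalIdeal P.localRing).valuation F f ≠ 0 := by simpa using hf
  have h1 : 0 ≤ P.ord f ↔ (IsDiscreteValuationRing.maximalIdeal P.localRing).valuation F f ≤ 1 := by
    unfold Point.ord
    rw [Left.nonneg_neg_iff, ← WithZero.log_one, WithZero.log_le_log hv one_ne_zero]
  rw [h1]
  constructor
  · intro h
    obtain ⟨a, rfl⟩ := IsDiscreteValuationRing.exists_lift_of_le_one h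
    exact a.2
  · intro h
    exact IsDedekindDomain.HeightOneSpectrum.valuation_le_one
      (IsDiscreteValuationRing.maximalIdeal P.localRing) (⟨f, h⟩ : P.localRing)

theorem Point.exists_ord_eq_one : ∃ t : F, P.ord t = 1 := by
  obtain ⟨t, ht⟩ := (IsDiscreteValuationRing.maximalIdeal P.localRing).valuation_exists_uniformizer F
  exact ⟨t, by simp [Point.ord, ht]⟩

theorem Point.ord_zero : P.ord 0 = 0 := by simp [Point.ord]

theorem Point.ne_zero_of_ord_ne_zero {f : F} (h : P.ord f ≠ 0) : f ≠ 0 := by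
  rintro rfl
  exact h P.ord_zero

theorem Point.mem_of_ord_nonneg {f : F} (h : 0 ≤ P.ord f) : f ∈ P.localRing := by
  by_cases hf : f = 0
  · subst hf; exact zero_mem _
  · exact (P.ord_nonneg_iff hf).1 h

theorem Point.ord_nonneg {f : F} (h : f ∈ P.localRing) : 0 ≤ P.ord f := by
  by_cases hf : f = 0
  · subst hf; rw [P.ord_zero]
  · exact (P.ord_nonneg_iff hf).2 h

theorem Point.ord_pow (f : F) (n : ℕ) : P.ord (f ^ n) = n * P.ord f := by
  simp [Point.ord, WithZero.log_pow]

theorem Point.ord_zpow (f : F) (n : ℤ) : P.ord (f ^ n) = n * P.ord f := by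
  simp [Point.ord, WithZero.log_zpow]

theorem Point.ord_div {f g : F} (hf : f ≠ 0) (hg : g ≠ 0) : P.ord (f / g) = P.ord f - P.ord g := by
  rw [div_eq_mul_inv, P.ord_mul hf (inv_ne_zero hg), P.ord_inv, sub_eq_add_neg]

theorem Point.ord_neg (f : F) : P.ord (-f) = P.ord f := by
  simp [Point.ord, Valuation.map_neg]

theorem Point.ord_algebraMap (c : k) : P.ord (algebraMap k F c) = 0 := by
  by_cases hc : c = 0
  · simp [hc, P.ord_zero]
  have h1 := P.ord_nonneg (P.algebraMap_mem c)
  have h2 := P.ord_nonneg (P.algebraMap_mem c⁻¹)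
  rw [map_inv₀, P.ord_inv] at h2
  omega

theorem Point.ord_smul {c : k} (hc : c ≠ 0) (f : F) : P.ord (c • f) = P.ord f := by
  by_cases hf : f = 0
  · simp [hf]
  rw [Algebra.smul_def, P.ord_mul (by simpa using hc) hf, P.ord_algebraMap, zero_add]

/-- Multiplying by `t ^ (-n)` for a uniformizer `t` reduces this to closure of the local ring under
addition. The disjunctions are needed because `ord 0 = 0` by convention. -/
theorem Point.le_ord_add {f g : F} {n : ℤ} (hfg : f + g ≠ 0) (hf : f = 0 ∨ n ≤ P.ord f)
    (hg : g = 0 ∨ n ≤ P.ord g) : n ≤ P.ord (f + g) := by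
  rcases eq_or_ne f 0 with rfl | hf0
  · simp only [zero_add, ne_eq] at *
    exact hg.resolve_left hfg
  rcases eq_or_ne g 0 with rfl | hg0
  · simp only [add_zero, ne_eq] at *
    exact hf.resolve_left hfg
  obtain ⟨t, ht⟩ := P.exists_ord_eq_one
  have ht0 : t ≠ 0 := P.ne_zero_of_ord_ne_zero (by omega)
  have key : ∀ h : F, h ≠ 0 → P.ord (h * t ^ (-n)) = P.ord h - n := by
    intro h hh
    rw [P.ord_mul hh (zpow_ne_zero _ ht0), P.ord_zpow, ht]
    ring
  have h1 := P.mem_of_ord_nonneg (f := f * t ^ (-n)) (by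
    have := hf.resolve_left hf0; rw [key f hf0]; omega)
  have h2 := P.mem_of_ord_nonneg (f := g * t ^ (-n)) (by
    have := hg.resolve_left hg0; rw [key g hg0]; omega)
  have h3 := P.ord_nonneg (add_mem h1 h2)
  rw [← add_mul, key _ hfg] at h3
  omega

theorem Point.ord_add_eq_left {f g : F} (hf : f ≠ 0) (h : g = 0 ∨ P.ord f < P.ord g) :
    f + g ≠ 0 ∧ P.ord (f + g) = P.ord f := by
  rcases eq_or_ne g 0 with rfl | hg0
  · simp [hf]
  have h := h.resolve_left hg0
  have hne : f + g ≠ 0 := by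
    intro h0
    rw [eq_neg_of_add_eq_zero_left h0, P.ord_neg] at h
    exact lt_irrefl _ h
  refine ⟨hne, le_antisymm ?_ (P.le_ord_add hne (Or.inr le_rfl) (Or.inr h.le))⟩
  by_contra hlt
  push Not at hlt
  have h4 : P.ord f + 1 ≤ P.ord ((f + g) + -g) :=
    P.le_ord_add (by simpa using hf) (Or.inr (by omega)) (Or.inr (by rw [P.ord_neg]; omega))
  rw [add_neg_cancel_right] at h4
  omega

/-- Elements of pairwise distinct orders: the order of the sum is bounded by that of each term. -/
theorem Point.ord_sum_le {ι : Type*} (s : Finset ι) (f : ι → F)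
    (hinj : ∀ i ∈ s, ∀ j ∈ s, f i ≠ 0 → f j ≠ 0 → P.ord (f i) = P.ord (f j) → i = j) :
    ∀ i ∈ s, f i ≠ 0 → (∑ j ∈ s, f j) ≠ 0 ∧ P.ord (∑ j ∈ s, f j) ≤ P.ord (f i) := by
  classical
  induction s using Finset.induction_on with
  | empty => simp
  | insert a s ha ih =>
    have ih := ih fun i hi j hj => hinj i (Finset.mem_insert_of_mem hi) j (Finset.mem_insert_of_mem hj)
    -- the order of a partial sum is attained
    have hatt : ∀ s' : Finset ι, s' ⊆ s → (∑ j ∈ s', f j) ≠ 0 →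
        ∃ j ∈ s', f j ≠ 0 ∧ P.ord (f j) ≤ P.ord (∑ j ∈ s', f j) := by
      intro s' _ h0
      by_contra! hcon
      -- If every term had order greater than that of the total, then so would every nonzero partial
      -- sum, including the total itself.
      have : ∀ s'' ⊆ s', (∑ j ∈ s'', f j) = 0 ∨ P.ord (∑ j ∈ s', f j) + 1 ≤ P.ord (∑ j ∈ s'', f j) := by
        intro s''
        induction s'' using Finset.induction_on with
        | empty => simp
        | insert b s'' hb ih' =>
          intro hs
          rw [Finset.sum_insert hb]
          by_cases h1 : f b + ∑ j ∈ s'', f j = 0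
          · exact Or.inl h1
          · refine Or.inr (P.le_ord_add h1 ?_ (ih' fun j hj => hs (Finset.mem_insert_of_mem hj)))
            by_cases h2 : f b = 0
            · exact Or.inl h2
            · exact Or.inr (hcon b (hs (Finset.mem_insert_self _ _)) h2)
      rcases this s' subset_rfl with h | h
      · exact h0 h
      · omega
    intro i hi hi0
    rw [Finset.sum_insert ha]
    by_cases hs0 : ∑ j ∈ s, f j = 0
    · rw [hs0, add_zero]
      rcases Finset.mem_insert.1 hi with rfl | hi
      · exact ⟨hi0, le_rfl⟩
      · exact absurd hs0 (ih i hi hi0).1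
    by_cases ha0 : f a = 0
    · rw [ha0, zero_add]
      rcases Finset.mem_insert.1 hi with rfl | hi
      · exact absurd ha0 hi0
      · exact ih i hi hi0
    obtain ⟨j, hj, hj0, hjle⟩ := hatt s subset_rfl hs0
    have hje : P.ord (∑ j ∈ s, f j) = P.ord (f j) := le_antisymm (ih j hj hj0).2 hjle
    have hne : P.ord (f a) ≠ P.ord (∑ j ∈ s, f j) := by
      rw [hje]
      intro h
      exact ha (hinj a (Finset.mem_insert_self _ _) j (Finset.mem_insert_of_mem hj) ha0 hj0 h ▸ hj)
    rcases lt_or_gt_of_ne hne with h | h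
    · obtain ⟨h1, h2⟩ := P.ord_add_eq_left ha0 (Or.inr h)
      refine ⟨h1, ?_⟩
      rw [h2]
      rcases Finset.mem_insert.1 hi with rfl | hi
      · exact le_rfl
      · exact h.le.trans (ih i hi hi0).2
    · rw [add_comm (f a)]
      obtain ⟨h1, h2⟩ := P.ord_add_eq_left hs0 (Or.inr h)
      refine ⟨h1, ?_⟩
      rw [h2]
      rcases Finset.mem_insert.1 hi with rfl | hi
      · exact h.le
      · exact (ih i hi hi0).2

theorem Point.valuation_le_one_iff_ord {f : F} (hf : f ≠ 0) :
    P.localRing.valuation f ≤ 1 ↔ 0 ≤ P.ord f := by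
  rw [P.ord_nonneg_iff hf, ValuationSubring.valuation_le_one_iff]

theorem Point.valuation_lt_one_iff_ord {f : F} (hf : f ≠ 0) :
    P.localRing.valuation f < 1 ↔ 0 < P.ord f := by
  have h := P.valuation_le_one_iff_ord (inv_ne_zero hf)
  rw [P.ord_inv, map_inv₀] at h
  have hv : 0 < P.localRing.valuation f := by simpa [zero_lt_iff] using hf
  rw [inv_le_one₀ hv] at h
  rw [← not_le, h]
  omega

theorem Point.valuation_eq_one_iff_ord {f : F} (hf : f ≠ 0) :
    P.localRing.valuation f = 1 ↔ P.ord f = 0 := by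
  have h1 := P.valuation_le_one_iff_ord hf
  have h2 := P.valuation_lt_one_iff_ord hf
  constructor
  · intro h
    rw [h] at h1 h2
    simp at h1 h2
    omega
  · intro h
    rw [h] at h1 h2
    exact le_antisymm (h1.2 le_rfl) (not_lt.1 fun h3 => lt_irrefl _ (h2.1 h3))

theorem Point.ord_eq_of_valuation_eq_zpow {t b : F} (ht : t ≠ 0) (hb : b ≠ 0) {n : ℤ}
    (h : P.localRing.valuation b = P.localRing.valuation t ^ n) : P.ord b = n * P.ord t := by
  have h1 : P.localRing.valuation (b / t ^ n) = 1 := by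
    rw [map_div₀, map_zpow₀, h, div_self]
    exact zpow_ne_zero _ (by simpa using ht)
  rw [P.valuation_eq_one_iff_ord (div_ne_zero hb (zpow_ne_zero _ ht)),
    P.ord_div hb (zpow_ne_zero _ ht), P.ord_zpow] at h1
  omega

/-- An element whose powers exhaust the value group has order one. -/
theorem Point.ord_eq_one_of_forall {t : F} (ht : t ≠ 0) (hlt : P.localRing.valuation t < 1)
    (h : ∀ b : F, b ≠ 0 → ∃ n : ℤ, P.localRing.valuation b = P.localRing.valuation t ^ n) :
    P.ord t = 1 := by
  obtain ⟨u, hu⟩ := P.exists_ord_eq_one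
  have hu0 : u ≠ 0 := P.ne_zero_of_ord_ne_zero (by omega)
  obtain ⟨n, hn⟩ := h u hu0
  have h1 := P.ord_eq_of_valuation_eq_zpow ht hu0 hn
  rw [hu] at h1
  have h2 := (P.valuation_lt_one_iff_ord ht).1 hlt
  exact Int.eq_one_of_mul_eq_one_left h2.le h1.symm

theorem Point.localRing_ne_top : P.localRing ≠ ⊤ := by
  intro h
  obtain ⟨t, ht⟩ := P.exists_ord_eq_one
  have ht0 : t ≠ 0 := P.ne_zero_of_ord_ne_zero (by omega)
  have h1 := P.ord_nonneg (f := t⁻¹) (by rw [h]; trivial)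
  rw [P.ord_inv] at h1
  omega

/-- The tool that turns a valuation ring into a `Point`: `t` is irreducible because its value is not
a product of two smaller nontrivial powers, and every nonzero element is a unit times a power of
`t`. -/
theorem isDiscreteValuationRing_of_forall (V : ValuationSubring F) {t : F} (ht : t ≠ 0)
    (hlt : V.valuation t < 1)
    (h : ∀ b : F, b ≠ 0 → ∃ n : ℤ, V.valuation b = V.valuation t ^ n) :
    IsDiscreteValuationRing V := by
  have htV : t ∈ V := (V.valuation_le_one_iff t).1 hlt.le
  have hv0 : V.valuation t ≠ 0 := by simpa using ht
  have hpos : 0 < V.valuation t := zero_lt_iff.2 hv0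
  have hassoc : ∀ b : V, b ≠ 0 → ∃ n : ℕ, V.valuation b = V.valuation t ^ n := by
    intro b hb
    obtain ⟨n, hn⟩ := h b (by simpa using hb)
    have hle := V.valuation_le_one b
    have : 0 ≤ n := by
      by_contra hneg
      push Not at hneg
      rw [hn] at hle
      exact absurd hle (not_le.2 (one_lt_zpow_of_neg₀ hpos hlt hneg))
    lift n to ℕ using this
    exact ⟨n, by simpa using hn⟩
  refine IsDiscreteValuationRing.ofHasUnitMulPowIrreducibleFactorization ⟨⟨t, htV⟩, ?_, ?_⟩
  · refine ⟨fun hu => ?_, ?_⟩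
    · exact absurd ((V.valuation_eq_one_iff _).1 hu) hlt.ne
    · intro a b hab
      have ha0 : a ≠ 0 := by
        rintro rfl
        apply ht
        simpa using congrArg Subtype.val hab
      have hb0 : b ≠ 0 := by
        rintro rfl
        apply ht
        simpa using congrArg Subtype.val hab
      obtain ⟨m, hm⟩ := hassoc a ha0
      obtain ⟨n, hn⟩ := hassoc b hb0
      have hmn : V.valuation t ^ 1 = V.valuation t ^ (m + n) := by
        have : t = a * b := congrArg Subtype.val hab
        rw [pow_add, ← hm, ← hn, ← map_mul, ← this, pow_one]
      have := pow_right_injective₀ hpos hlt.ne hmn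
      rcases (by omega : m = 0 ∨ n = 0) with h | h
      · left
        rw [V.valuation_eq_one_iff, hm, h, pow_zero]
      · right
        rw [V.valuation_eq_one_iff, hn, h, pow_zero]
  · intro b hb
    obtain ⟨n, hn⟩ := hassoc b hb
    refine ⟨n, ?_⟩
    have hu : V.valuation (b / t ^ n : F) = 1 := by
      rw [map_div₀, map_pow, hn, div_self (pow_ne_zero _ hv0)]
    refine associated_of_dvd_dvd ⟨⟨(b : F) / t ^ n, (V.valuation_le_one_iff _).1 hu.le⟩, ?_⟩
      ⟨⟨((b : F) / t ^ n)⁻¹, (V.valuation_le_one_iff _).1 (by rw [map_inv₀, hu, inv_one])⟩, ?_⟩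
    · ext
      simp [mul_div_cancel₀ _ (pow_ne_zero n ht)]
    · have hb' : (b : F) ≠ 0 := by simpa using hb
      ext
      change t ^ n = (b : F) * ((b : F) / t ^ n)⁻¹
      field_simp

end Ord


/-! ### Differentials in characteristic `p` and `p`-bases -/

section Frobenius

open KaehlerDifferential

variable {k : Type u} {F : Type v} [Field k] [Field F] [Algebra k F] {p : ℕ}

/-- The powers `t ^ i`, `i < p`, span `F` over its subfield of `p`-th powers. -/
def FrobSpan (p : ℕ) (t : F) : Prop :=
  ∀ b : F, ∃ c : Fin p → F, b = ∑ i, c i ^ p * t ^ (i : ℕ)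

/-- The powers of `x` bound `[F : F ^ p]` by `p`. If `t` is not a `p`-th power, `X ^ p - t ^ p` is
irreducible over `F ^ p`, so `t` has degree `p` and its powers form a basis. -/
theorem frobSpan_and_independent [Fact p.Prime] [CharP F p] {x t : F} (hx : FrobSpan p x)
    (ht : ∀ g : F, g ^ p ≠ t) :
    FrobSpan p t ∧ ∀ c : Fin p → F, ∑ i, c i ^ p * t ^ (i : ℕ) = 0 → c = 0 := by
  have hp : p.Prime := Fact.out
  let K : Subfield F := (frobenius F p).fieldRange
  have hK : ∀ a : K, ∃ g : F, g ^ p = a := fun a => by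
    obtain ⟨g, hg⟩ := a.2
    exact ⟨g, hg⟩
  have hKmem : ∀ g : F, g ^ p ∈ K := fun g => ⟨g, rfl⟩
  let τ : K := ⟨t ^ p, hKmem t⟩
  have hirr : Irreducible (Polynomial.X ^ p - Polynomial.C τ) := by
    rw [X_pow_sub_C_irreducible_iff_of_prime hp]
    intro b hb
    obtain ⟨g, hg⟩ := hK b
    have h1 : (b : F) ^ p = t ^ p := congrArg Subtype.val hb
    have h2 : (b : F) = t := frobenius_inj F p h1
    exact ht g (hg.trans h2)
  have hmin : minpoly K t = Polynomial.X ^ p - Polynomial.C τ := by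
    symm
    apply minpoly.eq_of_irreducible_of_monic hirr
    · simp [τ]
      exact sub_self _
    · exact Polynomial.monic_X_pow_sub_C _ hp.ne_zero
  have hdeg : (minpoly K t).natDegree = p := by
    rw [hmin, Polynomial.natDegree_X_pow_sub_C]
  have hli : LinearIndependent K fun i : Fin p => t ^ (i : ℕ) := by
    have := linearIndependent_pow (K := K) t
    rwa [hdeg] at this
  have hspanx : Submodule.span K (Set.range fun i : Fin p => x ^ (i : ℕ)) = ⊤ := by
    rw [eq_top_iff]
    intro b _
    obtain ⟨c, rfl⟩ := hx b
    refine Submodule.sum_mem _ fun i _ => ?_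
    exact Submodule.smul_mem _ (⟨c i ^ p, hKmem _⟩ : K) (Submodule.subset_span ⟨i, rfl⟩)
  have hfin : Module.Finite K F := ⟨Submodule.fg_def.2 ⟨_, Set.finite_range _, hspanx⟩⟩
  have hle : Module.finrank K F ≤ p := by
    have := finrank_range_le_card (R := K) (fun i : Fin p => x ^ (i : ℕ))
    rw [Set.finrank, hspanx, finrank_top] at this
    simpa using this
  have hge : p ≤ Module.finrank K F := by
    have := hli.fintype_card_le_finrank
    simpa using this
  have hspan := hli.span_eq_top_of_card_eq_finrank' (by simpa using le_antisymm hge hle)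
  constructor
  · intro b
    have hb : b ∈ Submodule.span K (Set.range fun i : Fin p => t ^ (i : ℕ)) := by rw [hspan]; trivial
    obtain ⟨c, hc⟩ := (Submodule.mem_span_range_iff_exists_fun K).1 hb
    choose g hg using fun i => hK (c i)
    refine ⟨g, ?_⟩
    rw [← hc]
    exact Finset.sum_congr rfl fun i _ => by rw [hg i]; rfl
  · intro c hc
    have := Fintype.linearIndependent_iff.1 hli (fun i => ⟨c i ^ p, hKmem _⟩) hc
    funext i
    have h1 : c i ^ p = 0 := congrArg Subtype.val (this i)
    simpa using pow_eq_zero_iff hp.ne_zero |>.1 h1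

theorem D_pow_char [Fact p.Prime] [CharP F p] (c : F) : D k F (c ^ p) = 0 := by
  rw [Derivation.leibniz_pow, ← Nat.cast_smul_eq_nsmul F, CharP.cast_eq_zero, zero_smul]

theorem D_pow_char_mul [Fact p.Prime] [CharP F p] (c t : F) (i : ℕ) :
    D k F (c ^ p * t ^ i) = (c ^ p * (i * t ^ (i - 1))) • D k F t := by
  rw [Derivation.leibniz, D_pow_char (p := p), smul_zero, add_zero, Derivation.leibniz_pow,
    ← Nat.cast_smul_eq_nsmul F, smul_smul, smul_smul, mul_assoc]

theorem D_sum_pow_char_mul [Fact p.Prime] [CharP F p] (c : Fin p → F) (t : F) :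
    D k F (∑ i, c i ^ p * t ^ (i : ℕ)) =
      (∑ i, c i ^ p * ((i : ℕ) * t ^ ((i : ℕ) - 1))) • D k F t := by
  rw [map_sum, Finset.sum_smul]
  exact Finset.sum_congr rfl fun i _ => D_pow_char_mul _ _ _

theorem FrobSpan.exists_smul_D [Fact p.Prime] [CharP F p] {t : F} (ht : FrobSpan p t)
    (ω : Ω[F⁄k]) : ∃ h : F, ω = h • D k F t := by
  have : ω ∈ Submodule.span F (Set.range (D k F)) := by
    rw [span_range_derivation]; trivial
  induction this using Submodule.span_induction with
  | mem ω h =>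
    obtain ⟨b, rfl⟩ := h
    obtain ⟨c, rfl⟩ := ht b
    exact ⟨_, D_sum_pow_char_mul c t⟩
  | zero => exact ⟨0, (zero_smul _ _).symm⟩
  | add a b _ _ ha hb =>
    obtain ⟨h, rfl⟩ := ha
    obtain ⟨h', rfl⟩ := hb
    exact ⟨h + h', (add_smul _ _ _).symm⟩
  | smul c a _ ha =>
    obtain ⟨h, rfl⟩ := ha
    exact ⟨c * h, smul_smul _ _ _⟩

/-- If `Ω[F⁄k]` vanished, the essentially finitely generated extension `F / k` would be formally
unramified, hence separable algebraic. This avoids choosing a separating transcendental. -/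
theorem IsCurve.nontrivial_differentials (hF : IsCurve k F) : Nontrivial (Ω[F⁄k]) := by
  by_contra hcon
  rw [not_nontrivial_iff_subsingleton] at hcon
  obtain ⟨t, ht, hfin⟩ := hF
  have : Algebra.FormallyUnramified k F := ⟨hcon⟩
  have h1 : Algebra.EssFiniteType k k⟮t⟯ :=
    IntermediateField.essFiniteType_iff.2 (IntermediateField.fg_adjoin_of_finite (Set.finite_singleton t))
  have h2 : Algebra.EssFiniteType k F := Algebra.EssFiniteType.comp k k⟮t⟯ F
  have h3 := (Algebra.FormallyUnramified.iff_isSeparable k F).1 this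
  exact ht (Algebra.IsAlgebraic.isAlgebraic t)

/-- A function field of a curve in characteristic `p` has degree `p` over its `p`-th powers, and
`t` generates it. -/
structure FrobGen (k : Type u) {F : Type v} [Field k] [Field F] [Algebra k F] (p : ℕ) (t : F) :
    Prop where
  span : FrobSpan p t
  indep : ∀ c : Fin p → F, ∑ i, c i ^ p * t ^ (i : ℕ) = 0 → c = 0
  D_ne_zero : D k F t ≠ 0

/-- Once the powers of `t` span over `F ^ p`, `dt` generates all differentials, and these are not
all zero. -/
theorem FrobSpan.frobGen [Fact p.Prime] [CharP F p] (hF : IsCurve k F) {x t : F}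
    (hx : FrobSpan p x) (ht : ∀ g : F, g ^ p ≠ t) : FrobGen k p t := by
  obtain ⟨h1, h2⟩ := frobSpan_and_independent hx ht
  refine ⟨h1, h2, fun h => ?_⟩
  have := hF.nontrivial_differentials
  obtain ⟨ω, hω⟩ := exists_ne (0 : Ω[F⁄k])
  obtain ⟨a, rfl⟩ := h1.exists_smul_D ω
  exact hω (by rw [h, smul_zero])

theorem FrobSpan.D_eq_zero_iff [Fact p.Prime] [CharP F p] (hF : IsCurve k F) {x b : F}
    (hx : FrobSpan p x) : D k F b = 0 ↔ ∃ g : F, g ^ p = b := by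
  constructor
  · intro h
    by_contra! hcon
    exact (hx.frobGen hF hcon).D_ne_zero h
  · rintro ⟨g, rfl⟩
    exact D_pow_char g

theorem FrobGen.smul_D_injective {t : F} (ht : FrobGen k p t) {a b : F}
    (h : a • D k F t = b • D k F t) : a = b :=
  smul_left_injective F ht.D_ne_zero h

theorem Point.frobGen_of_ord_eq_one [Fact p.Prime] [CharP F p] (hF : IsCurve k F) {x t : F}
    (hx : FrobSpan p x) (P : Point k F) (ht : P.ord t = 1) : FrobGen k p t := by
  refine hx.frobGen hF ?_
  rintro g rfl
  rw [P.ord_pow] at ht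
  have := Int.eq_one_of_mul_eq_one_right (by positivity) ht
  have : p = 1 := by exact_mod_cast this
  exact (Fact.out : p.Prime).ne_one this

/-- Expand a regular `b` as `∑ c i ^ p * t ^ i`. The terms have orders `p * ord (c i) + i`, distinct
modulo `p`, so nothing cancels and every `c i` is regular; hence `db` is a regular multiple of `dt`.
-/
theorem Point.smul_D_mem_regularDifferentials_iff [Fact p.Prime] [CharP F p] (hF : IsCurve k F)
    {x t : F} (hx : FrobSpan p x) (P : Point k F) (ht : P.ord t = 1) (h : F) :
    h • D k F t ∈ P.regularDifferentials ↔ h ∈ P.localRing := by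
  have hp : p.Prime := Fact.out
  have hgen := P.frobGen_of_ord_eq_one hF hx ht
  have ht0 : t ≠ 0 := P.ne_zero_of_ord_ne_zero (by omega)
  have htO : t ∈ P.localRing := P.mem_of_ord_nonneg (by omega)
  constructor
  · intro hmem
    have key : ∀ ω ∈ P.regularDifferentials, ∃ a ∈ P.localRing, ω = a • D k F t := by
      intro ω hω
      induction hω using Submodule.span_induction with
      | mem ω hω =>
        obtain ⟨a, ha, b, hb, rfl⟩ := hω
        obtain ⟨c, hc⟩ := hgen.span b
        have hcO : ∀ i, c i ∈ P.localRing := by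
          intro i
          by_cases hi : c i = 0
          · rw [hi]; exact zero_mem _
          have hterm : ∀ j, c j ^ p * t ^ (j : ℕ) ≠ 0 →
              P.ord (c j ^ p * t ^ (j : ℕ)) = p * P.ord (c j) + j := by
            intro j hj
            rw [P.ord_mul (left_ne_zero_of_mul hj) (right_ne_zero_of_mul hj), P.ord_pow, P.ord_pow,
              ht, mul_one]
          have hi0 : c i ^ p * t ^ (i : ℕ) ≠ 0 := mul_ne_zero (pow_ne_zero _ hi) (pow_ne_zero _ ht0)
          have h1 := (P.ord_sum_le Finset.univ (fun j => c j ^ p * t ^ (j : ℕ)) (by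
            intro j _ l _ hj hl hjl
            rw [hterm j hj, hterm l hl] at hjl
            have h2 : ((j : ℕ) : ℤ) % p = ((l : ℕ) : ℤ) % p := by
              have := congrArg (· % (p : ℤ)) hjl
              simpa [Int.add_emod] using this
            rw [Int.emod_eq_of_lt (by positivity) (by exact_mod_cast j.2),
              Int.emod_eq_of_lt (by positivity) (by exact_mod_cast l.2)] at h2
            exact Fin.ext (by exact_mod_cast h2)) i (Finset.mem_univ _) hi0).2
          rw [hterm i hi0, ← hc] at h1
          have h3 := P.ord_nonneg hb
          have hip : ((i : ℕ) : ℤ) < p := by exact_mod_cast i.2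
          have hp0 : (0 : ℤ) < p := by exact_mod_cast hp.pos
          apply P.mem_of_ord_nonneg
          -- If `ord (c i) ≤ -1`, then `p * ord (c i) + i ≤ i - p < 0`, although this order bounds
          -- `ord b ≥ 0` from above.
          by_contra hneg
          push Not at hneg
          nlinarith
        refine ⟨_, mul_mem ha (sum_mem (S := P.localRing.toSubring) (t := Finset.univ)
          (f := fun i : Fin p => c i ^ p * ((i : ℕ) * t ^ ((i : ℕ) - 1))) fun i _ => ?_), ?_⟩
        · exact mul_mem (pow_mem (hcO i) _) (mul_mem (natCast_mem _ _) (pow_mem htO _))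
        · conv_lhs => rw [hc]
          rw [D_sum_pow_char_mul, smul_smul]
      | zero => exact ⟨0, zero_mem _, (zero_smul _ _).symm⟩
      | add a b _ _ ha hb =>
        obtain ⟨h, hh, rfl⟩ := ha
        obtain ⟨h', hh', rfl⟩ := hb
        exact ⟨h + h', add_mem hh hh', (add_smul _ _ _).symm⟩
      | smul c a _ ha =>
        obtain ⟨h, hh, rfl⟩ := ha
        exact ⟨algebraMap k F c * h, mul_mem (P.algebraMap_mem c) hh, by
          rw [mul_smul, algebraMap_smul]⟩
    obtain ⟨a, ha, hEq⟩ := key _ hmem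
    rwa [hgen.smul_D_injective hEq]
  · intro hmem
    exact Submodule.subset_span ⟨h, hmem, t, htO, rfl⟩

end Frobenius

/-! ### Existence and uniqueness of the Cartier operator -/

section Cartier

open KaehlerDifferential

variable {k : Type u} {F : Type v} [Field k] [Field F] [Algebra k F] {p : ℕ}

/-- The primitive is `((X + Y) ^ p - X ^ p - Y ^ p) / p`, a polynomial over `ℤ`. Its partial
derivatives are computed over `ℤ`, where `p` can be cancelled, and then evaluated at `f, g`. This
makes `f ↦ f ^ (p - 1) df` additive modulo exact forms. -/
theorem exists_pow_smul_D_add [Fact p.Prime] (k : Type u) {F : Type v} [Field k] [Field F]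
    [Algebra k F] (f g : F) : ∃ R : F, (f + g) ^ (p - 1) • D k F (f + g) =
      f ^ (p - 1) • D k F f + g ^ (p - 1) • D k F g + D k F R := by
  have hp : p.Prime := Fact.out
  let X : MvPolynomial (Fin 2) ℤ := MvPolynomial.X 0
  let Y : MvPolynomial (Fin 2) ℤ := MvPolynomial.X 1
  obtain ⟨r, hr⟩ := exists_add_pow_prime_eq hp X Y
  let φ : MvPolynomial (Fin 2) ℤ →ₐ[ℤ] F := MvPolynomial.aeval ![f, g]
  have hφX : φ X = f := by simp [φ, X]
  have hφY : φ Y = g := by simp [φ, Y]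
  let R : MvPolynomial (Fin 2) ℤ := X * Y * r
  have hR : (X + Y) ^ p = X ^ p + Y ^ p + p * R := by rw [hr]; ring
  have hpz : (p : MvPolynomial (Fin 2) ℤ) ≠ 0 := by exact_mod_cast hp.ne_zero
  have hder : ∀ i : Fin 2, (X + Y) ^ (p - 1) =
      (if i = 0 then X ^ (p - 1) else Y ^ (p - 1)) + MvPolynomial.pderiv i R := by
    intro i
    have h1 := congrArg (MvPolynomial.pderiv i) hR
    apply mul_left_cancel₀ hpz
    fin_cases i
    · simp [Derivation.leibniz_pow, X, Y, MvPolynomial.pderiv_X, -mul_eq_mul_left_iff] at h1 ⊢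
      linear_combination h1
    · simp [Derivation.leibniz_pow, X, Y, MvPolynomial.pderiv_X, -mul_eq_mul_left_iff] at h1 ⊢
      linear_combination h1
  have hD : ∀ q : MvPolynomial (Fin 2) ℤ, D k F (φ q) =
      φ (MvPolynomial.pderiv 0 q) • D k F f + φ (MvPolynomial.pderiv 1 q) • D k F g := by
    intro q
    induction q using MvPolynomial.induction_on with
    | C a => simp [φ]
    | add a b ha hb => simp only [map_add, ha, hb, add_smul]; abel
    | mul_X a i ha =>
      rw [map_mul, Derivation.leibniz, ha]
      fin_cases i
      · simp [φ, Derivation.leibniz, MvPolynomial.pderiv_X, add_smul, smul_smul]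
        abel
      · simp [φ, Derivation.leibniz, MvPolynomial.pderiv_X, add_smul, smul_smul]
        abel
  refine ⟨φ R, ?_⟩
  have h0 := congrArg φ (hder 0)
  have h1 := congrArg φ (hder 1)
  simp only [map_pow, map_add, hφX, hφY, if_true, one_ne_zero, if_false] at h0 h1
  rw [hD, map_add, smul_add]
  conv_lhs => rw [h0]
  rw [add_smul, ← h0, h1, add_smul]
  abel

variable [Fact p.Prime] [CharP F p]

/-- Write a differential uniquely as `(∑ c i ^ p * t ^ i) dt`; the operator extracts `c (p - 1)`.
Additivity holds because Frobenius is additive. -/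
theorem FrobGen.exists_cartier {t : F} (ht : FrobGen k p t) :
    ∃ C : Ω[F⁄k] →+ Ω[F⁄k], ∀ (c : F) (j : ℕ), j < p →
      C ((c ^ p * t ^ j) • D k F t) = if j = p - 1 then c • D k F t else 0 := by
  classical
  have hp : p.Prime := Fact.out
  let l : Fin p := ⟨p - 1, Nat.sub_lt hp.pos one_pos⟩
  have hex : ∀ ω : Ω[F⁄k], ∃ c : Fin p → F, ω = (∑ i, c i ^ p * t ^ (i : ℕ)) • D k F t := by
    intro ω
    obtain ⟨h, rfl⟩ := ht.span.exists_smul_D ω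
    obtain ⟨c, rfl⟩ := ht.span h
    exact ⟨c, rfl⟩
  choose γ hγ using hex
  have huniq : ∀ c c' : Fin p → F, (∑ i, c i ^ p * t ^ (i : ℕ)) • D k F t =
      (∑ i, c' i ^ p * t ^ (i : ℕ)) • D k F t → c = c' := by
    intro c c' h
    have h1 := ht.smul_D_injective h
    have h2 := ht.indep (c - c') (by
      simp only [Pi.sub_apply, sub_pow_char, sub_mul, Finset.sum_sub_distrib, h1, sub_self])
    exact sub_eq_zero.1 h2
  have hadd : ∀ ω ω', γ (ω + ω') = γ ω + γ ω' := by
    intro ω ω'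
    apply huniq
    rw [← hγ]
    simp only [Pi.add_apply, add_pow_char, add_mul, Finset.sum_add_distrib, add_smul, ← hγ]
  refine ⟨AddMonoidHom.mk' (fun ω => γ ω l • D k F t) fun ω ω' => ?_, fun c j hj => ?_⟩
  · simp only [hadd, Pi.add_apply, add_smul]
  · have : γ ((c ^ p * t ^ j) • D k F t) = Pi.single ⟨j, hj⟩ c := by
      apply huniq
      rw [← hγ]
      congr 1
      rw [Finset.sum_eq_single ⟨j, hj⟩]
      · simp
      · intro i _ hi
        rw [Pi.single_eq_of_ne hi, zero_pow hp.ne_zero, zero_mul]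
      · simp
    change γ ((c ^ p * t ^ j) • D k F t) l • D k F t = _
    rw [this]
    by_cases h : j = p - 1
    · subst h
      simp [l]
    · rw [if_neg h, Pi.single_eq_of_ne, zero_smul]
      intro h'
      exact h (congrArg Fin.val h').symm

/-- The axioms determine the operator because `t ^ i dt` is exact for `i < p - 1`, while `t ^ (p -
1) dt` must go to `dt`. For existence, the normalization on `f ^ (p - 1) df` is additive in `f`
modulo exact forms, so it suffices to check the monomials `c ^ p * t ^ i`. -/
theorem FrobGen.existsUnique_cartier {t : F} (ht : FrobGen k p t) :
    ∃! C : Ω[F⁄k] →+ Ω[F⁄k], IsCartierOperator k F p C := by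
  have hp : p.Prime := Fact.out
  have hp2 := hp.two_le
  obtain ⟨C, hC⟩ := ht.exists_cartier
  have hsmul : ∀ (g : F) (ω : Ω[F⁄k]), C (g ^ p • ω) = g • C ω := by
    intro g ω
    obtain ⟨h, rfl⟩ := ht.span.exists_smul_D ω
    obtain ⟨c, rfl⟩ := ht.span h
    simp only [Finset.sum_smul, Finset.smul_sum, map_sum]
    refine Finset.sum_congr rfl fun i _ => ?_
    rw [hC _ _ i.2, smul_smul, ← mul_assoc, ← mul_pow, hC _ _ i.2]
    split_ifs
    · rw [smul_smul]
    · rw [smul_zero]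
  have hexact : ∀ f : F, C (D k F f) = 0 := by
    intro f
    obtain ⟨c, rfl⟩ := ht.span f
    rw [D_sum_pow_char_mul, Finset.sum_smul, map_sum]
    refine Finset.sum_eq_zero fun i _ => ?_
    rcases Nat.eq_zero_or_pos (i : ℕ) with h0 | h0
    · rw [h0]; simp
    · have hi : (((i : ℕ) : F)) ^ p = ((i : ℕ) : F) := by
        rw [← frobenius_def, map_natCast]
      have hlt := i.2
      rw [← hi, ← mul_assoc, ← mul_pow, hC _ _ (by omega), if_neg (by omega)]
  refine ⟨C, ⟨hsmul, hexact, ?_⟩, ?_⟩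
  · have hadd : ∀ f g : F, C (f ^ (p - 1) • D k F f) = D k F f →
        C (g ^ (p - 1) • D k F g) = D k F g →
        C ((f + g) ^ (p - 1) • D k F (f + g)) = D k F (f + g) := by
      intro f g hf hg
      obtain ⟨R, hR⟩ := exists_pow_smul_D_add (p := p) k f g
      rw [hR, map_add, map_add, hexact, hf, hg, add_zero, map_add]
    have hmono : ∀ (c : F) (i : ℕ),
        C ((c ^ p * t ^ i) ^ (p - 1) • D k F (c ^ p * t ^ i)) = D k F (c ^ p * t ^ i) := by
      intro c i
      rw [D_pow_char_mul, smul_smul]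
      rcases Nat.eq_zero_or_pos i with rfl | h0
      · simp
      · obtain ⟨j, rfl⟩ : ∃ j, i = j + 1 := ⟨i - 1, by omega⟩
        obtain ⟨q, hq⟩ : ∃ q, p = q + 1 := ⟨p - 1, by omega⟩
        -- Integer coefficients lie in the prime field, so they are their own `p`-th powers and pass
        -- through the operator unchanged.
        have hi : (((j + 1 : ℕ) : F)) ^ p = ((j + 1 : ℕ) : F) := by
          rw [← frobenius_def, map_natCast]
        have : (c ^ p * t ^ (j + 1)) ^ (p - 1) * (c ^ p * (((j + 1 : ℕ) : F) * t ^ (j + 1 - 1))) =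
            (((j + 1 : ℕ) : F) * c ^ p * t ^ j) ^ p * t ^ (p - 1) := by
          rw [mul_pow _ (t ^ j), mul_pow ((j + 1 : ℕ) : F), hi]
          subst hq
          simp only [Nat.add_sub_cancel]
          ring
        rw [this, hC _ _ (by omega), if_pos rfl]
        congr 1
        simp only [Nat.add_sub_cancel]
        ring
    intro f
    obtain ⟨c, rfl⟩ := ht.span f
    induction (Finset.univ : Finset (Fin p)) using Finset.cons_induction with
    | empty => simp
    | cons a s ha ih =>
      rw [Finset.sum_cons]
      exact hadd _ _ (hmono _ _) ih
  · intro C' hC'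
    ext ω
    obtain ⟨h, rfl⟩ := ht.span.exists_smul_D ω
    obtain ⟨c, rfl⟩ := ht.span h
    simp only [Finset.sum_smul, map_sum]
    refine Finset.sum_congr rfl fun i _ => ?_
    rw [hC _ _ i.2, mul_smul, hC'.pow_smul]
    split_ifs with h
    · rw [h, hC'.pow_sub_one_smul]
    · have hlt := i.2
      have hne : (((i : ℕ) + 1 : ℕ) : F) ≠ 0 := by
        intro h0
        have := (CharP.cast_eq_zero_iff F p _).1 h0
        have := Nat.le_of_dvd (by omega) this
        omega
      have hpow : (((((i : ℕ) + 1 : ℕ) : F))⁻¹) ^ p = ((((i : ℕ) + 1 : ℕ) : F))⁻¹ := by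
        rw [inv_pow, ← frobenius_def, map_natCast]
      have : t ^ (i : ℕ) • D k F t =
          D k F (((((i : ℕ) + 1 : ℕ) : F))⁻¹ ^ p * t ^ ((i : ℕ) + 1)) := by
        rw [D_pow_char_mul, hpow, Nat.add_sub_cancel, inv_mul_cancel_left₀ hne]
      rw [this, hC'.exact, smul_zero]

end Cartier


/-! ### Valuations on a cyclic cubic Kummer extension of `k(x)` -/

section Kummer

open Polynomial

variable {k : Type u} {F : Type v} [Field k] [Field F] [Algebra k F]

/-- `y` is a Kummer generator for the cyclic cubic extension `F / k(x)` with automorphism `σ`. -/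
structure Kummer (σ : F ≃ₐ[k] F) (ζ : k) (x y : F) : Prop where
  prim : IsPrimitiveRoot ζ 3
  iterate_three : ∀ b, σ (σ (σ b)) = b
  fixed_iff : ∀ b, σ b = b ↔ b ∈ k⟮x⟯
  trans : Transcendental k x
  ne_zero : y ≠ 0
  act : σ y = algebraMap k F ζ * y

theorem _root_.IsPrimitiveRoot.three_ne_zero {ζ : k} (h : IsPrimitiveRoot ζ 3) : (3 : k) ≠ 0 := by
  have := h.neZero'.ne
  exact_mod_cast this

theorem _root_.IsPrimitiveRoot.one_add_self_add_sq {ζ : k} (h : IsPrimitiveRoot ζ 3) :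
    1 + ζ + ζ ^ 2 = 0 := by
  have := h.geom_sum_eq_zero (by norm_num)
  simpa [Finset.sum_range_succ] using this

theorem aeval_ne_zero_of_transcendental {x : F} (hx : Transcendental k x) {A : k[X]} (hA : A ≠ 0) :
    aeval x A ≠ 0 := fun h => hx ⟨A, hA, h⟩

theorem aeval_mem_adjoin_simple (x : F) (A : k[X]) : aeval x A ∈ k⟮x⟯ :=
  IntermediateField.algebra_adjoin_le_adjoin k _ (aeval_mem_adjoin_singleton k x)

/-- Normal form at the origin of a rational function. -/
theorem exists_zpow_mul_aeval_div_of_mem_adjoin {x : F} (hx : Transcendental k x) {r : F} (hr : r ≠ 0)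
    (h : r ∈ k⟮x⟯) : ∃ (n : ℤ) (A B : k[X]), A.eval 0 ≠ 0 ∧ B.eval 0 ≠ 0 ∧
      r = x ^ n * (aeval x A / aeval x B) := by
  obtain ⟨A, B, rfl⟩ := (IntermediateField.mem_adjoin_simple_iff k r).1 h
  have hx0 : x ≠ 0 := fun h0 => hx (h0 ▸ isAlgebraic_zero)
  have hA : A ≠ 0 := by rintro rfl; simp at hr
  have hB : B ≠ 0 := by rintro rfl; simp at hr
  have key : ∀ A : k[X], A ≠ 0 → ∃ (n : ℕ) (A' : k[X]), A'.eval 0 ≠ 0 ∧ A = X ^ n * A' := by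
    intro A hA
    obtain ⟨A', h1, h2⟩ := Polynomial.exists_eq_pow_rootMultiplicity_mul_and_not_dvd A hA 0
    rw [C_0, sub_zero] at h1 h2
    refine ⟨_, A', fun h0 => h2 ?_, h1⟩
    rwa [X_dvd_iff, coeff_zero_eq_eval_zero]
  obtain ⟨m, A', hA', rfl⟩ := key A hA
  obtain ⟨n, B', hB', rfl⟩ := key B hB
  refine ⟨(m : ℤ) - n, A', B', hA', hB', ?_⟩
  have hB0 : aeval x B' ≠ 0 := aeval_ne_zero_of_transcendental hx (right_ne_zero_of_mul hB)
  rw [zpow_sub₀ hx0]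
  simp only [map_mul, map_pow, aeval_X, zpow_natCast]
  field_simp

theorem Kummer.map_fixed {σ : F ≃ₐ[k] F} {ζ : k} {x y : F} (h : Kummer σ ζ x y) : σ x = x :=
  (h.fixed_iff x).2 (IntermediateField.mem_adjoin_simple_self k x)

theorem Kummer.cube_mem {σ : F ≃ₐ[k] F} {ζ : k} {x y : F} (h : Kummer σ ζ x y) : y ^ 3 ∈ k⟮x⟯ := by
  rw [← h.fixed_iff, map_pow, h.act, mul_pow, ← map_pow, h.prim.pow_eq_one, map_one, one_mul]

/-- The coefficients are the projections of `b` to the three eigenspaces of `σ` (Lagrange resolvents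
over `3`), divided by `1`, `y`, `y ^ 2` to make them `σ`-invariant. -/
theorem Kummer.decomposition {σ : F ≃ₐ[k] F} {ζ : k} {x y : F} (h : Kummer σ ζ x y) (b : F) :
    ∃ b₀ ∈ k⟮x⟯, ∃ b₁ ∈ k⟮x⟯, ∃ b₂ ∈ k⟮x⟯, b = b₀ + b₁ * y + b₂ * y ^ 2 := by
  have h3 : (3 : F) ≠ 0 := by
    rw [← map_ofNat (algebraMap k F) 3]
    exact (_root_.map_ne_zero _).2 h.prim.three_ne_zero
  have hy := h.ne_zero
  set z : F := algebraMap k F ζ with hz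
  have hz3 : z ^ 3 = 1 := by rw [hz, ← map_pow, h.prim.pow_eq_one, map_one]
  have hz0 : z ≠ 0 := by rintro h0; rw [h0] at hz3; simp at hz3
  have hsum : 1 + z + z ^ 2 = 0 := by
    have := congrArg (algebraMap k F) h.prim.one_add_self_add_sq
    simpa using this
  have hσz : σ z = z := σ.commutes ζ
  have hσ3 := h.iterate_three b
  have hact := h.act
  refine ⟨(b + σ b + σ (σ b)) / 3, (h.fixed_iff _).1 ?_,
    (b + z ^ 2 * σ b + z * σ (σ b)) / (3 * y), (h.fixed_iff _).1 ?_,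
    (b + z * σ b + z ^ 2 * σ (σ b)) / (3 * y ^ 2), (h.fixed_iff _).1 ?_, ?_⟩
  · simp only [map_div₀, map_add, hσ3, map_ofNat]
    ring
  · simp only [map_div₀, map_add, map_mul, map_pow, hσ3, map_ofNat, hσz, hact]
    rw [div_eq_div_iff (by positivity) (by positivity)]
    linear_combination (-3 * y * σ b) * hz3
  · simp only [map_div₀, map_add, map_mul, map_pow, hσ3, map_ofNat, hσz, hact]
    rw [div_eq_div_iff (by positivity) (by positivity)]
    linear_combination (-3 * y ^ 2 * (σ b + z * σ (σ b))) * hz3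
  · field_simp
    linear_combination (-σ b - σ (σ b)) * hsum

variable (V : ValuationSubring F)

theorem valuation_aeval_eq_one (hk : ∀ c : k, algebraMap k F c ∈ V) {ξ : F} (hξ : V.valuation ξ < 1)
    {A : k[X]} (hA : A.eval 0 ≠ 0) : V.valuation (aeval ξ A) = 1 := by
  have hξV : ξ ∈ V := (V.valuation_le_one_iff ξ).1 hξ.le
  have hpoly : ∀ B : k[X], aeval ξ B ∈ V := by
    intro B
    rw [aeval_eq_sum_range]
    refine sum_mem (S := V.toSubring) fun i _ => ?_
    rw [Algebra.smul_def]
    exact mul_mem (hk _) (pow_mem hξV i)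
  have hc : V.valuation (algebraMap k F (A.eval 0)) = 1 := by
    apply le_antisymm ((V.valuation_le_one_iff _).2 (hk _))
    have h1 := (V.valuation_le_one_iff _).2 (hk (A.eval 0)⁻¹)
    rw [map_inv₀, map_inv₀] at h1
    exact (inv_le_one₀ (by simpa [zero_lt_iff] using hA)).1 h1
  have hdec : aeval ξ A = ξ * aeval ξ A.divX + algebraMap k F (A.eval 0) := by
    conv_lhs => rw [← X_mul_divX_add A]
    simp [coeff_zero_eq_eval_zero]
  rw [hdec, Valuation.map_add_eq_of_lt_right, hc]
  rw [hc, map_mul]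
  exact mul_lt_one_of_lt_of_le hξ ((V.valuation_le_one_iff _).2 (hpoly _))

theorem aeval_mem_valuationSubring (hk : ∀ c : k, algebraMap k F c ∈ V) {ξ : F} (hξ : ξ ∈ V)
    (B : k[X]) : aeval ξ B ∈ V := by
  rw [aeval_eq_sum_range]
  refine sum_mem (S := V.toSubring) fun i _ => ?_
  rw [Algebra.smul_def]
  exact mul_mem (hk _) (pow_mem hξ i)

theorem valuation_zpow_mul_aeval_div (hk : ∀ c : k, algebraMap k F c ∈ V) {ξ : F}
    (hξ : V.valuation ξ < 1) {A B : k[X]} (hA : A.eval 0 ≠ 0) (hB : B.eval 0 ≠ 0) (n : ℤ) :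
    V.valuation (ξ ^ n * (aeval ξ A / aeval ξ B)) = V.valuation ξ ^ n := by
  rw [map_mul, map_div₀, valuation_aeval_eq_one V hk hξ hA, valuation_aeval_eq_one V hk hξ hB,
    div_one, mul_one, map_zpow₀]

/-- The exponent is the order of `r` at the origin of the line, so it is the same for every `V`
above `ξ = 0`. This uniformity is what later allows two points to be compared. -/
theorem exists_valuation_eq_zpow_of_mem_adjoin {ξ : F} (hx : Transcendental k ξ) {r : F}
    (hr : r ≠ 0) (h : r ∈ k⟮ξ⟯) : ∃ n : ℤ, ∀ V : ValuationSubring F,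
      (∀ c : k, algebraMap k F c ∈ V) → V.valuation ξ < 1 → V.valuation r = V.valuation ξ ^ n := by
  obtain ⟨n, A, B, hA, hB, rfl⟩ := exists_zpow_mul_aeval_div_of_mem_adjoin hx hr h
  exact ⟨n, fun V hk hξ => valuation_zpow_mul_aeval_div V hk hξ hA hB n⟩

/-- The predicates `p` and `q` stand for disjoint sets of exponents (residue classes modulo `3` in
the application), which exclude equal values and so cancellation. -/
theorem valuation_add_of_disjoint {w : V.ValueGroup} (hw0 : 0 < w) (hw1 : w < 1) {a c : F}
    {p q : ℤ → Prop} (hpq : ∀ n, p n → ¬ q n) (ha : a = 0 ∨ ∃ n, p n ∧ V.valuation a = w ^ n)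
    (hc : c = 0 ∨ ∃ n, q n ∧ V.valuation c = w ^ n) :
    a + c = 0 ∨ ∃ n, (p n ∨ q n) ∧ V.valuation (a + c) = w ^ n := by
  rcases ha with rfl | ⟨m, hm, ha⟩
  · rw [zero_add]
    exact hc.imp id fun ⟨n, hn, h⟩ => ⟨n, Or.inr hn, h⟩
  rcases hc with rfl | ⟨n, hn, hc⟩
  · rw [add_zero]
    exact Or.inr ⟨m, Or.inl hm, ha⟩
  right
  have hne : V.valuation a ≠ V.valuation c := by
    rw [ha, hc]
    intro h
    have := zpow_right_injective₀ hw0 hw1.ne h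
    exact hpq m hm (this ▸ hn)
  rw [Valuation.map_add_of_distinct_val _ hne]
  rcases max_choice (V.valuation a) (V.valuation c) with h | h
  · exact ⟨m, Or.inl hm, h.trans ha⟩
  · exact ⟨n, Or.inr hn, h.trans hc⟩

variable {V} {σ : F ≃ₐ[k] F} {ζ : k} {ξ z : F}

/-- Since `ξ` is a unit times `z ^ 3`, the summands `b₀`, `b₁ z`, `b₂ z ^ 2` have values whose
exponents in `z` lie in different classes modulo `3`, so one of them dominates. -/
theorem Kummer.ramified_valuation (h : Kummer σ ζ ξ z) (hk : ∀ c : k, algebraMap k F c ∈ V)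
    (hξ : V.valuation ξ < 1) {g : k[X]} (hg : g.eval 0 ≠ 0) (hz : z ^ 3 = ξ * aeval ξ g) :
    V.valuation z ^ 3 = V.valuation ξ ∧ V.valuation z < 1 ∧
      ∀ b : F, b ≠ 0 → ∃ n : ℤ, V.valuation b = V.valuation z ^ n := by
  have h3 : V.valuation z ^ 3 = V.valuation ξ := by
    rw [← map_pow, hz, map_mul, valuation_aeval_eq_one V hk hξ hg, mul_one]
  have hlt : V.valuation z < 1 := by
    by_contra hcon
    push Not at hcon
    rw [← h3] at hξ
    exact absurd (one_le_pow₀ hcon (n := 3)) (not_le.2 hξ)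
  have hpos : 0 < V.valuation z := by simpa [zero_lt_iff] using h.ne_zero
  refine ⟨h3, hlt, fun b hb => ?_⟩
  obtain ⟨b₀, h0, b₁, h1, b₂, h2, rfl⟩ := h.decomposition b
  have key : ∀ (r : F) (_ : r ∈ k⟮ξ⟯) (i : ℕ), r * z ^ i = 0 ∨
      ∃ n : ℤ, (∃ m : ℤ, n = 3 * m + i) ∧ V.valuation (r * z ^ i) = V.valuation z ^ n := by
    intro r hr i
    rcases eq_or_ne r 0 with rfl | hr0
    · simp
    right
    obtain ⟨n, hn⟩ := exists_valuation_eq_zpow_of_mem_adjoin h.trans hr0 hr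
    refine ⟨3 * n + i, ⟨n, rfl⟩, ?_⟩
    rw [map_mul, hn V hk hξ, ← h3, map_pow, zpow_add₀ hpos.ne', zpow_mul]
    simp
  have e0 := key b₀ h0 0
  have e1 := key b₁ h1 1
  have e2 := key b₂ h2 2
  have e01 := valuation_add_of_disjoint V hpos hlt (by
    rintro n ⟨m, rfl⟩ ⟨m', hm⟩; omega) e0 e1
  have e012 := valuation_add_of_disjoint V hpos hlt (by
    rintro n (⟨m, rfl⟩ | ⟨m, rfl⟩) ⟨m', hm⟩ <;> omega) e01 e2
  simp only [pow_zero, mul_one, pow_one] at e012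
  obtain ⟨n, -, hn⟩ := e012.resolve_left hb
  exact ⟨n, hn⟩

/-- Newton approximations, by polynomials, of a cube root of `g` with constant term `c`. -/
noncomputable def cubeRootApprox (g : k[X]) (c : k) : ℕ → k[X]
  | 0 => C c
  | n + 1 => cubeRootApprox g c n - C (3 * c ^ 2)⁻¹ * (cubeRootApprox g c n ^ 3 - g)

theorem cubeRootApprox_eval_zero {g : k[X]} {c : k} (hc : c ^ 3 = g.eval 0) (n : ℕ) :
    (cubeRootApprox g c n).eval 0 = c := by
  induction n with
  | zero => simp [cubeRootApprox]
  | succ n ih => simp [cubeRootApprox, ih, hc]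

theorem aeval_eq_add_mul (ξ : F) (A : k[X]) :
    aeval ξ A = algebraMap k F (A.eval 0) + ξ * aeval ξ A.divX := by
  conv_lhs => rw [← X_mul_divX_add A]
  simp [coeff_zero_eq_eval_zero, add_comm]

/-- The Newton step keeps the derivative frozen at `3 c ^ 2`. Since `z ^ 2 + z s + s ^ 2 ≡ 3 c ^ 2`
modulo `ξ`, each step still gains one power of `ξ`, and the approximations stay polynomial in `ξ`.
-/
theorem cubeRootApprox_spec (hk : ∀ c : k, algebraMap k F c ∈ V) (hξ : V.valuation ξ < 1)
    (h3 : (3 : k) ≠ 0) {g : k[X]} {c : k} (hc0 : c ≠ 0) (hc : c ^ 3 = g.eval 0)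
    (hz : z ^ 3 = aeval ξ g) (hzc : V.valuation (z - algebraMap k F c) < 1) (n : ℕ) :
    ∃ e ∈ V, z = aeval ξ (cubeRootApprox g c n) + ξ ^ (n + 1) * e := by
  have hξV : ξ ∈ V := (V.valuation_le_one_iff ξ).1 hξ.le
  set γ := algebraMap k F c with hγ
  have hγ0 : γ ≠ 0 := by simpa [hγ] using hc0
  have h3F : (3 : F) ≠ 0 := by
    rw [← map_ofNat (algebraMap k F) 3]
    exact (_root_.map_ne_zero _).2 h3
  have hzV : z - γ ∈ V := (V.valuation_le_one_iff _).1 hzc.le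
  have hγV : γ ∈ V := hk c
  have hinv : (3 * γ ^ 2)⁻¹ ∈ V := by
    have := hk (3 * c ^ 2)⁻¹
    simpa only [hγ, map_inv₀, map_mul, map_pow, map_ofNat] using this
  have hunit : V.valuation (z ^ 2 + z * γ + γ ^ 2) = 1 := by
    have h1 : z ^ 2 + z * γ + γ ^ 2 = (z - γ) * ((z - γ) + 3 * γ) + 3 * γ ^ 2 := by ring
    have h2 : V.valuation (3 * γ ^ 2) = 1 := by
      apply le_antisymm
      · have := hk (3 * c ^ 2)
        rw [V.valuation_le_one_iff]
        simpa only [hγ, map_inv₀, map_mul, map_pow, map_ofNat] using this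
      · rw [← V.valuation_le_one_iff, map_inv₀] at hinv
        exact (inv_le_one₀ (by rw [zero_lt_iff]; simp [h3F, hγ0])).1 hinv
    rw [h1, Valuation.map_add_eq_of_lt_right, h2]
    rw [h2, map_mul]
    refine mul_lt_one_of_lt_of_le hzc ((V.valuation_le_one_iff _).2 (add_mem hzV ?_))
    have := hk (3 * c)
    simpa only [hγ, map_inv₀, map_mul, map_pow, map_ofNat] using this
  have hbase : ∃ e ∈ V, z = γ + ξ * e := by
    refine ⟨aeval ξ g.divX / (z ^ 2 + z * γ + γ ^ 2), ?_, ?_⟩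
    · rw [← V.valuation_le_one_iff, map_div₀, hunit, div_one, V.valuation_le_one_iff]
      exact aeval_mem_valuationSubring V hk hξV _
    · have hne : z ^ 2 + z * γ + γ ^ 2 ≠ 0 := by
        intro h0
        rw [h0, map_zero] at hunit
        exact zero_ne_one hunit
      have h4 := aeval_eq_add_mul ξ g
      rw [← hc, map_pow, ← hz] at h4
      have h5 : (z - γ) * (z ^ 2 + z * γ + γ ^ 2) = ξ * aeval ξ g.divX := by
        linear_combination h4
      rw [← mul_div_assoc, ← h5, mul_div_cancel_right₀ _ hne, add_sub_cancel]
  induction n with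
  | zero => simpa [cubeRootApprox] using hbase
  | succ n ih =>
    obtain ⟨e, he, hze⟩ := ih
    obtain ⟨e0, he0, hze0⟩ := hbase
    have hs := aeval_eq_add_mul ξ (cubeRootApprox g c n)
    rw [cubeRootApprox_eval_zero hc] at hs
    set s := aeval ξ (cubeRootApprox g c n) with hsdef
    set s' := aeval ξ (cubeRootApprox g c n).divX with hs'
    have hs'V : s' ∈ V := aeval_mem_valuationSubring V hk hξV _
    rw [← hγ] at hs
    -- The new error is `(z - s) * (1 - (3 γ ^ 2)⁻¹ (z ^ 2 + z s + s ^ 2))`. Substituting `z = γ + ξ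
    -- e0` and `s = γ + ξ s'` exhibits the extra factor `ξ`.
    refine ⟨-e * ((3 * γ ^ 2)⁻¹ * (3 * γ * (e0 + s') + ξ * (e0 ^ 2 + e0 * s' + s' ^ 2))), ?_, ?_⟩
    · have h3γ : 3 * γ ∈ V := by
        have := hk (3 * c)
        simpa only [hγ, map_inv₀, map_mul, map_pow, map_ofNat] using this
      exact mul_mem (neg_mem he) (mul_mem hinv (add_mem (mul_mem h3γ (add_mem he0 hs'V))
        (mul_mem hξV (add_mem (add_mem (pow_mem he0 2) (mul_mem he0 hs'V)) (pow_mem hs'V 2)))))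
    · have hstep : aeval ξ (cubeRootApprox g c (n + 1)) = s - (3 * γ ^ 2)⁻¹ * (s ^ 3 - z ^ 3) := by
        simp only [cubeRootApprox, hsdef, hz, hγ, map_sub, map_mul, aeval_C, map_pow, map_inv₀, map_ofNat]
      rw [hstep]
      have hz3 : z ^ 3 - s ^ 3 = (ξ ^ (n + 1) * e) * (z ^ 2 + z * s + s ^ 2) := by
        linear_combination (z ^ 2 + z * s + s ^ 2) * hze
      have hquad : z ^ 2 + z * s + s ^ 2 = 3 * γ ^ 2 +
          ξ * (3 * γ * (e0 + s') + ξ * (e0 ^ 2 + e0 * s' + s' ^ 2)) := by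
        rw [hze0, hs]; ring
      have hu : (3 * γ ^ 2)⁻¹ * (3 * γ ^ 2) = 1 := inv_mul_cancel₀ (by simp [h3F, hγ0])
      have hpow : ξ ^ (n + 1 + 1) = ξ ^ (n + 1) * ξ := pow_succ _ _
      rw [hpow]
      linear_combination hze + (-(3 * γ ^ 2)⁻¹) * hz3 - (3 * γ ^ 2)⁻¹ * ξ ^ (n + 1) * e * hquad -
        ξ ^ (n + 1) * e * hu

/-- Near an unramified point every function is approximated by rational functions of `ξ`. -/
theorem Kummer.exists_approx (h : Kummer σ ζ ξ z) {g : k[X]} {c : k} (hc0 : c ≠ 0)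
    (hc : c ^ 3 = g.eval 0) (hz : z ^ 3 = aeval ξ g) (b : F) (n : ℕ) :
    ∃ r ∈ k⟮ξ⟯, ∀ V : ValuationSubring F, (∀ c : k, algebraMap k F c ∈ V) → V.valuation ξ < 1 →
      V.valuation (z - algebraMap k F c) < 1 → ∃ e ∈ V, b = r + ξ ^ n * e := by
  have hξ0 : ξ ≠ 0 := fun h0 => h.trans (h0 ▸ isAlgebraic_zero)
  obtain ⟨b₀, h0, b₁, h1, b₂, h2, rfl⟩ := h.decomposition b
  have hbd : ∀ r ∈ k⟮ξ⟯, ∃ M : ℕ, ∀ V : ValuationSubring F, (∀ c : k, algebraMap k F c ∈ V) →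
      V.valuation ξ < 1 → ∀ m, M ≤ m → ξ ^ m * r ∈ V := by
    intro r hr
    rcases eq_or_ne r 0 with rfl | hr0
    · exact ⟨0, fun V _ _ m _ => by rw [mul_zero]; exact zero_mem _⟩
    obtain ⟨j, hj⟩ := exists_valuation_eq_zpow_of_mem_adjoin h.trans hr0 hr
    refine ⟨j.natAbs, fun V hk hξ m hm => ?_⟩
    rw [← V.valuation_le_one_iff, map_mul, hj V hk hξ, map_pow, ← zpow_natCast, ← zpow_add₀ (by simpa using hξ0)]
    have : 0 ≤ (m : ℤ) + j := by omega
    lift (m : ℤ) + j to ℕ using this with l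
    rw [zpow_natCast]
    exact pow_le_one₀ zero_le hξ.le
  obtain ⟨M₁, hM₁⟩ := hbd b₁ h1
  obtain ⟨M₂, hM₂⟩ := hbd b₂ h2
  -- The additional precision `max M₁ M₂` absorbs the poles of `b₁` and `b₂`; it is fixed before any
  -- `V` is chosen.
  set s := aeval ξ (cubeRootApprox g c (n + max M₁ M₂)) with hs
  have hsK : s ∈ k⟮ξ⟯ := aeval_mem_adjoin_simple _ _
  refine ⟨b₀ + b₁ * s + b₂ * s ^ 2, add_mem (add_mem h0 (mul_mem h1 hsK)) (mul_mem h2 (pow_mem hsK 2)),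
    fun V hk hξ hzc => ?_⟩
  have hξV : ξ ∈ V := (V.valuation_le_one_iff ξ).1 hξ.le
  obtain ⟨e, he, hze⟩ := cubeRootApprox_spec hk hξ h.prim.three_ne_zero hc0 hc hz hzc
    (n + max M₁ M₂)
  rw [← hs] at hze
  have hsV : s ∈ V := aeval_mem_valuationSubring V hk hξV _
  have hzV : z ∈ V := by
    rw [hze]; exact add_mem hsV (mul_mem (pow_mem hξV _) he)
  refine ⟨e * (ξ ^ (max M₁ M₂ + 1) * b₁ + ξ ^ (max M₁ M₂ + 1) * b₂ * (z + s)), ?_, ?_⟩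
  · exact mul_mem he (add_mem (hM₁ V hk hξ _ (by omega))
      (mul_mem (hM₂ V hk hξ _ (by omega)) (add_mem hzV hsV)))
  · linear_combination (b₁ + b₂ * (z + s)) * hze

/-- For a cube root `c` of `g(0)`, the product of `z - c`, `z - ζ c`, `z - ζ² c` is `z ^ 3 - g(0)`,
a multiple of `ξ`; so some factor lies in the maximal ideal. -/
theorem Kummer.exists_cubeRoot_residue [IsAlgClosed k] (hζ : IsPrimitiveRoot ζ 3)
    (hk : ∀ c : k, algebraMap k F c ∈ V) (hξ : V.valuation ξ < 1) {g : k[X]}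
    (hz : z ^ 3 = aeval ξ g) :
    ∃ c : k, c ^ 3 = g.eval 0 ∧ V.valuation (z - algebraMap k F c) < 1 := by
  obtain ⟨c, hc⟩ := IsAlgClosed.exists_pow_nat_eq (g.eval 0) (n := 3) (by norm_num)
  have hξV : ξ ∈ V := (V.valuation_le_one_iff ξ).1 hξ.le
  have hprod : (z - algebraMap k F c) * (z - algebraMap k F (ζ * c)) *
      (z - algebraMap k F (ζ ^ 2 * c)) = ξ * aeval ξ g.divX := by
    have h4 := aeval_eq_add_mul ξ g
    rw [← hc, map_pow, ← hz] at h4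
    have hsum := congrArg (algebraMap k F) hζ.one_add_self_add_sq
    have h3 := congrArg (algebraMap k F) hζ.pow_eq_one
    simp only [map_add, map_one, map_pow, map_zero, map_mul] at hsum h3 ⊢
    set w := algebraMap k F ζ
    set d := algebraMap k F c
    linear_combination h4 + (-(z ^ 2) * d + z * d ^ 2 * w) * hsum - d ^ 3 * h3
  by_contra! hcon
  have h1 := hcon c hc
  have h2 := hcon (ζ * c) (by rw [mul_pow, hζ.pow_eq_one, one_mul, hc])
  have h3 := hcon (ζ ^ 2 * c) (by rw [mul_pow, ← pow_mul, mul_comm 2 3, pow_mul, hζ.pow_eq_one,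
    one_pow, one_mul, hc])
  have h4 : V.valuation (ξ * aeval ξ g.divX) < 1 := by
    rw [map_mul]
    exact mul_lt_one_of_lt_of_le hξ ((V.valuation_le_one_iff _).2
      (aeval_mem_valuationSubring V hk hξV _))
  rw [← hprod, map_mul, map_mul] at h4
  exact absurd (one_le_mul (one_le_mul h1 h2) h3) (not_le.2 h4)

/-- Some power `ξ ^ M` bounds the value of `b` from below. Approximating `b` modulo `ξ ^ (M + 1)` by
a rational function `r` then gives the same value, and the value of `r` is a power of that of `ξ`.
-/
theorem Kummer.unramified_valuation [IsAlgClosed k] (h : Kummer σ ζ ξ z)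
    (hk : ∀ c : k, algebraMap k F c ∈ V)
    (hξ : V.valuation ξ < 1) {g : k[X]} (hg : g.eval 0 ≠ 0) (hz : z ^ 3 = aeval ξ g) :
    V.valuation z = 1 ∧ ∀ b : F, b ≠ 0 → ∃ n : ℤ, V.valuation b = V.valuation ξ ^ n := by
  have hξ0 : ξ ≠ 0 := fun h0 => h.trans (h0 ▸ isAlgebraic_zero)
  have hpos : 0 < V.valuation ξ := by simpa [zero_lt_iff] using hξ0
  constructor
  · have h1 : V.valuation z ^ 3 = 1 := by rw [← map_pow, hz, valuation_aeval_eq_one V hk hξ hg]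
    exact (pow_eq_one_iff_of_nonneg zero_le (by norm_num)).1 h1
  obtain ⟨c, hc, hzc⟩ := Kummer.exists_cubeRoot_residue h.prim hk hξ hz
  have hc0 : c ≠ 0 := by
    rintro rfl
    apply hg
    rw [← hc]
    norm_num
  have hbd : ∀ b : F, ∃ M : ℕ, ξ ^ M * b ∈ V := by
    intro b
    obtain ⟨r, hr, hV⟩ := h.exists_approx hc0 hc hz b 0
    obtain ⟨e, he, rfl⟩ := hV V hk hξ hzc
    rcases eq_or_ne r 0 with rfl | hr0
    · exact ⟨0, by simpa using he⟩
    obtain ⟨j, hj⟩ := exists_valuation_eq_zpow_of_mem_adjoin h.trans hr0 hr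
    refine ⟨j.natAbs, ?_⟩
    have hξV : ξ ∈ V := (V.valuation_le_one_iff ξ).1 hξ.le
    rw [mul_add]
    refine add_mem ?_ (mul_mem (pow_mem hξV _) (by simpa using he))
    rw [← V.valuation_le_one_iff, map_mul, hj V hk hξ, map_pow, ← zpow_natCast,
      ← zpow_add₀ hpos.ne']
    have : 0 ≤ (j.natAbs : ℤ) + j := by omega
    lift (j.natAbs : ℤ) + j to ℕ using this with l
    rw [zpow_natCast]
    exact pow_le_one₀ zero_le hξ.le
  intro b hb
  obtain ⟨M, hM⟩ := hbd b⁻¹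
  have hMb : V.valuation ξ ^ M ≤ V.valuation b := by
    rw [← V.valuation_le_one_iff, map_mul, map_inv₀, map_pow] at hM
    have hbpos : 0 < V.valuation b := by simpa [zero_lt_iff] using hb
    rwa [mul_inv_le_iff₀ hbpos, one_mul] at hM
  obtain ⟨r, hr, hV⟩ := h.exists_approx hc0 hc hz b (M + 1)
  obtain ⟨e, he, hbe⟩ := hV V hk hξ hzc
  have hlt : V.valuation (ξ ^ (M + 1) * e) < V.valuation b := by
    refine lt_of_lt_of_le ?_ hMb
    rw [map_mul, map_pow]
    calc _ ≤ V.valuation ξ ^ (M + 1) * 1 := by gcongr; exact (V.valuation_le_one_iff e).2 he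
      _ < _ := by
        rw [mul_one]
        exact pow_lt_pow_right_of_lt_one₀ hpos hξ (Nat.lt_succ_self M)
  have hrb : V.valuation r = V.valuation b := by
    have : r = b - ξ ^ (M + 1) * e := by rw [hbe]; ring
    rw [this, Valuation.map_sub_eq_of_lt_left _ hlt]
  have hr0 : r ≠ 0 := by
    rintro rfl
    rw [map_zero] at hrb
    exact hb (by simpa using hrb.symm)
  obtain ⟨j, hj⟩ := exists_valuation_eq_zpow_of_mem_adjoin h.trans hr0 hr
  exact ⟨j, hrb ▸ hj V hk hξ⟩

/-- At both points `b` differs from the same rational function `r` by a regular element, and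
regularity of `r` depends only on its order at `ξ = 0`. Hence the local rings coincide. -/
theorem Kummer.point_unique (h : Kummer σ ζ ξ z) {g : k[X]} {c : k} (hc0 : c ≠ 0)
    (hc : c ^ 3 = g.eval 0) (hz : z ^ 3 = aeval ξ g) {P Q : Point k F}
    (hP : P.localRing.valuation ξ < 1) (hPc : P.localRing.valuation (z - algebraMap k F c) < 1)
    (hQ : Q.localRing.valuation ξ < 1) (hQc : Q.localRing.valuation (z - algebraMap k F c) < 1) :
    P = Q := by
  have hξ0 : ξ ≠ 0 := fun h0 => h.trans (h0 ▸ isAlgebraic_zero)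
  have key : ∀ P Q : Point k F, P.localRing.valuation ξ < 1 →
      P.localRing.valuation (z - algebraMap k F c) < 1 → Q.localRing.valuation ξ < 1 →
      Q.localRing.valuation (z - algebraMap k F c) < 1 → P.localRing ≤ Q.localRing := by
    intro P Q hP hPc hQ hQc b hb
    obtain ⟨r, hr, hV⟩ := h.exists_approx hc0 hc hz b 0
    obtain ⟨e, he, hbe⟩ := hV _ P.algebraMap_mem hP hPc
    obtain ⟨e', he', hbe'⟩ := hV _ Q.algebraMap_mem hQ hQc
    rw [pow_zero, one_mul] at hbe hbe'
    rw [hbe']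
    refine add_mem ?_ he'
    have hrP : r ∈ P.localRing := by
      have : r = b - e := by rw [hbe]; ring
      rw [this]
      exact sub_mem hb he
    rcases eq_or_ne r 0 with rfl | hr0
    · exact zero_mem _
    obtain ⟨j, hj⟩ := exists_valuation_eq_zpow_of_mem_adjoin h.trans hr0 hr
    rw [← ValuationSubring.valuation_le_one_iff, hj _ P.algebraMap_mem hP] at hrP
    rw [← ValuationSubring.valuation_le_one_iff, hj _ Q.algebraMap_mem hQ]
    have hj0 : 0 ≤ j := by
      by_contra hneg
      push Not at hneg
      exact absurd hrP (not_le.2 (one_lt_zpow_of_neg₀ (by simpa [zero_lt_iff] using hξ0) hP hneg))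
    lift j to ℕ using hj0
    rw [zpow_natCast]
    exact pow_le_one₀ zero_le hQ.le
  have : P.localRing = Q.localRing := le_antisymm (key P Q hP hPc hQ hQc) (key Q P hQ hQc hP hPc)
  cases P
  cases Q
  congr

/-- Transcendence makes `ξ` a nonunit of `k[ξ]`, so some valuation ring of `F` contains `k[ξ]` with
`ξ` among its nonunits. -/
theorem exists_valuationSubring_of_transcendental (hξ : Transcendental k ξ) :
    ∃ V : ValuationSubring F, (∀ c : k, algebraMap k F c ∈ V) ∧ V.valuation ξ < 1 := by
  let A : Subring F := (Algebra.adjoin k {ξ}).toSubring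
  let a : A := ⟨ξ, Algebra.self_mem_adjoin_singleton k ξ⟩
  have hI : Ideal.span {a} ≠ ⊤ := by
    rw [Ne, Ideal.span_singleton_eq_top]
    intro hu
    obtain ⟨b, hb⟩ := hu.exists_right_inv
    have hb' : ξ * (b : F) = 1 := congrArg Subtype.val hb
    obtain ⟨B, hB⟩ := (Algebra.adjoin_singleton_eq_range_aeval k ξ ▸ b.2 :
      (b : F) ∈ (aeval ξ : k[X] →ₐ[k] F).range)
    rw [← hB] at hb'
    have h0 : aeval ξ (X * B - 1) = 0 := by
      simp only [map_sub, map_mul, aeval_X, map_one]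
      exact sub_eq_zero.2 hb'
    refine hξ ⟨X * B - 1, fun h1 => ?_, h0⟩
    have := congrArg (eval 0) h1
    simp at this
  obtain ⟨V, hAV, hIV⟩ := Ideal.image_subset_nonunits_valuationSubring (Ideal.span {a}) hI
  refine ⟨V, fun c => hAV ((Algebra.adjoin k {ξ}).algebraMap_mem c), ?_⟩
  exact V.mem_nonunits_iff.1 (hIV ⟨a, Ideal.mem_span_singleton_self a, rfl⟩)

/-- Otherwise every `x - a`, hence every nonzero polynomial in `x`, would be a unit. The local ring
would then contain `k(x)` and `y`, hence all of `F`. -/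
theorem Point.exists_valuation_sub_lt_one [IsAlgClosed k] {x y : F} (h : Kummer σ ζ x y)
    (P : Point k F) (hx : x ∈ P.localRing) :
    ∃ a : k, P.localRing.valuation (x - algebraMap k F a) < 1 := by
  by_contra! hcon
  have hone : ∀ a : k, P.localRing.valuation (x - algebraMap k F a) = 1 := fun a =>
    le_antisymm ((ValuationSubring.valuation_le_one_iff _ _).2 (sub_mem hx (P.algebraMap_mem a)))
      (hcon a)
  have hpoly : ∀ (n : ℕ) (A : k[X]), A ≠ 0 → A.natDegree = n →
      P.localRing.valuation (aeval x A) = 1 := by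
    intro n
    induction n with
    | zero =>
      intro A hA hn
      rw [eq_C_of_natDegree_eq_zero hn] at hA ⊢
      rw [aeval_C]
      have hc : A.coeff 0 ≠ 0 := by simpa using hA
      rw [P.valuation_eq_one_iff_ord (by simpa using hc), P.ord_algebraMap]
    | succ n ih =>
      intro A hA hn
      obtain ⟨a, ha⟩ := IsAlgClosed.exists_root A (by
        rw [degree_eq_natDegree hA, hn]; exact_mod_cast (Nat.succ_ne_zero n))
      obtain ⟨B, rfl⟩ := dvd_iff_isRoot.2 ha
      have hB : B ≠ 0 := right_ne_zero_of_mul hA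
      rw [natDegree_mul (X_sub_C_ne_zero a) hB, natDegree_X_sub_C] at hn
      rw [map_mul, map_mul, ih B hB (by omega), map_sub, aeval_X, aeval_C, hone, one_mul]
  have hK : ∀ r ∈ k⟮x⟯, r ∈ P.localRing := by
    intro r hr
    obtain ⟨A, B, rfl⟩ := (IntermediateField.mem_adjoin_simple_iff k r).1 hr
    rcases eq_or_ne A 0 with rfl | hA
    · simp
    rcases eq_or_ne B 0 with rfl | hB
    · simp
    rw [← ValuationSubring.valuation_le_one_iff, map_div₀, hpoly _ A hA rfl, hpoly _ B hB rfl,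
      div_one]
  have hy : y ∈ P.localRing := by
    have := hK _ h.cube_mem
    rw [← ValuationSubring.valuation_le_one_iff, map_pow] at this
    rw [← ValuationSubring.valuation_le_one_iff]
    exact (pow_le_one_iff (by norm_num)).1 this
  apply P.localRing_ne_top
  rw [eq_top_iff]
  intro b _
  obtain ⟨b₀, h0, b₁, h1, b₂, h2, rfl⟩ := h.decomposition b
  exact add_mem (add_mem (hK _ h0) (mul_mem (hK _ h1) hy)) (mul_mem (hK _ h2) (pow_mem hy 2))

end Kummer


/-! ### The model `y ^ 3 = f(x) g(x) ^ 2` and its local analysis -/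

section Model

open Polynomial KaehlerDifferential

variable {k : Type u} {F : Type v} [Field k] [Field F] [Algebra k F] {p : ℕ}
  {σ : F ≃ₐ[k] F} {ζ : k} {x y : F}

theorem Kummer.finiteDimensional (h : Kummer σ ζ x y) : FiniteDimensional k⟮x⟯ F := by
  refine ⟨Submodule.fg_def.2 ⟨{1, y, y ^ 2}, by simp, ?_⟩⟩
  rw [eq_top_iff]
  intro b _
  obtain ⟨b₀, h0, b₁, h1, b₂, h2, rfl⟩ := h.decomposition b
  have e0 := Submodule.smul_mem (Submodule.span k⟮x⟯ {1, y, y ^ 2}) ⟨b₀, h0⟩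
    (Submodule.subset_span (by simp : (1 : F) ∈ ({1, y, y ^ 2} : Set F)))
  have e1 := Submodule.smul_mem (Submodule.span k⟮x⟯ {1, y, y ^ 2}) ⟨b₁, h1⟩
    (Submodule.subset_span (by simp : y ∈ ({1, y, y ^ 2} : Set F)))
  have e2 := Submodule.smul_mem (Submodule.span k⟮x⟯ {1, y, y ^ 2}) ⟨b₂, h2⟩
    (Submodule.subset_span (by simp : y ^ 2 ∈ ({1, y, y ^ 2} : Set F)))
  have := add_mem (add_mem e0 e1) e2
  simpa [Subfield.smul_def, IntermediateField.smul_def] using this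

theorem Kummer.isCurve (h : Kummer σ ζ x y) : IsCurve k F :=
  ⟨x, h.trans, h.finiteDimensional⟩

/-- On `k(x)` this uses that `k` is perfect. The generator `y` contributes nothing new: `p ^ 2 ≡ 1`
modulo `3`, so `y ^ i` is a `p`-th power times a rational function of `x`. -/
theorem Kummer.frobSpan [IsAlgClosed k] [Fact p.Prime] [CharP F p] (h : Kummer σ ζ x y) :
    FrobSpan p x := by
  have hp : p.Prime := Fact.out
  have hadd : ∀ {a b : F}, (∃ c : Fin p → F, a = ∑ i, c i ^ p * x ^ (i : ℕ)) →
      (∃ c : Fin p → F, b = ∑ i, c i ^ p * x ^ (i : ℕ)) →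
      ∃ c : Fin p → F, a + b = ∑ i, c i ^ p * x ^ (i : ℕ) := by
    rintro a b ⟨c, rfl⟩ ⟨d, rfl⟩
    exact ⟨c + d, by simp only [Pi.add_apply, add_pow_char, add_mul, Finset.sum_add_distrib]⟩
  have hmul : ∀ {a : F} (g : F), (∃ c : Fin p → F, a = ∑ i, c i ^ p * x ^ (i : ℕ)) →
      ∃ c : Fin p → F, g ^ p * a = ∑ i, c i ^ p * x ^ (i : ℕ) := by
    rintro a g ⟨c, rfl⟩
    exact ⟨fun i => g * c i, by simp only [mul_pow, Finset.mul_sum, mul_assoc]⟩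
  have hpow : ∀ n : ℕ, ∃ c : Fin p → F, x ^ n = ∑ i, c i ^ p * x ^ (i : ℕ) := by
    intro n
    refine ⟨Pi.single ⟨n % p, Nat.mod_lt _ hp.pos⟩ (x ^ (n / p)), ?_⟩
    rw [Finset.sum_eq_single ⟨n % p, Nat.mod_lt _ hp.pos⟩]
    · rw [Pi.single_eq_same, ← pow_mul, ← pow_add, mul_comm, Nat.div_add_mod]
    · intro i _ hi
      rw [Pi.single_eq_of_ne hi, zero_pow hp.ne_zero, zero_mul]
    · simp
  have hpoly : ∀ A : k[X], ∃ c : Fin p → F, aeval x A = ∑ i, c i ^ p * x ^ (i : ℕ) := by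
    intro A
    induction A using Polynomial.induction_on' with
    | add A B hA hB => rw [map_add]; exact hadd hA hB
    | monomial n a =>
      obtain ⟨d, rfl⟩ := IsAlgClosed.exists_pow_nat_eq a hp.pos
      rw [aeval_monomial, map_pow]
      exact hmul _ (hpow n)
  have hrat : ∀ r ∈ k⟮x⟯, ∃ c : Fin p → F, r = ∑ i, c i ^ p * x ^ (i : ℕ) := by
    intro r hr
    obtain ⟨A, B, rfl⟩ := (IntermediateField.mem_adjoin_simple_iff k r).1 hr
    -- The denominator is made a `p`-th power, leaving a polynomial to expand.
    have : aeval x A / aeval x B = (aeval x B)⁻¹ ^ p * aeval x (A * B ^ (p - 1)) := by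
      rcases eq_or_ne (aeval x B) 0 with h0 | h0
      · simp [h0, hp.ne_zero]
      obtain ⟨q, hq⟩ : ∃ q, p = q + 1 := ⟨p - 1, by have := hp.pos; omega⟩
      rw [hq, Nat.add_sub_cancel, map_mul, map_pow, inv_pow]
      field_simp
      ring
    rw [this]
    exact hmul _ (hpoly _)
  have hp3 : ¬ 3 ∣ p := by
    intro h3
    have : p = 3 := ((Nat.prime_dvd_prime_iff_eq Nat.prime_three hp).1 h3).symm
    have h0 : ((3 : ℕ) : F) = 0 := by
      rw [← this]
      exact CharP.cast_eq_zero F p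
    apply h.prim.three_ne_zero
    apply (algebraMap k F).injective
    rw [map_ofNat, map_zero]
    exact_mod_cast h0
  have hmod : p ^ 2 % 3 = 1 := by
    rw [Nat.pow_mod]
    have : p % 3 = 1 ∨ p % 3 = 2 := by omega
    rcases this with h | h <;> rw [h]
  obtain ⟨q, hq⟩ : ∃ q, p ^ 2 = 3 * q + 1 := ⟨p ^ 2 / 3, by omega⟩
  have hy : ∀ r ∈ k⟮x⟯, ∀ i : ℕ, ∃ c : Fin p → F, r * y ^ i = ∑ i, c i ^ p * x ^ (i : ℕ) := by
    intro r hr i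
    have : r * y ^ i = (y ^ (i * p)) ^ p * (r * ((y ^ 3) ^ (q * i))⁻¹) := by
      have h1 : (y ^ (i * p)) ^ p = y ^ i * (y ^ 3) ^ (q * i) := by
        rw [← pow_mul, ← pow_mul, ← pow_add]
        congr 1
        calc i * p * p = i * p ^ 2 := by ring
          _ = _ := by rw [hq]; ring
      rw [h1]
      have hy0 := h.ne_zero
      field_simp
    rw [this]
    exact hmul _ (hrat _ (mul_mem hr (inv_mem (pow_mem h.cube_mem _))))
  intro b
  obtain ⟨b₀, h0, b₁, h1, b₂, h2, rfl⟩ := h.decomposition b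
  have e0 := hy b₀ h0 0
  have e1 := hy b₁ h1 1
  rw [pow_zero, mul_one] at e0
  rw [pow_one] at e1
  exact hadd (hadd e0 e1) (hy b₂ h2 2)

/-- A `p`-th root of `x` would be `σ`-invariant by injectivity of Frobenius, hence in `k(x)`, where
its order at `x = 0` would be `1 / p`. -/
theorem Kummer.ne_pow_char [Fact p.Prime] [CharP F p] (h : Kummer σ ζ x y) (g : F) :
    g ^ p ≠ x := by
  have hp : p.Prime := Fact.out
  intro hg
  have hσ : σ g = g := by
    apply frobenius_inj F p
    change σ g ^ p = g ^ p
    rw [← map_pow, hg, h.map_fixed]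
  have hx0 : x ≠ 0 := fun h0 => h.trans (h0 ▸ isAlgebraic_zero)
  have hg0 : g ≠ 0 := by rintro rfl; rw [zero_pow hp.ne_zero] at hg; exact hx0 hg.symm
  obtain ⟨V, hk, hV⟩ := exists_valuationSubring_of_transcendental h.trans
  obtain ⟨n, hn⟩ := exists_valuation_eq_zpow_of_mem_adjoin h.trans hg0 ((h.fixed_iff g).1 hσ)
  have h1 : V.valuation x ^ (1 : ℤ) = V.valuation x ^ (n * p) := by
    rw [zpow_one, zpow_mul, ← hn V hk hV, zpow_natCast, ← map_pow, hg]
  have h2 := zpow_right_injective₀ (by simpa [zero_lt_iff] using hx0) hV.ne h1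
  have h3 : ((p : ℕ) : ℤ) ∣ 1 := ⟨n, by rw [h2]; ring⟩
  have : p ∣ 1 := by exact_mod_cast h3
  exact hp.one_lt.ne' (Nat.dvd_one.1 this)

theorem Kummer.frobGen [IsAlgClosed k] [Fact p.Prime] [CharP F p] (h : Kummer σ ζ x y) :
    FrobGen k p x :=
  h.frobSpan.frobGen h.isCurve h.ne_pow_char

theorem Kummer.sub_algebraMap (h : Kummer σ ζ x y) (a : k) :
    Kummer σ ζ (x - algebraMap k F a) y := by
  have hadj : k⟮x - algebraMap k F a⟯ = k⟮x⟯ := by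
    apply le_antisymm
    · rw [IntermediateField.adjoin_simple_le_iff]
      exact sub_mem (IntermediateField.mem_adjoin_simple_self k x) (algebraMap_mem _ _)
    · rw [IntermediateField.adjoin_simple_le_iff]
      have := add_mem (IntermediateField.mem_adjoin_simple_self k (x - algebraMap k F a))
        (algebraMap_mem k⟮x - algebraMap k F a⟯ a)
      simpa using this
  refine ⟨h.prim, h.iterate_three, fun b => by rw [hadj, h.fixed_iff], fun hal => h.trans ?_,
    h.ne_zero, h.act⟩
  have := hal.add (isAlgebraic_algebraMap a)
  simpa using this

theorem Kummer.inv (h : Kummer σ ζ x y) : Kummer σ ζ x⁻¹ y := by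
  have hadj : k⟮x⁻¹⟯ = k⟮x⟯ := by
    apply le_antisymm
    · rw [IntermediateField.adjoin_simple_le_iff]
      exact inv_mem (IntermediateField.mem_adjoin_simple_self k x)
    · rw [IntermediateField.adjoin_simple_le_iff]
      have := inv_mem (IntermediateField.mem_adjoin_simple_self k x⁻¹)
      simpa using this
  refine ⟨h.prim, h.iterate_three, fun b => by rw [hadj, h.fixed_iff], fun hal => h.trans ?_,
    h.ne_zero, h.act⟩
  simpa using hal.inv

theorem Kummer.mul_of_mem (h : Kummer σ ζ x y) {r : F} (hr : r ∈ k⟮x⟯) (hr0 : r ≠ 0) :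
    Kummer σ ζ x (y * r) :=
  ⟨h.prim, h.iterate_three, h.fixed_iff, h.trans, mul_ne_zero h.ne_zero hr0, by
    rw [map_mul, h.act, (h.fixed_iff r).2 hr, mul_assoc]⟩

theorem Kummer.sq (h : Kummer σ ζ x y) : Kummer σ (ζ ^ 2) x (y ^ 2) :=
  ⟨h.prim.pow_of_coprime 2 (by norm_num), h.iterate_three, h.fixed_iff, h.trans,
    pow_ne_zero _ h.ne_zero, by rw [map_pow, h.act, mul_pow, map_pow]⟩

/-- The model `y ^ 3 = f(x) g(x) ^ 2` of a trielliptic curve, unramified at infinity. -/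
structure Model (σ : F ≃ₐ[k] F) (ζ : k) (x y : F) (f g : k[X]) (m : ℕ) : Prop extends
    Kummer σ ζ x y where
  eqn : y ^ 3 = aeval x f * aeval x g ^ 2
  sqfree : Squarefree (f * g)
  deg : f.natDegree + 2 * g.natDegree = 3 * m

variable {f g : k[X]} {m : ℕ}

namespace Model

theorem f_ne_zero (M : Model σ ζ x y f g m) : f ≠ 0 := left_ne_zero_of_mul M.sqfree.ne_zero

theorem g_ne_zero (M : Model σ ζ x y f g m) : g ≠ 0 := right_ne_zero_of_mul M.sqfree.ne_zero

theorem aeval_g_ne_zero (M : Model σ ζ x y f g m) : aeval x g ≠ 0 :=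
  aeval_ne_zero_of_transcendental M.trans M.g_ne_zero

theorem aeval_f_ne_zero (M : Model σ ζ x y f g m) : aeval x f ≠ 0 :=
  aeval_ne_zero_of_transcendental M.trans M.f_ne_zero

/-- The function `z = y ^ 2 / g(x)` satisfies `z ^ 3 = g f ^ 2`. This symmetry transfers every
statement about roots of `f` to roots of `g`, and from one eigenspace of `σ` to the other. -/
theorem swap (M : Model σ ζ x y f g m) :
    Model σ (ζ ^ 2) x (y ^ 2 / aeval x g) g f (2 * m - g.natDegree) where
  toKummer := by
    rw [div_eq_mul_inv]
    exact M.toKummer.sq.mul_of_mem (inv_mem (aeval_mem_adjoin_simple x g))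
      (inv_ne_zero M.aeval_g_ne_zero)
  eqn := by
    have := M.aeval_g_ne_zero
    rw [div_pow, ← pow_mul, mul_comm 2 3, pow_mul, M.eqn]
    field_simp
  sqfree := by rw [mul_comm]; exact M.sqfree
  deg := by have := M.deg; omega

theorem swap_swap (M : Model σ ζ x y f g m) : (y ^ 2 / aeval x g) ^ 2 / aeval x f = y := by
  have h1 := M.aeval_g_ne_zero
  have h2 := M.aeval_f_ne_zero
  rw [div_pow, div_div, div_eq_iff (by positivity)]
  linear_combination y * M.eqn

theorem eval_g_ne_zero (M : Model σ ζ x y f g m) {a : k} (ha : f.eval a = 0) : g.eval a ≠ 0 := by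
  intro hb
  obtain ⟨f', rfl⟩ := dvd_iff_isRoot.2 ha
  obtain ⟨g', rfl⟩ := dvd_iff_isRoot.2 hb
  exact (Polynomial.irreducible_X_sub_C a).not_isUnit (M.sqfree _ ⟨f' * g', by ring⟩)

theorem exists_factor (M : Model σ ζ x y f g m) {a : k} (ha : f.eval a = 0) :
    ∃ f' : k[X], f = (X - C a) * f' ∧ f'.eval a ≠ 0 := by
  obtain ⟨f', hf'⟩ := dvd_iff_isRoot.2 ha
  refine ⟨f', hf', fun hb => ?_⟩
  obtain ⟨f'', hf''⟩ := dvd_iff_isRoot.2 hb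
  exact (Polynomial.irreducible_X_sub_C a).not_isUnit (M.sqfree _ ⟨f'' * g, by
    rw [hf', hf'']; ring⟩)

theorem aeval_comp_sub (x : F) (a : k) (A : k[X]) :
    aeval (x - algebraMap k F a) (A.comp (X + C a)) = aeval x A := by
  rw [aeval_comp]
  simp

theorem eqn_unramified (M : Model σ ζ x y f g m) (a : k) :
    y ^ 3 = aeval (x - algebraMap k F a) ((f * g ^ 2).comp (X + C a)) := by
  rw [aeval_comp_sub, map_mul, map_pow, M.eqn]

theorem exists_eqn_ramified (M : Model σ ζ x y f g m) {a : k} (ha : f.eval a = 0) :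
    ∃ G : k[X], G.eval 0 ≠ 0 ∧
      y ^ 3 = (x - algebraMap k F a) * aeval (x - algebraMap k F a) G := by
  obtain ⟨f', hf, hf'⟩ := M.exists_factor ha
  refine ⟨(f' * g ^ 2).comp (X + C a), ?_, ?_⟩
  · have := M.eval_g_ne_zero ha
    simp [hf', this]
  · rw [aeval_comp_sub, M.eqn, hf]
    simp only [map_mul, map_sub, aeval_X, aeval_C, map_pow]
    ring

theorem aeval_reverse {x : F} (hx : x ≠ 0) (A : k[X]) :
    aeval x⁻¹ A.reverse * x ^ A.natDegree = aeval x A := by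
  have : Invertible x := invertibleOfNonzero hx
  have := eval₂_reverse_mul_pow (algebraMap k F) x A
  rwa [invOf_eq_inv] at this

theorem kummer_infinity (M : Model σ ζ x y f g m) : Kummer σ ζ x⁻¹ (y * x⁻¹ ^ m) := by
  refine M.toKummer.inv.mul_of_mem (pow_mem (IntermediateField.mem_adjoin_simple_self k _) _)
    (pow_ne_zero _ (inv_ne_zero ?_))
  exact fun h0 => M.trans (h0 ▸ isAlgebraic_zero)

/-- The degree condition is exactly what lets the powers of `x` cancel, so that infinity looks like
an unramified finite point with coordinate `x⁻¹`. -/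
theorem eqn_infinity (M : Model σ ζ x y f g m) :
    (y * x⁻¹ ^ m) ^ 3 = aeval x⁻¹ (f.reverse * g.reverse ^ 2) := by
  have hx0 : x ≠ 0 := fun h0 => M.trans (h0 ▸ isAlgebraic_zero)
  rw [mul_pow, M.eqn, ← aeval_reverse hx0 f, ← aeval_reverse hx0 g, map_mul, map_pow, ← pow_mul,
    mul_comm m 3, ← M.deg, inv_pow, pow_add, pow_mul']
  field_simp

theorem eval_infinity_ne_zero (M : Model σ ζ x y f g m) :
    (f.reverse * g.reverse ^ 2).eval 0 ≠ 0 := by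
  rw [eval_mul, eval_pow, ← coeff_zero_eq_eval_zero, ← coeff_zero_eq_eval_zero, coeff_zero_reverse,
    coeff_zero_reverse]
  have h1 := M.f_ne_zero
  have h2 := M.g_ne_zero
  simp [h1, h2]

theorem _root_.TriCurve.Point.ord_aeval_eq_zero (P : Point k F) {ξ : F} (hξ0 : Transcendental k ξ)
    (hξ : P.localRing.valuation ξ < 1) {A : k[X]} (hA : A.eval 0 ≠ 0) : P.ord (aeval ξ A) = 0 := by
  have hA0 : A ≠ 0 := by rintro rfl; simp at hA
  rw [← P.valuation_eq_one_iff_ord (aeval_ne_zero_of_transcendental hξ0 hA0)]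
  exact valuation_aeval_eq_one _ P.algebraMap_mem hξ hA

theorem D_aeval (x : F) (A : k[X]) : D k F (aeval x A) = aeval x (derivative A) • D k F x := by
  rw [Derivation.map_aeval]

theorem valuation_inv_lt_one (P : Point k F) {x : F} (hx : x ∉ P.localRing) :
    P.localRing.valuation x⁻¹ < 1 := by
  have hx0 : x ≠ 0 := by rintro rfl; exact hx (zero_mem _)
  rw [map_inv₀]
  apply inv_lt_one_of_one_lt₀
  rw [← not_le, ValuationSubring.valuation_le_one_iff]
  exact hx

theorem ord_aeval_eq_zero (M : Model σ ζ x y f g m) (P : Point k F) {a : k}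
    (hP : P.localRing.valuation (x - algebraMap k F a) < 1) {A : k[X]} (hA : A.eval a ≠ 0) :
    P.ord (aeval x A) = 0 := by
  rw [← aeval_comp_sub x a A]
  exact P.ord_aeval_eq_zero (M.toKummer.sub_algebraMap a).trans hP (by simpa using hA)

/-- The order data of `x`, `y` and `z` at a point where `f` vanishes. -/
theorem ord_of_eval_f_eq_zero (M : Model σ ζ x y f g m) (P : Point k F) {a : k}
    (hP : P.localRing.valuation (x - algebraMap k F a) < 1) (ha : f.eval a = 0) :
    P.ord (x - algebraMap k F a) = 3 ∧ P.ord y = 1 ∧ P.ord (y ^ 2 / aeval x g) = 2 := by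
  obtain ⟨G, hG, hy⟩ := M.exists_eqn_ramified ha
  have hK := M.toKummer.sub_algebraMap a
  obtain ⟨-, h1, h2⟩ := hK.ramified_valuation P.algebraMap_mem hP hG hy
  have hy1 := P.ord_eq_one_of_forall M.ne_zero h1 h2
  have hξ0 : x - algebraMap k F a ≠ 0 := fun h0 => hK.trans (h0 ▸ isAlgebraic_zero)
  have hG0 : G ≠ 0 := by rintro rfl; simp at hG
  refine ⟨?_, hy1, ?_⟩
  · have := congrArg P.ord hy
    rw [P.ord_pow, hy1, P.ord_mul hξ0 (aeval_ne_zero_of_transcendental hK.trans hG0),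
      P.ord_aeval_eq_zero hK.trans hP hG] at this
    push_cast at this
    omega
  · rw [P.ord_div (pow_ne_zero _ M.ne_zero) M.aeval_g_ne_zero, P.ord_pow, hy1,
      M.ord_aeval_eq_zero P hP (M.eval_g_ne_zero ha)]
    norm_num

variable [IsAlgClosed k]

theorem exists_point (M : Model σ ζ x y f g m) (a : k) :
    ∃ P : Point k F, P.localRing.valuation (x - algebraMap k F a) < 1 := by
  obtain ⟨V, hk, hV⟩ := exists_valuationSubring_of_transcendental (M.toKummer.sub_algebraMap a).trans
  have hξ0 : x - algebraMap k F a ≠ 0 :=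
    fun h0 => (M.toKummer.sub_algebraMap a).trans (h0 ▸ isAlgebraic_zero)
  by_cases hf : f.eval a = 0
  · obtain ⟨G, hG, hy⟩ := M.exists_eqn_ramified hf
    obtain ⟨-, h1, h2⟩ := (M.toKummer.sub_algebraMap a).ramified_valuation hk hV hG hy
    exact ⟨⟨V, hk, isDiscreteValuationRing_of_forall V M.ne_zero h1 h2⟩, hV⟩
  by_cases hg : g.eval a = 0
  · obtain ⟨G, hG, hy⟩ := M.swap.exists_eqn_ramified hg
    obtain ⟨-, h1, h2⟩ := (M.swap.toKummer.sub_algebraMap a).ramified_valuation hk hV hG hy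
    exact ⟨⟨V, hk, isDiscreteValuationRing_of_forall V M.swap.ne_zero h1 h2⟩, hV⟩
  · obtain ⟨-, h2⟩ := (M.toKummer.sub_algebraMap a).unramified_valuation hk hV (by simp [hf, hg])
      (M.eqn_unramified a)
    exact ⟨⟨V, hk, isDiscreteValuationRing_of_forall V hξ0 hV h2⟩, hV⟩

theorem exists_point_infinity (M : Model σ ζ x y f g m) :
    ∃ P : Point k F, P.localRing.valuation x⁻¹ < 1 := by
  obtain ⟨V, hk, hV⟩ := exists_valuationSubring_of_transcendental M.kummer_infinity.trans
  have hξ0 : x⁻¹ ≠ 0 := fun h0 => M.kummer_infinity.trans (h0 ▸ isAlgebraic_zero)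
  obtain ⟨-, h2⟩ := M.kummer_infinity.unramified_valuation hk hV M.eval_infinity_ne_zero
    M.eqn_infinity
  exact ⟨⟨V, hk, isDiscreteValuationRing_of_forall V hξ0 hV h2⟩, hV⟩

theorem mem_regular_iff_of_eval_f_eq_zero (p : ℕ) [Fact p.Prime] [CharP F p] (M : Model σ ζ x y f g m) (P : Point k F) {a : k}
    (hP : P.localRing.valuation (x - algebraMap k F a) < 1) (ha : f.eval a = 0) {h : F}
    (hh : h ≠ 0) : h • D k F x ∈ P.regularDifferentials ↔ 0 ≤ P.ord h + 2 := by
  obtain ⟨G, hG, hy⟩ := M.exists_eqn_ramified ha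
  have hK := M.toKummer.sub_algebraMap a
  obtain ⟨-, hy1, -⟩ := M.ord_of_eval_f_eq_zero P hP ha
  have hy0 := M.ne_zero
  have h3 : (3 : F) ≠ 0 := by
    rw [← map_ofNat (algebraMap k F) 3]
    exact (_root_.map_ne_zero _).2 M.prim.three_ne_zero
  set ξ := x - algebraMap k F a with hξ
  -- The derivative of `X * G` takes the value `G(0)` at `0`. So in `3 y ^ 2 dy = H dx` the factor
  -- `H` is a unit, and `dx` has order `2`; the ramification is tame since `3 ≠ 0`.
  have hder : (derivative (X * G)).eval 0 ≠ 0 := by simpa using hG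
  set H := aeval ξ (derivative (X * G)) with hH
  have hH0 : P.ord H = 0 := P.ord_aeval_eq_zero hK.trans hP hder
  have hHne : H ≠ 0 := aeval_ne_zero_of_transcendental hK.trans (by
    intro h0; rw [h0] at hder; simp at hder)
  have hD : (3 * y ^ 2) • D k F y = H • D k F x := by
    have h1 : y ^ 3 = aeval ξ (X * G) := by rw [hy, map_mul, aeval_X]
    have h2 := congrArg (D k F) h1
    rw [D_aeval, Derivation.leibniz_pow, ← Nat.cast_smul_eq_nsmul F, smul_smul] at h2
    have h4 : D k F ξ = D k F x := by rw [hξ, map_sub, Derivation.map_algebraMap, sub_zero]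
    rw [h4] at h2
    exact_mod_cast h2
  have hDx : h • D k F x = (h * (3 * y ^ 2 / H)) • D k F y := by
    rw [mul_div_assoc', mul_comm h, div_eq_mul_inv, mul_assoc, mul_comm, mul_smul, hD, smul_smul]
    congr 1
    field_simp
  have h3o : P.ord 3 = 0 := by
    rw [← map_ofNat (algebraMap k F) 3, P.ord_algebraMap]
  have hne : h * (3 * y ^ 2 / H) ≠ 0 := by positivity
  rw [hDx, P.smul_D_mem_regularDifferentials_iff M.toKummer.isCurve (M.toKummer.frobSpan (p := p)) hy1,
    ← P.ord_nonneg_iff hne, P.ord_mul hh (by positivity), P.ord_div (by positivity) hHne,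
    P.ord_mul h3 (by positivity), P.ord_pow, hy1, hH0, h3o]
  norm_num

theorem mem_regular_iff_unramified (p : ℕ) [Fact p.Prime] [CharP F p] (M : Model σ ζ x y f g m) (P : Point k F) {a : k}
    (hP : P.localRing.valuation (x - algebraMap k F a) < 1) (hf : f.eval a ≠ 0)
    (hg : g.eval a ≠ 0) : P.ord (x - algebraMap k F a) = 1 ∧ P.ord y = 0 ∧
      P.ord (y ^ 2 / aeval x g) = 0 ∧
      ∀ h : F, h ≠ 0 → (h • D k F x ∈ P.regularDifferentials ↔ 0 ≤ P.ord h) := by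
  have hK := M.toKummer.sub_algebraMap a
  have hξ0 : x - algebraMap k F a ≠ 0 := fun h0 => hK.trans (h0 ▸ isAlgebraic_zero)
  obtain ⟨h1, h2⟩ := hK.unramified_valuation P.algebraMap_mem hP (by simp [hf, hg])
      (M.eqn_unramified a)
  have ho := P.ord_eq_one_of_forall hξ0 hP h2
  have hy := (P.valuation_eq_one_iff_ord M.ne_zero).1 h1
  refine ⟨ho, hy, ?_, fun h hh => ?_⟩
  · rw [P.ord_div (pow_ne_zero _ M.ne_zero) M.aeval_g_ne_zero, P.ord_pow, hy,
      M.ord_aeval_eq_zero P hP hg]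
    norm_num
  · have h4 : D k F x = D k F (x - algebraMap k F a) := by
      rw [map_sub, Derivation.map_algebraMap, sub_zero]
    rw [h4, P.smul_D_mem_regularDifferentials_iff M.toKummer.isCurve (M.toKummer.frobSpan (p := p)) ho,
      P.ord_nonneg_iff hh]

/-- Orders at a point over `x = a`; here `e` is the ramification index and `d` the order of `dx`. -/
theorem local_finite (p : ℕ) [Fact p.Prime] [CharP F p] (M : Model σ ζ x y f g m) (P : Point k F) {a : k}
    (hP : P.localRing.valuation (x - algebraMap k F a) < 1) :
    ∃ e d : ℤ, P.ord (x - algebraMap k F a) = e ∧ (0 ≤ d ∧ d < e) ∧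
      (0 ≤ d - P.ord y ∧ d - P.ord y < e) ∧
      (0 ≤ d - P.ord (y ^ 2 / aeval x g) ∧ d - P.ord (y ^ 2 / aeval x g) < e) ∧
      ∀ h : F, h ≠ 0 → (h • D k F x ∈ P.regularDifferentials ↔ 0 ≤ P.ord h + d) := by
  by_cases hf : f.eval a = 0
  · obtain ⟨h1, h2, h3⟩ := M.ord_of_eval_f_eq_zero P hP hf
    exact ⟨3, 2, h1, by omega, by omega, by omega,
      fun h hh => M.mem_regular_iff_of_eval_f_eq_zero p P hP hf hh⟩
  by_cases hg : g.eval a = 0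
  · obtain ⟨h1, h2, h3⟩ := M.swap.ord_of_eval_f_eq_zero P hP hg
    rw [M.swap_swap] at h3
    exact ⟨3, 2, h1, by omega, by omega, by omega,
      fun h hh => M.swap.mem_regular_iff_of_eval_f_eq_zero p P hP hg hh⟩
  · obtain ⟨h1, h2, h3, h4⟩ := M.mem_regular_iff_unramified p P hP hf hg
    exact ⟨1, 0, h1, by omega, by omega, by omega, fun h hh => by rw [h4 h hh, add_zero]⟩

theorem local_infinity (p : ℕ) [Fact p.Prime] [CharP F p] (M : Model σ ζ x y f g m) (P : Point k F)
    (hP : P.localRing.valuation x⁻¹ < 1) :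
    P.ord x = -1 ∧ P.ord y = -m ∧ P.ord (y ^ 2 / aeval x g) = -((2 * m - g.natDegree : ℕ) : ℤ) ∧
      (∀ A : k[X], A ≠ 0 → P.ord (aeval x A) = -A.natDegree) ∧
      ∀ h : F, h ≠ 0 → (h • D k F x ∈ P.regularDifferentials ↔ 0 ≤ P.ord h - 2) := by
  have hx0 : x ≠ 0 := fun h0 => M.trans (h0 ▸ isAlgebraic_zero)
  have hK := M.kummer_infinity
  obtain ⟨h1, h2⟩ := hK.unramified_valuation P.algebraMap_mem hP M.eval_infinity_ne_zero
    M.eqn_infinity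
  have ho := P.ord_eq_one_of_forall (inv_ne_zero hx0) hP h2
  have hy0 := (P.valuation_eq_one_iff_ord hK.ne_zero).1 h1
  have hx : P.ord x = -1 := by
    rw [P.ord_inv] at ho; omega
  have hy : P.ord y = -m := by
    rw [P.ord_mul M.ne_zero (pow_ne_zero _ (inv_ne_zero hx0)), P.ord_pow, ho] at hy0
    omega
  have hpoly : ∀ A : k[X], A ≠ 0 → P.ord (aeval x A) = -A.natDegree := by
    intro A hA
    have hrev : A.reverse.eval 0 ≠ 0 := by
      rw [← coeff_zero_eq_eval_zero, coeff_zero_reverse]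
      simpa using hA
    rw [← aeval_reverse hx0 A, P.ord_mul, P.ord_aeval_eq_zero hK.trans hP hrev, P.ord_pow, hx]
    · ring
    · exact aeval_ne_zero_of_transcendental hK.trans (by simpa using hA)
    · exact pow_ne_zero _ hx0
  refine ⟨hx, hy, ?_, hpoly, fun h hh => ?_⟩
  · rw [P.ord_div (pow_ne_zero _ M.ne_zero) M.aeval_g_ne_zero, P.ord_pow, hy,
      hpoly g M.g_ne_zero]
    have := M.deg
    push_cast
    omega
  · have hD : h • D k F x = (-(h * x ^ 2)) • D k F x⁻¹ := by
      rw [Derivation.leibniz_inv, smul_smul]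
      congr 1
      field_simp
    have hne : h * x ^ 2 ≠ 0 := mul_ne_zero hh (pow_ne_zero _ hx0)
    rw [hD, P.smul_D_mem_regularDifferentials_iff M.toKummer.isCurve (M.toKummer.frobSpan (p := p)) ho,
      ← P.ord_nonneg_iff (neg_ne_zero.2 hne), P.ord_neg, P.ord_mul hh (pow_ne_zero _ hx0),
      P.ord_pow, hx]
    norm_num [sub_eq_add_neg]

/-- The differentials `r η dx` with `r` rational in `x` and `η ∈ {1, y⁻¹, z⁻¹}` that are
holomorphic. -/
theorem mem_holomorphic_iff (p : ℕ) [Fact p.Prime] [CharP F p] (M : Model σ ζ x y f g m) {η : F} {N : ℕ}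
    (hη : η = 1 ∧ N = 0 ∨ η = y⁻¹ ∧ N = m ∨
      η = (y ^ 2 / aeval x g)⁻¹ ∧ N = 2 * m - g.natDegree) {r : F} (hr : r ∈ k⟮x⟯) :
    (r * η) • D k F x ∈ holomorphicDifferentials k F ↔
      ∃ A ∈ degreeLT k (N - 1), r = aeval x A := by
  have hη0 : η ≠ 0 := by
    rcases hη with ⟨rfl, -⟩ | ⟨rfl, -⟩ | ⟨rfl, -⟩
    · exact one_ne_zero
    · exact inv_ne_zero M.ne_zero
    · exact inv_ne_zero M.swap.ne_zero
  have hfin : ∀ (P : Point k F) (a : k), P.localRing.valuation (x - algebraMap k F a) < 1 →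
      ∃ e d : ℤ, P.ord (x - algebraMap k F a) = e ∧ (0 ≤ d + P.ord η ∧ d + P.ord η < e) ∧
      ∀ h : F, h ≠ 0 → (h • D k F x ∈ P.regularDifferentials ↔ 0 ≤ P.ord h + d) := by
    intro P a hP
    obtain ⟨e, d, h1, h2, h3, h4, h5⟩ := M.local_finite p P hP
    refine ⟨e, d, h1, ?_, h5⟩
    rcases hη with ⟨rfl, -⟩ | ⟨rfl, -⟩ | ⟨rfl, -⟩
    · rw [P.ord_one]; omega
    · rw [P.ord_inv]; omega
    · rw [P.ord_inv]; omega
  have hinf : ∀ P : Point k F, P.localRing.valuation x⁻¹ < 1 → P.ord η = N := by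
    intro P hP
    obtain ⟨-, h1, h2, -⟩ := M.local_infinity p P hP
    rcases hη with ⟨rfl, rfl⟩ | ⟨rfl, rfl⟩ | ⟨rfl, rfl⟩
    · rw [P.ord_one]; rfl
    · rw [P.ord_inv, h1, neg_neg]
    · rw [P.ord_inv, h2, neg_neg]
  constructor
  · intro hmem
    rw [holomorphicDifferentials, Submodule.mem_iInf] at hmem
    rcases eq_or_ne r 0 with rfl | hr0
    · exact ⟨0, zero_mem _, by simp⟩
    -- Regularity at finite points forces `r` to be a polynomial: each root of the denominator is
    -- shown to be a root of the numerator, and the common factor is cancelled.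
    have hpol : ∀ (n : ℕ) (A B : k[X]), B.natDegree = n → r = aeval x A / aeval x B →
        ∃ A : k[X], r = aeval x A := by
      intro n
      induction n with
      | zero =>
        intro A B hB hrAB
        rw [eq_C_of_natDegree_eq_zero hB, aeval_C, div_eq_mul_inv, ← map_inv₀] at hrAB
        exact ⟨A * C (B.coeff 0)⁻¹, by rw [hrAB, map_mul, aeval_C]⟩
      | succ n ih =>
        intro A B hB hrAB
        have hB0 : B ≠ 0 := by rintro rfl; simp at hB
        have hBx := aeval_ne_zero_of_transcendental M.trans hB0
        have hAx : aeval x A ≠ 0 := by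
          intro h0
          rw [h0, zero_div] at hrAB
          exact hr0 hrAB
        obtain ⟨a, ha⟩ := IsAlgClosed.exists_root B (by
          rw [degree_eq_natDegree hB0, hB]; exact_mod_cast (Nat.succ_ne_zero n))
        obtain ⟨B', rfl⟩ := dvd_iff_isRoot.2 ha
        have hB' : B' ≠ 0 := right_ne_zero_of_mul hB0
        obtain ⟨P, hP⟩ := M.exists_point a
        obtain ⟨e, d, h1, ⟨h2, h3⟩, h4⟩ := hfin P a hP
        have hreg := (h4 _ (mul_ne_zero hr0 hη0)).1 (hmem P)
        have hxa : x - algebraMap k F a ≠ 0 := P.ne_zero_of_ord_ne_zero (by omega)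
        have hB'O : 0 ≤ P.ord (aeval x B') := by
          apply P.ord_nonneg
          apply aeval_mem_valuationSubring _ P.algebraMap_mem
          have := add_mem ((ValuationSubring.valuation_le_one_iff _ _).1 hP.le) (P.algebraMap_mem a)
          simpa using this
        -- A pole of `r` at `a` costs at least the ramification index `e`, while `η dx` has order
        -- strictly less than `e` there.
        have hA : A.eval a = 0 := by
          by_contra hA
          have h5 := M.ord_aeval_eq_zero P hP hA
          rw [P.ord_mul hr0 hη0, hrAB, P.ord_div hAx hBx, h5, map_mul,
            P.ord_mul (by simpa using hxa) (aeval_ne_zero_of_transcendental M.trans hB'), map_sub,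
            aeval_X, aeval_C, h1] at hreg
          omega
        obtain ⟨A', rfl⟩ := dvd_iff_isRoot.2 hA
        refine ih A' B' ?_ ?_
        · rw [natDegree_mul (X_sub_C_ne_zero a) hB', natDegree_X_sub_C] at hB
          omega
        · rw [hrAB, map_mul, map_mul, mul_div_mul_left]
          simpa using hxa
    obtain ⟨A, B, hAB⟩ := (IntermediateField.mem_adjoin_simple_iff k r).1 hr
    obtain ⟨A, rfl⟩ := hpol _ A B rfl hAB
    refine ⟨A, ?_, rfl⟩
    have hA : A ≠ 0 := by rintro rfl; simp at hr0
    -- At infinity `A(x) η dx` has order `N - 2 - deg A`, which gives the degree bound. For `N = 0`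
    -- nothing is allowed, in agreement with the truncated `N - 1 = 0`.
    obtain ⟨P, hP⟩ := M.exists_point_infinity
    obtain ⟨-, -, -, h1, h2⟩ := M.local_infinity p P hP
    have h3 := (h2 _ (mul_ne_zero hr0 hη0)).1 (hmem P)
    rw [P.ord_mul hr0 hη0, h1 A hA, hinf P hP] at h3
    rw [mem_degreeLT, degree_eq_natDegree hA]
    exact_mod_cast (by omega : A.natDegree < N - 1)
  · rintro ⟨A, hA, rfl⟩
    rcases eq_or_ne A 0 with rfl | hA0
    · simp
    have hAx := aeval_ne_zero_of_transcendental M.trans hA0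
    rw [mem_degreeLT, degree_eq_natDegree hA0] at hA
    have hA' : A.natDegree < N - 1 := by exact_mod_cast hA
    rw [holomorphicDifferentials, Submodule.mem_iInf]
    intro P
    by_cases hx : x ∈ P.localRing
    · obtain ⟨a, ha⟩ := P.exists_valuation_sub_lt_one M.toKummer hx
      obtain ⟨e, d, h1, ⟨h2, h3⟩, h4⟩ := hfin P a ha
      rw [h4 _ (mul_ne_zero hAx hη0), P.ord_mul hAx hη0]
      have := P.ord_nonneg (aeval_mem_valuationSubring _ P.algebraMap_mem hx A)
      omega
    · have hP := valuation_inv_lt_one P hx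
      obtain ⟨-, -, -, h1, h2⟩ := M.local_infinity p P hP
      rw [h2 _ (mul_ne_zero hAx hη0), P.ord_mul hAx hη0, h1 A hA0, hinf P hP]
      omega

end Model

end Model


/-! ### The action of automorphisms on points and differentials -/

section Action

variable {k : Type u} {F : Type v} [Field k] [Field F] [Algebra k F]

/-- The preimage of a point under an automorphism of the function field. -/
def Point.comap (P : Point k F) (σ : F ≃ₐ[k] F) : Point k F where
  localRing := P.localRing.comap (σ : F →+* F)
  algebraMap_mem c := by
    rw [ValuationSubring.mem_comap]
    simpa using P.algebraMap_mem c
  isDVR :=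
    let e : P.localRing ≃+* P.localRing.comap (σ : F →+* F) :=
      { toFun := fun a => ⟨σ.symm a, by simp [ValuationSubring.mem_comap]⟩
        invFun := fun b => ⟨σ b, b.2⟩
        left_inv := fun a => by ext; simp
        right_inv := fun b => by ext; simp
        map_mul' := fun a b => by ext; exact map_mul σ.symm (a : F) b
        map_add' := fun a b => by ext; exact map_add σ.symm (a : F) b }
    IsDiscreteValuationRing.RingEquivClass.isDiscreteValuationRing e

theorem Point.mem_comap {P : Point k F} {σ : F ≃ₐ[k] F} {b : F} :
    b ∈ (P.comap σ).localRing ↔ σ b ∈ P.localRing := Iff.rfl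

theorem Point.comap_injective (σ : F ≃ₐ[k] F) :
    Function.Injective fun P : Point k F => P.comap σ := by
  intro P Q h
  have : P.localRing = Q.localRing := by
    ext b
    have h1 := congrArg (fun R : Point k F => σ.symm b ∈ R.localRing) h
    simpa [Point.mem_comap] using h1
  cases P
  cases Q
  congr

theorem Point.comap_symm_comap (P : Point k F) (σ : F ≃ₐ[k] F) : (P.comap σ.symm).comap σ = P := by
  have : ((P.comap σ.symm).comap σ).localRing = P.localRing := by
    ext b
    simp [Point.mem_comap]
  revert this
  generalize (P.comap σ.symm).comap σ = Q
  intro h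
  cases P
  cases Q
  congr

/-- Since `σ` matches the local rings, the two orders are proportional with a nonnegative factor;
because a uniformizer at `P` has order `1`, the factor divides `1`. -/
theorem Point.ord_comap (P : Point k F) (σ : F ≃ₐ[k] F) (f : F) :
    (P.comap σ).ord f = P.ord (σ f) := by
  obtain ⟨t, ht⟩ := (P.comap σ).exists_ord_eq_one
  have ht0 : t ≠ 0 := (P.comap σ).ne_zero_of_ord_ne_zero (by omega)
  have key : ∀ f : F, f ≠ 0 → P.ord (σ f) = (P.comap σ).ord f * P.ord (σ t) := by
    intro f hf
    set n := (P.comap σ).ord f with hn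
    have hpow : t ^ n ≠ 0 := zpow_ne_zero _ ht0
    have hu : (P.comap σ).ord (f / t ^ n) = 0 := by
      rw [Point.ord_div _ hf hpow, Point.ord_zpow, ht, ← hn]
      ring
    have h1 := P.ord_nonneg (Point.mem_comap.1 ((P.comap σ).mem_of_ord_nonneg hu.ge))
    have h2 := P.ord_nonneg (Point.mem_comap.1 ((P.comap σ).mem_of_ord_nonneg
      (f := (f / t ^ n)⁻¹) (by rw [Point.ord_inv, hu, neg_zero])))
    rw [map_inv₀, P.ord_inv] at h2
    have h3 : P.ord (σ (f / t ^ n)) = 0 := by omega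
    rw [map_div₀, map_zpow₀, P.ord_div (by simpa using hf) (zpow_ne_zero _ (by simpa using ht0)),
      P.ord_zpow] at h3
    omega
  have h1 : P.ord (σ t) = 1 := by
    obtain ⟨s, hs⟩ := P.exists_ord_eq_one
    have hs0 : s ≠ 0 := P.ne_zero_of_ord_ne_zero (by omega)
    have h2 := key (σ.symm s) (by simpa using hs0)
    rw [AlgEquiv.apply_symm_apply, hs] at h2
    have h3 := P.ord_nonneg (Point.mem_comap.1 ((P.comap σ).mem_of_ord_nonneg
      (f := t) (by rw [ht]; norm_num)))
    exact Int.eq_one_of_mul_eq_one_left h3 h2.symm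
  rcases eq_or_ne f 0 with rfl | hf
  · rw [map_zero, Point.ord_zero, Point.ord_zero]
  · rw [key f hf, h1, mul_one]

theorem differentialAction_mem_holomorphic (σ : F ≃ₐ[k] F) {ω : Ω[F⁄k]}
    (hω : ω ∈ holomorphicDifferentials k F) :
    differentialAction σ ω ∈ holomorphicDifferentials k F := by
  rw [holomorphicDifferentials, Submodule.mem_iInf] at hω ⊢
  intro P
  have h := hω (P.comap σ)
  have hle : (P.comap σ).regularDifferentials ≤
      P.regularDifferentials.comap (differentialAction σ) := by
    refine Submodule.span_le.2 ?_
    rintro _ ⟨a, ha, b, hb, rfl⟩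
    change differentialAction σ (a • KaehlerDifferential.D k F b) ∈ P.regularDifferentials
    rw [differentialAction_smul_D]
    exact Submodule.subset_span ⟨σ a, ha, σ b, hb, rfl⟩
  exact hle h

end Action

/-! ### Explicit holomorphic differentials and the genus -/

section Holomorphic

open Polynomial KaehlerDifferential

variable {k : Type u} {F : Type v} [Field k] [Field F] [Algebra k F]
  {σ : F ≃ₐ[k] F} {ζ : k} {x y : F} {f g : k[X]} {m : ℕ}

namespace Model

theorem exists_decomposition_inv (M : Model σ ζ x y f g m) (h : F) :
    ∃ r₀ ∈ k⟮x⟯, ∃ r₁ ∈ k⟮x⟯, ∃ r₂ ∈ k⟮x⟯,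
      h = r₀ + r₁ * y⁻¹ + r₂ * (y ^ 2 / aeval x g)⁻¹ := by
  obtain ⟨b₀, h0, b₁, h1, b₂, h2, rfl⟩ := M.toKummer.decomposition h
  have hy := M.ne_zero
  have hg := M.aeval_g_ne_zero
  refine ⟨b₀, h0, b₂ * y ^ 3, mul_mem h2 M.cube_mem, b₁ * (y ^ 3 / aeval x g),
    mul_mem h1 (div_mem M.cube_mem (aeval_mem_adjoin_simple x g)), ?_⟩
  field_simp
  ring

theorem action_smul (M : Model σ ζ x y f g m) (h : F) :
    differentialAction σ (h • D k F x) = σ h • D k F x := by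
  rw [differentialAction_smul_D, M.map_fixed]

theorem act_inv (M : Model σ ζ x y f g m) : σ y⁻¹ = algebraMap k F (ζ ^ 2) * y⁻¹ := by
  have h3 : algebraMap k F ζ * algebraMap k F (ζ ^ 2) = 1 := by
    rw [← map_mul, ← pow_succ', M.prim.pow_eq_one, map_one]
  rw [map_inv₀, M.act, mul_inv, eq_inv_of_mul_eq_one_right h3]

theorem act_swap_inv (M : Model σ ζ x y f g m) :
    σ (y ^ 2 / aeval x g)⁻¹ = algebraMap k F ζ * (y ^ 2 / aeval x g)⁻¹ := by
  rw [M.swap.act_inv, ← pow_mul, pow_succ, M.prim.pow_eq_one, one_mul]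

theorem act_decomposition (M : Model σ ζ x y f g m) {r₀ r₁ r₂ : F} (h0 : r₀ ∈ k⟮x⟯)
    (h1 : r₁ ∈ k⟮x⟯) (h2 : r₂ ∈ k⟮x⟯) :
    σ (r₀ + r₁ * y⁻¹ + r₂ * (y ^ 2 / aeval x g)⁻¹) =
      r₀ + algebraMap k F (ζ ^ 2) * (r₁ * y⁻¹) +
        algebraMap k F ζ * (r₂ * (y ^ 2 / aeval x g)⁻¹) := by
  rw [map_add, map_add, map_mul, map_mul, M.act_inv, M.act_swap_inv, (M.fixed_iff _).2 h0,
    (M.fixed_iff _).2 h1, (M.fixed_iff _).2 h2]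
  ring

/-- The two summands are eigenvectors of `σ` for the distinct eigenvalues `ζ ^ 2` and `ζ`. -/
theorem decomposition_eq_zero (M : Model σ ζ x y f g m) {r₁ r₂ : F}
    (h1 : r₁ ∈ k⟮x⟯) (h2 : r₂ ∈ k⟮x⟯)
    (h : r₁ * y⁻¹ + r₂ * (y ^ 2 / aeval x g)⁻¹ = 0) : r₁ = 0 ∧ r₂ = 0 := by
  have h3 := M.act_decomposition (zero_mem k⟮x⟯) h1 h2
  rw [zero_add, h, map_zero, zero_add] at h3
  have hne : algebraMap k F ζ - algebraMap k F (ζ ^ 2) ≠ 0 := by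
    rw [← map_sub, Ne, map_eq_zero, sub_eq_zero]
    intro h4
    have hz0 : ζ ≠ 0 := M.prim.ne_zero (by norm_num)
    have : ζ = 1 := by
      apply mul_left_cancel₀ hz0
      rw [mul_one, ← pow_two, ← h4]
    exact M.prim.ne_one (by norm_num) this
  have h5 : (algebraMap k F ζ - algebraMap k F (ζ ^ 2)) * (r₂ * (y ^ 2 / aeval x g)⁻¹) = 0 := by
    linear_combination -h3 - algebraMap k F (ζ ^ 2) * h
  have h6 := (mul_eq_zero.1 h5).resolve_left hne
  rw [h6, add_zero] at h
  exact ⟨(mul_eq_zero.1 h).resolve_right (inv_ne_zero M.ne_zero),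
    (mul_eq_zero.1 h6).resolve_right (inv_ne_zero M.swap.ne_zero)⟩

/-- The differentials `(A(x) / y + B(x) / z) dx`, where `z = y ^ 2 / g(x)`. -/
noncomputable def differentialMap (x y : F) (g : k[X]) (m n : ℕ) :
    (degreeLT k m × degreeLT k n) →ₗ[k] Ω[F⁄k] where
  toFun A := (aeval x (A.1 : k[X]) * y⁻¹ + aeval x (A.2 : k[X]) * (y ^ 2 / aeval x g)⁻¹) • D k F x
  map_add' A B := by
    rw [← add_smul]
    congr 1
    simp only [Prod.fst_add, Prod.snd_add, Submodule.coe_add, map_add]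
    ring
  map_smul' c A := by
    simp only [Prod.smul_fst, Prod.smul_snd, Submodule.coe_smul, map_smul, RingHom.id_apply,
      smul_mul_assoc, ← smul_add, smul_assoc]

theorem finrank_degreeLT (n : ℕ) : Module.finrank k (degreeLT k n) = n := by
  rw [(degreeLTEquiv k n).finrank_eq, Module.finrank_fin_fun]

variable [IsAlgClosed k]

/-- The holomorphic space is stable under `σ` and `3` is invertible, so the eigencomponents of a
holomorphic differential are holomorphic. Each is then settled by `mem_holomorphic_iff`. -/
theorem holomorphicDifferentials_eq_range (p : ℕ) [Fact p.Prime] [CharP F p]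
    (M : Model σ ζ x y f g m) : holomorphicDifferentials k F =
      LinearMap.range (differentialMap x y g (m - 1) (2 * m - g.natDegree - 1)) := by
  have h3 : (3 : F) ≠ 0 := by
    rw [← map_ofNat (algebraMap k F) 3]
    exact (_root_.map_ne_zero _).2 M.prim.three_ne_zero
  apply le_antisymm
  · intro ω hω
    obtain ⟨h, rfl⟩ := (M.toKummer.frobSpan (p := p)).exists_smul_D ω
    obtain ⟨r₀, hr0, r₁, hr1, r₂, hr2, rfl⟩ := M.exists_decomposition_inv h
    have hS := differentialAction_mem_holomorphic σ hω
    have hSS := differentialAction_mem_holomorphic σ hS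
    rw [M.action_smul, M.act_decomposition hr0 hr1 hr2] at hS
    rw [M.action_smul, M.action_smul, M.act_decomposition hr0 hr1 hr2] at hSS
    simp only [map_add, map_mul, AlgEquiv.commutes, (M.fixed_iff _).2 hr0, (M.fixed_iff _).2 hr1,
      (M.fixed_iff _).2 hr2, M.act_inv, M.act_swap_inv] at hSS
    have hsum : 1 + algebraMap k F ζ + algebraMap k F (ζ ^ 2) = 0 := by
      have := congrArg (algebraMap k F) M.prim.one_add_self_add_sq
      simpa only [map_add, map_one, map_zero] using this
    have hz1 : algebraMap k F ζ * algebraMap k F (ζ ^ 2) = 1 := by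
      rw [← map_mul, ← pow_succ', M.prim.pow_eq_one, map_one]
    have hz2 : algebraMap k F ζ * algebraMap k F ζ = algebraMap k F (ζ ^ 2) := by
      rw [← map_mul, ← pow_two]
    have hz4 : algebraMap k F (ζ ^ 2) * algebraMap k F (ζ ^ 2) = algebraMap k F ζ := by
      rw [← map_mul, ← pow_add, pow_succ, M.prim.pow_eq_one, one_mul]
    -- This is `(a ω + b σω + c σ²ω) / 3`; the three weight vectors used below are the projectors to
    -- the eigenspaces for `1`, `ζ ^ 2` and `ζ`.
    have hcomb : ∀ (a b c : k) (u : F), (3 : F)⁻¹ * ((r₀ + r₁ * y⁻¹ + r₂ * (y ^ 2 / aeval x g)⁻¹) * algebraMap k F a +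
        algebraMap k F b * (r₀ + algebraMap k F (ζ ^ 2) * (r₁ * y⁻¹) +
        algebraMap k F ζ * (r₂ * (y ^ 2 / aeval x g)⁻¹)) +
        algebraMap k F c * (r₀ + algebraMap k F (ζ ^ 2) * (r₁ * (algebraMap k F (ζ ^ 2) * y⁻¹)) +
        algebraMap k F ζ * (r₂ * (algebraMap k F ζ * (y ^ 2 / aeval x g)⁻¹)))) = u →
        u • D k F x ∈ holomorphicDifferentials k F := by
      rintro a b c _ rfl
      have e := add_mem (add_mem (Submodule.smul_mem _ a hω) (Submodule.smul_mem _ b hS))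
        (Submodule.smul_mem _ c hSS)
      have e' := Submodule.smul_mem _ (3 : k)⁻¹ e
      have hs : ∀ (c : k) (h : F), c • h • D k F x = (algebraMap k F c * h) • D k F x := by
        intro c h
        rw [← algebraMap_smul F c, smul_smul]
      rw [hs a, hs b, hs c, ← add_smul, ← add_smul, hs, map_inv₀, map_ofNat,
        mul_comm (algebraMap k F a)] at e'
      exact e'
    have m0 := hcomb 1 1 1 (r₀ * 1) (by
      rw [inv_mul_eq_iff_eq_mul₀ h3, map_one]
      generalize (y ^ 2 / aeval x g)⁻¹ = w at *
      generalize y⁻¹ = s at *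
      generalize algebraMap k F (ζ ^ 2) = z' at *
      linear_combination (r₁ * s) * (hz4 + hsum) + (r₂ * w) * (hz2 + hsum))
    have m1 := hcomb 1 ζ (ζ ^ 2) (r₁ * y⁻¹) (by
      rw [inv_mul_eq_iff_eq_mul₀ h3, map_one]
      generalize (y ^ 2 / aeval x g)⁻¹ = w at *
      generalize y⁻¹ = s at *
      generalize algebraMap k F (ζ ^ 2) = z' at *
      linear_combination r₀ * hsum + (r₁ * s) * (hz1 + z' * hz4 + hz1) +
        (r₂ * w) * (hz2 + z' * hz2 + hz4 + hsum))
    have m2 := hcomb 1 (ζ ^ 2) ζ (r₂ * (y ^ 2 / aeval x g)⁻¹) (by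
      rw [inv_mul_eq_iff_eq_mul₀ h3, map_one]
      generalize (y ^ 2 / aeval x g)⁻¹ = w at *
      generalize y⁻¹ = s at *
      generalize algebraMap k F (ζ ^ 2) = z' at *
      linear_combination r₀ * hsum + (r₂ * w) * (hz1 + algebraMap k F ζ * hz2 + hz1) +
        (r₁ * s) * (hz4 + algebraMap k F ζ * hz4 + hz2 + hsum))
    obtain ⟨A₀, hA₀, h0⟩ := (M.mem_holomorphic_iff p (Or.inl ⟨rfl, rfl⟩) hr0).1 m0
    obtain ⟨A, hA, h1⟩ := (M.mem_holomorphic_iff p (Or.inr (Or.inl ⟨rfl, rfl⟩)) hr1).1 m1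
    obtain ⟨B, hB, h2⟩ := (M.mem_holomorphic_iff p (Or.inr (Or.inr ⟨rfl, rfl⟩)) hr2).1 m2
    -- The invariant part comes from the projective line, which has no holomorphic differentials:
    -- the bound is `degreeLT k (0 - 1)`, the zero space.
    have hA0 : A₀ = 0 := by
      rw [mem_degreeLT] at hA₀
      by_contra hne
      rw [degree_eq_natDegree hne] at hA₀
      simp at hA₀
    refine ⟨⟨⟨A, hA⟩, ⟨B, hB⟩⟩, ?_⟩
    change (aeval x A * y⁻¹ + aeval x B * (y ^ 2 / aeval x g)⁻¹) • D k F x = _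
    rw [← h1, ← h2, h0, hA0, map_zero, zero_add]
  · rintro _ ⟨⟨⟨A, hA⟩, ⟨B, hB⟩⟩, rfl⟩
    change (aeval x A * y⁻¹ + aeval x B * (y ^ 2 / aeval x g)⁻¹) • D k F x ∈ _
    rw [add_smul]
    exact add_mem ((M.mem_holomorphic_iff p (Or.inr (Or.inl ⟨rfl, rfl⟩))
        (aeval_mem_adjoin_simple x A)).2 ⟨A, hA, rfl⟩)
      ((M.mem_holomorphic_iff p (Or.inr (Or.inr ⟨rfl, rfl⟩))
        (aeval_mem_adjoin_simple x B)).2 ⟨B, hB, rfl⟩)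

theorem differentialMap_injective (p : ℕ) [Fact p.Prime] [CharP F p]
    (M : Model σ ζ x y f g m) (n n' : ℕ) : Function.Injective (differentialMap x y g n n') := by
  rw [← LinearMap.ker_eq_bot, LinearMap.ker_eq_bot']
  rintro ⟨⟨A, hA⟩, ⟨B, hB⟩⟩ h
  change (aeval x A * y⁻¹ + aeval x B * (y ^ 2 / aeval x g)⁻¹) • D k F x = 0 at h
  have h0 := (smul_eq_zero.1 h).resolve_right (M.toKummer.frobGen (p := p)).D_ne_zero
  obtain ⟨h1, h2⟩ := M.decomposition_eq_zero (aeval_mem_adjoin_simple x A)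
    (aeval_mem_adjoin_simple x B) h0
  have hz : ∀ A : k[X], aeval x A = 0 → A = 0 := fun A hA => by
    by_contra hne
    exact aeval_ne_zero_of_transcendental M.trans hne hA
  have hA0 := hz A h1
  have hB0 := hz B h2
  subst hA0 hB0
  rfl

theorem genus_eq (p : ℕ) [Fact p.Prime] [CharP F p] (M : Model σ ζ x y f g m) :
    genus k F = (m - 1) + (2 * m - g.natDegree - 1) := by
  have : ∀ n, Module.Finite k (degreeLT k n) := fun n => Module.Finite.equiv (degreeLTEquiv k n).symm
  rw [genus, M.holomorphicDifferentials_eq_range p,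
    LinearMap.finrank_range_of_inj (M.differentialMap_injective p _ _), Module.finrank_prod,
    finrank_degreeLT, finrank_degreeLT]

end Model

end Holomorphic


/-! ### Logarithmic differentials and `p`-torsion of the Jacobian -/

section PRank

open KaehlerDifferential

variable {k : Type u} {F : Type v} [Field k] [Field F] [Algebra k F] {p : ℕ} [Fact p.Prime]
  [CharP F p]

theorem IsCartierOperator.log {C : Ω[F⁄k] →+ Ω[F⁄k]} (hC : IsCartierOperator k F p C) {f : F}
    (hf : f ≠ 0) : C (f⁻¹ • D k F f) = f⁻¹ • D k F f := by
  have hp : p.Prime := Fact.out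
  have h1 : f⁻¹ • D k F f = (f⁻¹) ^ p • (f ^ (p - 1) • D k F f) := by
    rw [smul_smul]
    congr 1
    obtain ⟨q, rfl⟩ : ∃ q, p = q + 1 := ⟨p - 1, by have := hp.pos; omega⟩
    rw [Nat.add_sub_cancel, inv_pow]
    field_simp
    ring
  conv_lhs => rw [h1]
  rw [hC.pow_smul, hC.pow_sub_one_smul]

/-- Locally `f` is a `p`-th power times a unit `v`. Since `p`-th powers have zero differential, `df
/ f = dv / v`, which is regular. -/
theorem log_differential_mem_holomorphic {f : F} (hf : f ≠ 0) {n : Point k F → ℤ}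
    (h : ∀ P : Point k F, P.ord f = p * n P) :
    f⁻¹ • D k F f ∈ holomorphicDifferentials k F := by
  rw [holomorphicDifferentials, Submodule.mem_iInf]
  intro P
  obtain ⟨t, ht⟩ := P.exists_ord_eq_one
  have ht0 : t ≠ 0 := P.ne_zero_of_ord_ne_zero (by omega)
  have hs0 : (t ^ n P) ^ p ≠ 0 := pow_ne_zero _ (zpow_ne_zero _ ht0)
  set w := (t ^ n P) ^ p with hw
  have hwo : P.ord w = p * n P := by rw [hw, P.ord_pow, P.ord_zpow, ht, mul_one]
  have hu : P.ord (f / w) = 0 := by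
    rw [P.ord_div hf hs0, h, hwo, sub_self]
  have hD : f⁻¹ • D k F f = (f / w)⁻¹ • D k F (f / w) := by
    have h1 : f = w * (f / w) := by field_simp
    have h2 : D k F f = w • D k F (f / w) := by
      conv_lhs => rw [h1]
      rw [Derivation.leibniz, hw, D_pow_char, smul_zero, add_zero]
    rw [h2, smul_smul]
    congr 1
    field_simp
  rw [hD]
  exact Submodule.subset_span ⟨_, P.mem_of_ord_nonneg (by rw [P.ord_inv, hu, neg_zero]), _,
    P.mem_of_ord_nonneg hu.ge, rfl⟩

/-- If the Cartier operator vanishes on holomorphic differentials, the Jacobian has no nontrivial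
`p`-torsion. -/
theorem hasPRank_zero_of_cartier (hF : IsCurve k F) {x : F} (hx : FrobSpan p x)
    {C : Ω[F⁄k] →+ Ω[F⁄k]} (hC : IsCartierOperator k F p C)
    (h0 : ∀ ω ∈ holomorphicDifferentials k F, C ω = 0) : HasPRank k F p 0 := by
  have hp : p.Prime := Fact.out
  have hzero : ∀ c : Jacobian k F, p • c = 0 → c = 0 := by
    intro c
    induction c using QuotientAddGroup.induction_on with
    | H E =>
      intro hc
      rw [← QuotientAddGroup.mk_nsmul, QuotientAddGroup.eq_zero_iff, AddSubgroup.mem_addSubgroupOf] at hc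
      obtain ⟨f, hf, hE⟩ := hc
      have hord : ∀ P : Point k F, P.ord f = p * (E : Divisor k F) P := by
        intro P
        rw [← hE P]
        simp
      -- The form `df / f` is fixed by the Cartier operator and also killed by it, so `df = 0`. Then
      -- `f = g ^ p`, and `E` is the divisor of `g`.
      have h1 := h0 _ (log_differential_mem_holomorphic (p := p) hf hord)
      rw [hC.log hf] at h1
      have h2 := (smul_eq_zero.1 h1).resolve_left (inv_ne_zero hf)
      obtain ⟨g, rfl⟩ := (hx.D_eq_zero_iff hF).1 h2
      rw [QuotientAddGroup.eq_zero_iff, AddSubgroup.mem_addSubgroupOf]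
      refine ⟨g, fun hg => hf (by rw [hg, zero_pow hp.ne_zero]), fun P => ?_⟩
      have h3 := hord P
      rw [P.ord_pow] at h3
      exact (mul_left_cancel₀ (by exact_mod_cast hp.ne_zero) h3).symm
  rw [HasPRank, pow_zero, Nat.card_eq_one_iff_unique]
  exact ⟨⟨fun a b => Subtype.ext ((hzero _ a.2).trans (hzero _ b.2).symm)⟩, ⟨⟨0, smul_zero _⟩⟩⟩

end PRank

/-! ### Vanishing of the Cartier operator on the explicit curve -/

section Superspecial

open Polynomial KaehlerDifferential

variable {k : Type u} [Field k] {p : ℕ}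

theorem exists_derivative_eq [CharP k p] {G : k[X]} (hG : ∀ i, p ∣ i + 1 → G.coeff i = 0) :
    ∃ Q : k[X], derivative Q = G := by
  refine ⟨∑ i ∈ Finset.range (G.natDegree + 1), monomial (i + 1) (G.coeff i / ((i + 1 : ℕ) : k)), ?_⟩
  conv_rhs => rw [G.as_sum_range]
  rw [derivative_sum]
  refine Finset.sum_congr rfl fun i _ => ?_
  rw [derivative_monomial, Nat.add_sub_cancel]
  congr 1
  by_cases h : ((i + 1 : ℕ) : k) = 0
  · rw [hG i ((CharP.cast_eq_zero_iff k p _).1 h), zero_div, zero_mul]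
  · rw [div_mul_cancel₀ _ h]

theorem natDegree_X_sq_sub_one : (X ^ 2 - 1 : k[X]).natDegree = 2 := by
  rw [← C_1]; exact natDegree_X_pow_sub_C

theorem natDegree_X_sq_add_one : (X ^ 2 + 1 : k[X]).natDegree = 2 := by
  rw [← C_1]; exact natDegree_X_pow_add_C

theorem reverse_pow (A : k[X]) (n : ℕ) : (A ^ n).reverse = A.reverse ^ n := by
  induction n with
  | zero => rw [pow_zero, pow_zero, ← C_1, reverse_C]
  | succ n ih => rw [pow_succ, pow_succ, reverse_mul_of_domain, ih]

theorem reverse_X_sq_sub_one : (X ^ 2 - 1 : k[X]).reverse = -(X ^ 2 - 1) := by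
  ext n
  rw [coeff_reverse, natDegree_X_sq_sub_one]
  rcases (by omega : n = 0 ∨ n = 1 ∨ n = 2 ∨ 2 < n) with rfl | rfl | rfl | h
  · rw [revAt_le (by norm_num)]; simp [coeff_one]
  · rw [revAt_le (by norm_num)]; simp [coeff_X_pow, coeff_one]
  · rw [revAt_le (by norm_num)]; simp [coeff_one]
  · rw [revAt_eq_self_of_lt h]
    have h0 : n ≠ 0 := by omega
    simp [coeff_X_pow, coeff_one, h.ne', h0]

theorem reverse_X_sq_add_one : (X ^ 2 + 1 : k[X]).reverse = X ^ 2 + 1 := by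
  ext n
  rw [coeff_reverse, natDegree_X_sq_add_one]
  rcases (by omega : n = 0 ∨ n = 1 ∨ n = 2 ∨ 2 < n) with rfl | rfl | rfl | h
  · rw [revAt_le (by norm_num)]; simp [coeff_one]
  · rw [revAt_le (by norm_num)]
  · rw [revAt_le (by norm_num)]; simp [coeff_one]
  · rw [revAt_eq_self_of_lt h]

/-- The coefficients of `(X² - 1) ^ a (X² + 1) ^ b` that the Cartier operator sees vanish: the
polynomial is antipalindromic. -/
theorem coeff_eq_zero_of_antipalindromic (hp2 : (2 : k) ≠ 0) {a b : ℕ} (ha : Odd a)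
    (hab : a + b + 1 = p) {i : ℕ} (hi : p ∣ i + 1) :
    ((X ^ 2 - 1 : k[X]) ^ a * (X ^ 2 + 1) ^ b).coeff i = 0 := by
  have h1 : (X ^ 2 - 1 : k[X]) ≠ 0 := by
    intro h; have := natDegree_X_sq_sub_one (k := k); rw [h] at this; simp at this
  have h2 : (X ^ 2 + 1 : k[X]) ≠ 0 := by
    intro h; have := natDegree_X_sq_add_one (k := k); rw [h] at this; simp at this
  have hdeg : ((X ^ 2 - 1 : k[X]) ^ a * (X ^ 2 + 1) ^ b).natDegree = 2 * (a + b) := by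
    rw [natDegree_mul (pow_ne_zero _ h1) (pow_ne_zero _ h2), natDegree_pow, natDegree_pow,
      natDegree_X_sq_sub_one, natDegree_X_sq_add_one]
    ring
  have hrev : ((X ^ 2 - 1 : k[X]) ^ a * (X ^ 2 + 1) ^ b).reverse =
      -((X ^ 2 - 1 : k[X]) ^ a * (X ^ 2 + 1) ^ b) := by
    rw [reverse_mul_of_domain, reverse_pow, reverse_pow, reverse_X_sq_sub_one,
      reverse_X_sq_add_one, ha.neg_pow, neg_mul]
  obtain ⟨j, hj⟩ := hi
  rcases (by omega : j = 0 ∨ j = 1 ∨ 2 ≤ j) with rfl | rfl | hj2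
  · omega
  -- Among exponents up to the degree `2 (p - 1)`, only `p - 1 = a + b` is possible. It is the
  -- middle one, so reversal makes the coefficient equal to its own negative.
  · have hii : i = a + b := by omega
    have h3 := congrArg (fun q : k[X] => q.coeff i) hrev
    simp only [coeff_reverse, hdeg, coeff_neg] at h3
    rw [revAt_le (by omega), show 2 * (a + b) - i = i by omega] at h3
    have h4 : (2 : k) * ((X ^ 2 - 1 : k[X]) ^ a * (X ^ 2 + 1) ^ b).coeff i = 0 := by
      linear_combination h3
    exact (mul_eq_zero.1 h4).resolve_left hp2
  · apply coeff_eq_zero_of_natDegree_lt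
    rw [hdeg]
    have : p * 2 ≤ p * j := Nat.mul_le_mul_left _ hj2
    omega

variable {F : Type v} [Field F] [Algebra k F] {σ : F ≃ₐ[k] F} {ζ : k} {x y : F} {f g : k[X]} {m : ℕ}

/-- From `y ^ (p + 1) = (f g ^ 2) ^ (q + 1)` one gets `y⁻¹ = (y / (f g)) ^ p * f ^ (2 q + 1) * g ^
q`. Under the coefficient condition the polynomial has an antiderivative, so what remains after
extracting the `p`-th power is exact. -/
theorem Model.cartier_inv_eq_zero [Fact p.Prime] [CharP k p]
    (M : Model σ ζ x y f g m) {q : ℕ} (hq : p = 3 * q + 2)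
    (hfg : ∀ i, p ∣ i + 1 → (f ^ (2 * q + 1) * g ^ q).coeff i = 0) {C : Ω[F⁄k] →+ Ω[F⁄k]}
    (hC : IsCartierOperator k F p C) : C (y⁻¹ • D k F x) = 0 := by
  obtain ⟨Q, hQ⟩ := exists_derivative_eq hfg
  have hy := M.ne_zero
  have hf := M.aeval_f_ne_zero
  have hg := M.aeval_g_ne_zero
  have h1 : y⁻¹ = (y / (aeval x f * aeval x g)) ^ p * aeval x (f ^ (2 * q + 1) * g ^ q) := by
    have h2 : y ^ (p + 1) = (aeval x f * aeval x g ^ 2) ^ (q + 1) := by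
      rw [← M.eqn, ← pow_mul]
      congr 1
      omega
    have h3 : y ^ p = y⁻¹ * (aeval x f * aeval x g ^ 2) ^ (q + 1) := by
      rw [← h2, pow_succ]
      field_simp
    rw [div_pow, h3, hq]
    simp only [map_mul, map_pow]
    field_simp
    ring
  rw [h1, mul_smul, hC.pow_smul, ← hQ, ← Model.D_aeval, hC.exact, smul_zero]

/-- The basis `dx / z`, `dx / y` consists of eigenvectors for `ζ` and `ζ ^ 2` respectively. -/
theorem Model.hasSignature [IsAlgClosed k] [Fact p.Prime] [CharP F p] (M : Model σ ζ x y f g 2)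
    (hg : g.natDegree = 2) : HasSignature σ ζ 1 1 := by
  have hD : D k F x ≠ 0 := (M.toKummer.frobGen (p := p)).D_ne_zero
  have hz := M.swap.ne_zero
  have hy := M.ne_zero
  have hζ0 : ζ ≠ 0 := M.prim.ne_zero (by norm_num)
  have hζ1 : ζ ≠ 1 := M.prim.ne_one (by norm_num)
  have hc1 : ∀ A ∈ degreeLT k (2 - 1), ∃ a : k, A = Polynomial.C a := by
    intro A hA
    rw [mem_degreeLT] at hA
    exact ⟨_, eq_C_of_degree_le_zero (Order.le_of_lt_succ (by exact_mod_cast hA))⟩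
  have hform : ∀ ω ∈ holomorphicDifferentials k F, ∃ a b : k,
      ω = (a • y⁻¹ + b • (y ^ 2 / aeval x g)⁻¹) • D k F x := by
    intro ω hω
    rw [M.holomorphicDifferentials_eq_range p, hg] at hω
    obtain ⟨⟨⟨A, hA⟩, ⟨B, hB⟩⟩, rfl⟩ := hω
    obtain ⟨a, rfl⟩ := hc1 A hA
    obtain ⟨b, rfl⟩ := hc1 B hB
    refine ⟨a, b, ?_⟩
    change (aeval x (Polynomial.C a) * y⁻¹ + aeval x (Polynomial.C b) * (y ^ 2 / aeval x g)⁻¹) • D k F x = _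
    rw [aeval_C, aeval_C, Algebra.smul_def, Algebra.smul_def]
  have hmem1 : y⁻¹ • D k F x ∈ holomorphicDifferentials k F := by
    have := (M.mem_holomorphic_iff p (Or.inr (Or.inl ⟨rfl, rfl⟩)) (one_mem k⟮x⟯)).2
      ⟨1, by rw [mem_degreeLT, degree_one]; norm_num, by simp⟩
    rwa [one_mul] at this
  have hmem2 : (y ^ 2 / aeval x g)⁻¹ • D k F x ∈ holomorphicDifferentials k F := by
    have := (M.mem_holomorphic_iff p (Or.inr (Or.inr ⟨rfl, rfl⟩)) (one_mem k⟮x⟯)).2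
      ⟨1, by rw [mem_degreeLT, degree_one, hg]; norm_num, by simp⟩
    rwa [one_mul] at this
  have hact : ∀ a b : k, differentialAction σ ((a • y⁻¹ + b • (y ^ 2 / aeval x g)⁻¹) • D k F x) =
      ((ζ ^ 2 * a) • y⁻¹ + (ζ * b) • (y ^ 2 / aeval x g)⁻¹) • D k F x := by
    intro a b
    rw [M.action_smul, map_add, map_smul, map_smul, M.act_inv, M.act_swap_inv, ← Algebra.smul_def,
      ← Algebra.smul_def, smul_smul, smul_smul, mul_comm a, mul_comm b]
  have hsep : ∀ a b c d : k, (a • y⁻¹ + b • (y ^ 2 / aeval x g)⁻¹) • D k F x =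
      (c • y⁻¹ + d • (y ^ 2 / aeval x g)⁻¹) • D k F x → a = c ∧ b = d := by
    intro a b c d h
    have h1 := smul_left_injective F hD h
    have h2 := M.decomposition_eq_zero (algebraMap_mem k⟮x⟯ (a - c)) (algebraMap_mem k⟮x⟯ (b - d)) (by
      simp only [Algebra.smul_def] at h1
      simp only [map_sub]
      linear_combination h1)
    constructor
    · exact sub_eq_zero.1 ((map_eq_zero _).1 h2.1)
    · exact sub_eq_zero.1 ((map_eq_zero _).1 h2.2)
  have hspan1 : eigendifferentials σ ζ 1 = k ∙ ((y ^ 2 / aeval x g)⁻¹ • D k F x) := by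
    apply le_antisymm
    · rintro ω ⟨hω, hE⟩
      obtain ⟨a, b, rfl⟩ := hform ω hω
      have hE := Module.End.mem_eigenspace_iff.1 hE
      rw [hact, pow_one, ← smul_assoc, smul_add, smul_smul, smul_smul] at hE
      have h1 := (hsep _ _ _ _ hE).1
      have ha : a = 0 := by
        by_contra ha
        apply hζ1
        have := mul_right_cancel₀ ha h1
        rw [pow_two] at this
        exact mul_left_cancel₀ hζ0 (by rw [this, mul_one])
      rw [ha, zero_smul, zero_add, smul_assoc]
      exact Submodule.smul_mem _ _ (Submodule.mem_span_singleton_self _)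
    · rw [Submodule.span_singleton_le_iff_mem]
      refine ⟨hmem2, Module.End.mem_eigenspace_iff.2 ?_⟩
      rw [M.action_smul, M.act_swap_inv, pow_one, mul_smul, algebraMap_smul]
  have hspan2 : eigendifferentials σ ζ 2 = k ∙ (y⁻¹ • D k F x) := by
    apply le_antisymm
    · rintro ω ⟨hω, hE⟩
      obtain ⟨a, b, rfl⟩ := hform ω hω
      have hE := Module.End.mem_eigenspace_iff.1 hE
      rw [hact, ← smul_assoc, smul_add, smul_smul, smul_smul] at hE
      have h1 := (hsep _ _ _ _ hE).2
      have hb : b = 0 := by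
        by_contra hb
        apply hζ1
        have := mul_right_cancel₀ hb h1
        rw [pow_two] at this
        exact mul_left_cancel₀ hζ0 (by rw [← this, mul_one])
      rw [hb, zero_smul, add_zero, smul_assoc]
      exact Submodule.smul_mem _ _ (Submodule.mem_span_singleton_self _)
    · rw [Submodule.span_singleton_le_iff_mem]
      refine ⟨hmem1, Module.End.mem_eigenspace_iff.2 ?_⟩
      rw [M.action_smul, M.act_inv, mul_smul, algebraMap_smul]
  constructor
  · rw [hspan1, finrank_span_singleton (smul_ne_zero (inv_ne_zero hz) hD)]
  · rw [hspan2, finrank_span_singleton (smul_ne_zero (inv_ne_zero hy) hD)]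

/-- For `dx / y` and `dx / z` the exponents of `X² - 1` are `2 q + 1` and `q`. Both are odd because
`p = 3 q + 2` is odd, so the antipalindromic argument applies to each. -/
theorem Model.cartier_eq_zero [IsAlgClosed k] [Fact p.Prime] [CharP k p]
    (M : Model σ ζ x y (X ^ 2 - 1) (X ^ 2 + 1) 2) (hp2 : p ≠ 2) (hp3 : p % 3 = 2)
    {C : Ω[F⁄k] →+ Ω[F⁄k]} (hC : IsCartierOperator k F p C) :
    ∀ ω ∈ holomorphicDifferentials k F, C ω = 0 := by
  have hp : p.Prime := Fact.out
  have hF : CharP F p := charP_of_injective_algebraMap (algebraMap k F).injective p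
  have h2 : (2 : k) ≠ 0 := by
    intro h
    have : p ∣ 2 := (CharP.cast_eq_zero_iff k p 2).1 (by exact_mod_cast h)
    exact hp2 ((Nat.prime_dvd_prime_iff_eq hp Nat.prime_two).1 this)
  have hodd := hp.odd_of_ne_two hp2
  obtain ⟨q, hq⟩ : ∃ q, p = 3 * q + 2 := ⟨p / 3, by omega⟩
  have hqodd : Odd q := by
    rw [hq] at hodd
    rw [Nat.odd_iff] at hodd ⊢
    omega
  have h1 := M.cartier_inv_eq_zero hq (fun i hi =>
    coeff_eq_zero_of_antipalindromic h2 (odd_two_mul_add_one q) (by omega) hi) hC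
  have h3 := M.swap.cartier_inv_eq_zero hq (fun i hi => by
    rw [mul_comm]
    exact coeff_eq_zero_of_antipalindromic h2 hqodd (by omega) hi) hC
  intro ω hω
  rw [M.holomorphicDifferentials_eq_range p, natDegree_X_sq_add_one] at hω
  obtain ⟨⟨⟨A, hA⟩, ⟨B, hB⟩⟩, rfl⟩ := hω
  have hc1 : ∀ A ∈ degreeLT k (2 - 1), ∃ a : k, A = Polynomial.C (a ^ p) := by
    intro A hA
    rw [mem_degreeLT] at hA
    obtain ⟨a, ha⟩ := IsAlgClosed.exists_pow_nat_eq (A.coeff 0) hp.pos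
    exact ⟨a, by rw [ha]; exact eq_C_of_degree_le_zero (Order.le_of_lt_succ (by exact_mod_cast hA))⟩
  obtain ⟨a, rfl⟩ := hc1 A hA
  obtain ⟨b, rfl⟩ := hc1 B hB
  change C ((aeval x (Polynomial.C (a ^ p)) * y⁻¹ + aeval x (Polynomial.C (b ^ p)) *
    (y ^ 2 / aeval x (X ^ 2 + 1 : k[X]))⁻¹) • D k F x) = 0
  rw [aeval_C, aeval_C, add_smul, map_add, map_pow, map_pow, mul_smul, mul_smul, hC.pow_smul,
    hC.pow_smul, h1, h3, smul_zero, smul_zero, add_zero]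

end Superspecial


/-! ### Kummer generators give trielliptic covers -/

section Cover

variable {k : Type u} {F : Type v} [Field k] [Field F] [Algebra k F] {σ : F ≃ₐ[k] F} {ζ : k}
  {x y : F}

theorem mem_fixedField_zpowers_iff {b : F} :
    b ∈ IntermediateField.fixedField (Subgroup.zpowers σ) ↔ σ b = b := by
  rw [IntermediateField.mem_fixedField_iff]
  constructor
  · exact fun h => h σ (Subgroup.mem_zpowers σ)
  · intro h τ hτ
    have hle : Subgroup.zpowers σ ≤ MulAction.stabilizer (F ≃ₐ[k] F) b := by
      rw [Subgroup.zpowers_le]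
      exact h
    exact hle hτ

theorem Kummer.isTriellipticCover (h : Kummer σ ζ x y) : IsTriellipticCover σ x where
  orderOf_eq := by
    have : Fact (Nat.Prime 3) := ⟨Nat.prime_three⟩
    apply orderOf_eq_prime
    · ext b
      simpa [pow_succ] using h.iterate_three b
    · rintro rfl
      have h1 := h.act
      rw [AlgEquiv.one_apply] at h1
      have h2 : algebraMap k F ζ = algebraMap k F 1 := by
        rw [map_one]
        exact (mul_eq_right₀ h.ne_zero).1 h1.symm
      exact h.prim.ne_one (by norm_num) ((algebraMap k F).injective h2)
  transcendental := h.trans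
  fixedField_eq := by
    ext b
    rw [mem_fixedField_zpowers_iff, h.fixed_iff]

theorem Kummer.adjoin_eq_top (h : Kummer σ ζ x y) : IntermediateField.adjoin k {x, y} = ⊤ := by
  rw [eq_top_iff]
  intro b _
  have hle : k⟮x⟯ ≤ IntermediateField.adjoin k {x, y} :=
    IntermediateField.adjoin.mono k _ _ (by simp)
  have hy : y ∈ IntermediateField.adjoin k {x, y} :=
    IntermediateField.subset_adjoin k _ (by simp)
  obtain ⟨b₀, h0, b₁, h1, b₂, h2, rfl⟩ := h.decomposition b
  exact add_mem (add_mem (hle h0) (mul_mem (hle h1) hy)) (mul_mem (hle h2) (pow_mem hy 2))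

end Cover

/-! ### Construction of the explicit curve -/

section Construction

open Polynomial

variable {k : Type u} [Field k]

/-- Since the degree is prime there are no proper intermediate fields, and `y` is not fixed; so the
fixed field of `τ` is the base. -/
theorem kummer_of_ratFunc {F : Type v} [Field F] [Algebra k F] [Algebra (RatFunc k) F]
    [IsScalarTower k (RatFunc k) F] {ζ : k} (hζ : IsPrimitiveRoot ζ 3)
    (hrank : Module.finrank (RatFunc k) F = 3) (τ : F ≃ₐ[RatFunc k] F) {y : F} (hy0 : y ≠ 0)
    (hτy : τ y = algebraMap k F ζ * y) (hτ3 : ∀ b, τ (τ (τ b)) = b) :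
    Kummer (τ.restrictScalars k) ζ (algebraMap (RatFunc k) F RatFunc.X) y := by
  have hfix : ∀ b, τ b = b ↔ b ∈ Set.range (algebraMap (RatFunc k) F) := by
    intro b
    constructor
    · intro hb
      have hsimple := IntermediateField.isSimpleOrder_of_finrank_prime (RatFunc k) F
        (by rw [hrank]; exact Nat.prime_three)
      rcases hsimple.eq_bot_or_eq_top (IntermediateField.fixedField (Subgroup.zpowers τ)) with h | h
      · have : b ∈ IntermediateField.fixedField (Subgroup.zpowers τ) :=
          mem_fixedField_zpowers_iff.2 hb
        rw [h] at this
        exact IntermediateField.mem_bot.1 this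
      · exfalso
        have : y ∈ IntermediateField.fixedField (Subgroup.zpowers τ) := by rw [h]; trivial
        have h1 := mem_fixedField_zpowers_iff.1 this
        rw [hτy] at h1
        have h2 : algebraMap k F ζ = algebraMap k F 1 := by
          rw [map_one]
          exact (mul_eq_right₀ hy0).1 h1
        exact hζ.ne_one (by norm_num) ((algebraMap k F).injective h2)
    · rintro ⟨r, rfl⟩
      exact τ.commutes r
  have htrans : Transcendental k (algebraMap (RatFunc k) F RatFunc.X) :=
    (transcendental_algebraMap_iff (algebraMap (RatFunc k) F).injective).2 RatFunc.transcendental_X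
  refine ⟨hζ, hτ3, fun b => ?_, htrans, hy0, hτy⟩
  change τ b = b ↔ _
  rw [hfix]
  constructor
  · rintro ⟨r, rfl⟩
    have hpoly : ∀ A : k[X], algebraMap (RatFunc k) F (algebraMap k[X] (RatFunc k) A) =
        aeval (algebraMap (RatFunc k) F RatFunc.X) A := by
      intro A
      rw [aeval_algebraMap_apply, RatFunc.aeval_X_left_eq_algebraMap]
    rw [← RatFunc.num_div_denom r, map_div₀, hpoly, hpoly]
    exact div_mem (aeval_mem_adjoin_simple _ _) (aeval_mem_adjoin_simple _ _)
  · intro hb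
    obtain ⟨A, B, rfl⟩ := (IntermediateField.mem_adjoin_simple_iff k b).1 hb
    rw [aeval_algebraMap_apply, aeval_algebraMap_apply]
    exact ⟨_, map_div₀ _ _ _⟩

/-- A cube root of a non-cube generates a cyclic cubic extension. -/
theorem exists_cubic_extension {K : Type u} [Field K] {ε : K} (hε : ε ^ 3 = 1) {c : K}
    (hc : ∀ b : K, b ^ 3 ≠ c) :
    ∃ (F : Type u) (_ : Field F) (_ : Algebra K F) (y : F) (τ : F ≃ₐ[K] F),
      Module.finrank K F = 3 ∧ y ^ 3 = algebraMap K F c ∧ τ y = ε • y ∧ ∀ b, τ (τ (τ b)) = b := by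
  have hirr : Irreducible (X ^ 3 - C c) := X_pow_sub_C_irreducible_of_prime Nat.prime_three hc
  have : Fact (Irreducible (X ^ 3 - C c)) := ⟨hirr⟩
  have hτy := autAdjoinRootXPowSubC_root (a := c) (rootsOfUnity.mkOfPowEq ε hε)
  rw [rootsOfUnity.val_mkOfPowEq_coe] at hτy
  refine ⟨AdjoinRoot (X ^ 3 - C c), inferInstance, inferInstance, AdjoinRoot.root (X ^ 3 - C c),
    autAdjoinRootXPowSubC 3 c (rootsOfUnity.mkOfPowEq ε hε), ?_, root_X_pow_sub_C_pow 3 c, hτy, ?_⟩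
  · rw [(AdjoinRoot.powerBasis hirr.ne_zero).finrank, AdjoinRoot.powerBasis_dim,
      natDegree_X_pow_sub_C]
  · intro b
    generalize autAdjoinRootXPowSubC 3 c (rootsOfUnity.mkOfPowEq ε hε) = τ at hτy
    have h1 : τ.toAlgHom.comp (τ.toAlgHom.comp τ.toAlgHom) = AlgHom.id K _ := by
      apply AdjoinRoot.algHom_ext
      change τ (τ (τ (AdjoinRoot.root _))) = AdjoinRoot.root _
      rw [hτy, map_smul, map_smul, hτy, map_smul, hτy, smul_smul, smul_smul,
        show ε * ε * ε = 1 by rw [← hε]; ring, one_smul]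
    exact DFunLike.congr_fun h1 b

/-- Adjoining a cube root of a non-cube of `k(x)` gives a Kummer cover. -/
theorem exists_kummer {ζ : k} (hζ : IsPrimitiveRoot ζ 3) {c : RatFunc k}
    (hc : ∀ b : RatFunc k, b ^ 3 ≠ c) :
    ∃ (F : Type u) (_ : Field F) (_ : Algebra k F) (_ : Algebra (RatFunc k) F)
      (_ : IsScalarTower k (RatFunc k) F) (y : F) (σ : F ≃ₐ[k] F),
      Kummer σ ζ (algebraMap (RatFunc k) F RatFunc.X) y ∧ y ^ 3 = algebraMap (RatFunc k) F c := by
  obtain ⟨F, _, _, y, τ, hrank, hy3, hτy, hτ3⟩ := exists_cubic_extension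
    (ε := algebraMap k (RatFunc k) ζ) (by rw [← map_pow, hζ.pow_eq_one, map_one]) hc
  let _ : Algebra k F := ((algebraMap (RatFunc k) F).comp (algebraMap k (RatFunc k))).toAlgebra
  have : IsScalarTower k (RatFunc k) F := IsScalarTower.of_algebraMap_eq fun _ => rfl
  have hy0 : y ≠ 0 := by
    rintro rfl
    rw [zero_pow (by norm_num)] at hy3
    have : c = 0 := (map_eq_zero _).1 hy3.symm
    exact hc 0 (by rw [this]; norm_num)
  exact ⟨F, inferInstance, inferInstance, inferInstance, inferInstance, y, τ.restrictScalars k,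
    kummer_of_ratFunc hζ hrank τ hy0 (by rw [hτy, Algebra.smul_def]; rfl) hτ3, hy3⟩

theorem squarefree_X_sq_sub_one_mul (h2 : (2 : k) ≠ 0) :
    Squarefree ((X ^ 2 - 1) * (X ^ 2 + 1) : k[X]) := by
  have h : ((X ^ 2 - 1) * (X ^ 2 + 1) : k[X]) = X ^ 4 - C 1 := by rw [C_1]; ring
  have h4 : ((4 : ℕ) : k) ≠ 0 := by
    have : ((4 : ℕ) : k) = 2 * 2 := by norm_num
    rw [this]
    exact mul_ne_zero h2 h2
  rw [h]
  exact (separable_X_pow_sub_C (1 : k) h4 one_ne_zero).squarefree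

theorem ratFunc_cube_ne (h2 : (2 : k) ≠ 0) (b : RatFunc k) :
    b ^ 3 ≠ algebraMap k[X] (RatFunc k) ((X ^ 2 - 1) * (X ^ 2 + 1) ^ 2) := by
  intro hb
  obtain ⟨A, rfl⟩ := IsIntegrallyClosed.exists_algebraMap_eq_of_isIntegral_pow (R := k[X])
    (by norm_num : 0 < 3) (by rw [hb]; exact isIntegral_algebraMap)
  rw [← map_pow] at hb
  have hA := RatFunc.algebraMap_injective k hb
  have hroot : IsRoot A 1 := by
    have := congrArg (eval 1) hA
    simp at this
    exact this
  obtain ⟨B, rfl⟩ := dvd_iff_isRoot.2 hroot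
  -- The root `1` of the right side is simple. After cancelling one factor, the two sides take the
  -- values `0` and `8` at `1`.
  have h1 : (X - C 1) ^ 2 * B ^ 3 = (X + 1) * (X ^ 2 + 1 : k[X]) ^ 2 := by
    apply mul_left_cancel₀ (X_sub_C_ne_zero (1 : k))
    rw [C_1] at hA ⊢
    linear_combination hA
  have h3 := congrArg (eval 1) h1
  simp at h3
  norm_num at h3
  exact h2 h3

/-- The trielliptic curve `y ^ 3 = (x ^ 2 - 1) (x ^ 2 + 1) ^ 2` in odd characteristic
`p ≡ 2 mod 3` is superspecial of genus two. -/
theorem exists_superspecial (p : ℕ) [Fact p.Prime] (hp2 : p ≠ 2) (hp3 : p % 3 = 2)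
    (k : Type u) [Field k] [IsAlgClosed k] [CharP k p] :
    ∃ (F : Type u) (_ : Field F) (_ : Algebra k F) (x y : F) (σ : F ≃ₐ[k] F),
      Transcendental k x ∧ y ^ 3 = (x ^ 2 - 1) * (x ^ 2 + 1) ^ 2 ∧
      IntermediateField.adjoin k {x, y} = ⊤ ∧ IsCurve k F ∧ IsTriellipticCover σ x ∧
      genus k F = 2 ∧ (∀ ζ : k, IsPrimitiveRoot ζ 3 → HasSignature σ ζ 1 1) ∧
      IsSuperspecial k F p ∧ HasPRank k F p 0 := by
  have hp : p.Prime := Fact.out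
  have hne : ∀ q : ℕ, q.Prime → p ≠ q → ((q : ℕ) : k) ≠ 0 := by
    intro q hq hpq h
    exact hpq ((Nat.prime_dvd_prime_iff_eq hp hq).1 ((CharP.cast_eq_zero_iff k p q).1 h))
  have h2 : (2 : k) ≠ 0 := by exact_mod_cast hne 2 Nat.prime_two hp2
  have h3 : NeZero ((3 : ℕ) : k) := ⟨hne 3 Nat.prime_three (by rintro rfl; omega)⟩
  obtain ⟨ζ, hζ⟩ := HasEnoughRootsOfUnity.exists_primitiveRoot k 3
  obtain ⟨F, _, _, _, _, y, σ, hK, hy⟩ := exists_kummer hζ (ratFunc_cube_ne h2)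
  have hF : CharP F p := charP_of_injective_algebraMap (algebraMap k F).injective p
  set x : F := algebraMap (RatFunc k) F RatFunc.X with hx
  have hpoly : algebraMap (RatFunc k) F (algebraMap k[X] (RatFunc k) ((X ^ 2 - 1) * (X ^ 2 + 1) ^ 2)) =
      aeval x (X ^ 2 - 1 : k[X]) * aeval x (X ^ 2 + 1 : k[X]) ^ 2 := by
    rw [← map_pow, ← map_mul, hx, aeval_algebraMap_apply, RatFunc.aeval_X_left_eq_algebraMap]
  rw [hpoly] at hy
  have M : Model σ ζ x y (X ^ 2 - 1) (X ^ 2 + 1) 2 := ⟨hK, hy, squarefree_X_sq_sub_one_mul h2, by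
    rw [natDegree_X_sq_sub_one, natDegree_X_sq_add_one]⟩
  have hcurve := hK.isCurve
  have hspan : FrobSpan p x := hK.frobSpan
  obtain ⟨C, hC, hCuniq⟩ := (hK.frobGen (p := p)).existsUnique_cartier
  refine ⟨F, inferInstance, inferInstance, x, y, σ, hK.trans, by simpa using hy, hK.adjoin_eq_top,
    hcurve, hK.isTriellipticCover, ?_, ?_, ⟨⟨C, hC, hCuniq⟩,
      fun C' hC' => M.cartier_eq_zero hp2 hp3 hC'⟩,
    hasPRank_zero_of_cartier hcurve hspan hC (M.cartier_eq_zero hp2 hp3 hC)⟩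
  · rw [M.genus_eq p, natDegree_X_sq_add_one]
  · intro ζ' hζ'
    obtain ⟨i, hi, rfl⟩ := hζ.eq_pow_of_pow_eq_one hζ'.pow_eq_one
    interval_cases i
    · exact absurd (pow_zero ζ) (hζ'.ne_one (by norm_num))
    · rw [pow_one]
      exact M.hasSignature (p := p) natDegree_X_sq_add_one
    -- For the other primitive root `ζ ^ 2`, the swapped model plays the same role.
    · have M' := M.swap
      rw [natDegree_X_sq_add_one] at M'
      exact M'.hasSignature (p := p) natDegree_X_sq_sub_one

end Construction


/-! ### Every trielliptic curve has a model -/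

section NormalForm

open Polynomial

variable {k : Type u} {F : Type v} [Field k] [Field F] [Algebra k F] {σ : F ≃ₐ[k] F} {ζ : k}
  {x y : F}

/-- For a `b` not fixed by `σ`, the two nontrivial Lagrange resolvents cannot both vanish. One has
eigenvalue `ζ`; the other has eigenvalue `ζ ^ 2`, and its square has eigenvalue `ζ`. -/
theorem IsTriellipticCover.exists_kummer (h : IsTriellipticCover σ x) (hζ : IsPrimitiveRoot ζ 3) :
    ∃ y, Kummer σ ζ x y := by
  have h3 : (3 : F) ≠ 0 := by
    rw [← map_ofNat (algebraMap k F) 3]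
    exact (_root_.map_ne_zero _).2 hζ.three_ne_zero
  have hσ3 : ∀ b, σ (σ (σ b)) = b := by
    intro b
    have h1 : σ ^ 3 = 1 := by rw [← h.orderOf_eq]; exact pow_orderOf_eq_one σ
    have := DFunLike.congr_fun h1 b
    simpa [pow_succ] using this
  have hfix : ∀ b, σ b = b ↔ b ∈ k⟮x⟯ := by
    intro b
    rw [← h.fixedField_eq, mem_fixedField_zpowers_iff]
  have hne : ∃ b, σ b ≠ b := by
    by_contra! hcon
    have h1 : σ = 1 := by ext b; exact hcon b
    have := h.orderOf_eq
    rw [h1, orderOf_one] at this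
    omega
  obtain ⟨b, hb⟩ := hne
  set z := algebraMap k F ζ with hz
  have hσz : σ z = z := σ.commutes ζ
  have hz3 : z ^ 3 = 1 := by rw [hz, ← map_pow, hζ.pow_eq_one, map_one]
  have hsum : 1 + z + z ^ 2 = 0 := by
    have := congrArg (algebraMap k F) hζ.one_add_self_add_sq
    simpa only [map_add, map_one, map_zero, map_pow] using this
  by_cases h1 : b + z ^ 2 * σ b + z * σ (σ b) = 0
  · by_cases h2 : b + z * σ b + z ^ 2 * σ (σ b) = 0
    · exfalso
      apply hb
      have h4 : σ b + z ^ 2 * σ (σ b) + z * b = 0 := by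
        have := congrArg σ h1
        simpa only [map_add, map_mul, map_pow, hσz, hσ3, map_zero] using this
      have h5 : (3 : F) * (σ b - b) = 0 := by
        have h6 := congrArg σ h2
        simp only [map_add, map_mul, map_pow, hσz, hσ3, map_zero] at h6
        linear_combination h4 + h6 - h1 - h2 + (σ b - b) * hsum
      exact sub_eq_zero.1 ((mul_eq_zero.1 h5).resolve_left h3)
    · refine ⟨(b + z * σ b + z ^ 2 * σ (σ b)) ^ 2, hζ, hσ3, hfix, h.transcendental,
        pow_ne_zero _ h2, ?_⟩
      simp only [map_add, map_mul, map_pow, hσz, hσ3]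
      rw [show σ b + z * σ (σ b) + z ^ 2 * b = z ^ 2 * (b + z * σ b + z ^ 2 * σ (σ b)) by
        linear_combination (-(σ b) - z * σ (σ b)) * hz3]
      rw [mul_pow]
      linear_combination (z * (b + z * σ b + z ^ 2 * σ (σ b)) ^ 2) * hz3
  · refine ⟨b + z ^ 2 * σ b + z * σ (σ b), hζ, hσ3, hfix, h.transcendental, h1, ?_⟩
    simp only [map_add, map_mul, map_pow, hσz, hσ3]
    linear_combination (-(σ b)) * hz3

/-- Multiplying by one more linear factor moves it from outside to `f`, from `f` to `g`, or from `g`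
to `h`, according to its multiplicity modulo `3`. -/
theorem exists_cube_mul_squarefree [IsAlgClosed k] (H : k[X]) (hH : H ≠ 0) :
    ∃ h f g : k[X], H = h ^ 3 * (f * g ^ 2) ∧ Squarefree (f * g) := by
  obtain ⟨n, hn⟩ : ∃ n, H.natDegree = n := ⟨_, rfl⟩
  induction n generalizing H with
  | zero =>
    refine ⟨1, H, 1, by ring, ?_⟩
    rw [mul_one]
    exact (isUnit_iff_degree_eq_zero.2 (by rw [degree_eq_natDegree hH, hn]; rfl)).squarefree
  | succ n ih =>
    obtain ⟨a, ha⟩ := IsAlgClosed.exists_root H (by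
      rw [degree_eq_natDegree hH, hn]; exact_mod_cast (Nat.succ_ne_zero n))
    obtain ⟨H', rfl⟩ := dvd_iff_isRoot.2 ha
    have hH' : H' ≠ 0 := right_ne_zero_of_mul hH
    rw [natDegree_mul (X_sub_C_ne_zero a) hH', natDegree_X_sub_C] at hn
    obtain ⟨h, f, g, rfl, hsq⟩ := ih H' hH' (by omega)
    by_cases hg : (X - C a) ∣ g
    · obtain ⟨g', rfl⟩ := hg
      exact ⟨(X - C a) * h, f, g', by ring, hsq.squarefree_of_dvd ⟨X - C a, by ring⟩⟩
    by_cases hf : (X - C a) ∣ f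
    · obtain ⟨f', rfl⟩ := hf
      exact ⟨h, f', (X - C a) * g, by ring, hsq.squarefree_of_dvd ⟨1, by ring⟩⟩
    refine ⟨h, (X - C a) * f, g, by ring, ?_⟩
    rw [mul_assoc, squarefree_mul_iff]
    refine ⟨?_, (irreducible_X_sub_C a).squarefree, hsq⟩
    rw [(irreducible_X_sub_C a).isRelPrime_iff_not_dvd]
    intro hdvd
    exact ((prime_X_sub_C a).dvd_or_dvd hdvd).elim hf hg

/-- After clearing denominators, a point `a` of the line with `G(a) ≠ 0` is moved to infinity. The
cover is unramified there, which is why the degree becomes divisible by `3`. -/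
theorem Kummer.exists_polynomial [IsAlgClosed k] (h : Kummer σ ζ x y) :
    ∃ (x' y' : F) (H : k[X]) (N : ℕ), Kummer σ ζ x' y' ∧ y' ^ 3 = aeval x' H ∧ H ≠ 0 ∧
      H.natDegree = 3 * N := by
  obtain ⟨A, B, hAB⟩ := (IntermediateField.mem_adjoin_simple_iff k _).1 h.cube_mem
  have hB : aeval x B ≠ 0 := by
    intro h0
    rw [h0, div_zero] at hAB
    exact pow_ne_zero 3 h.ne_zero hAB
  have hA : A ≠ 0 := by
    rintro rfl
    rw [map_zero, zero_div] at hAB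
    exact pow_ne_zero 3 h.ne_zero hAB
  have hB0 : B ≠ 0 := by rintro rfl; simp at hB
  have h1 := h.mul_of_mem (aeval_mem_adjoin_simple x B) hB
  have hG : (y * aeval x B) ^ 3 = aeval x (A * B ^ 2) := by
    rw [mul_pow, hAB, map_mul, map_pow]
    field_simp
  have hG0 : A * B ^ 2 ≠ 0 := mul_ne_zero hA (pow_ne_zero _ hB0)
  set G := A * B ^ 2
  obtain ⟨a, ha⟩ : ∃ a, G.eval a ≠ 0 := by
    by_contra! hcon
    have : Infinite k := IsAlgClosed.instInfinite
    exact hG0 (Polynomial.funext fun a => by rw [hcon a, eval_zero])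
  have h2 := h1.sub_algebraMap a
  have hξ0 : x - algebraMap k F a ≠ 0 := fun h0 => h2.trans (h0 ▸ isAlgebraic_zero)
  set G₁ := G.comp (X + C a) with hG₁
  have hG₁0 : G₁.coeff 0 ≠ 0 := by
    rw [coeff_zero_eq_eval_zero]
    simpa [hG₁] using ha
  have hG₁ne : G₁ ≠ 0 := by intro h0; rw [h0] at hG₁0; simp at hG₁0
  rw [← Model.aeval_comp_sub x a G, ← hG₁, ← Model.aeval_reverse hξ0 G₁] at hG
  have h3 := h2.inv.mul_of_mem (pow_mem (IntermediateField.mem_adjoin_simple_self k _) G₁.natDegree)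
    (pow_ne_zero _ (inv_ne_zero hξ0))
  -- With `ξ = x - a` and `n = deg G₁`, multiplying the generator by `ξ⁻¹ ^ n` multiplies its cube
  -- `G₁.reverse(ξ⁻¹) ξ ^ n` by `ξ⁻¹ ^ (3 n)`; hence the factor `X ^ (2 n)` and total degree `3 n`.
  refine ⟨_, _, G₁.reverse * X ^ (2 * G₁.natDegree), G₁.natDegree, h3, ?_, ?_, ?_⟩
  · rw [mul_pow, hG, map_mul, map_pow, aeval_X]
    generalize aeval (x - algebraMap k F a)⁻¹ G₁.reverse = R
    generalize x - algebraMap k F a = ξ at hξ0 ⊢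
    generalize G₁.natDegree = n
    have h4 : ξ ^ n * ξ⁻¹ ^ n = 1 := by rw [← mul_pow, mul_inv_cancel₀ hξ0, one_pow]
    linear_combination R * (ξ⁻¹ ^ n) ^ 2 * h4
  · exact mul_ne_zero (by simpa using hG₁ne) (pow_ne_zero _ X_ne_zero)
  · rw [natDegree_mul (by simpa using hG₁ne) (pow_ne_zero _ X_ne_zero), natDegree_X_pow,
      reverse_natDegree, natTrailingDegree_eq_zero.2 (Or.inr hG₁0)]
    omega

theorem Kummer.exists_model [IsAlgClosed k] (h : Kummer σ ζ x y) :
    ∃ (x' y' : F) (f g : k[X]) (m : ℕ), Model σ ζ x' y' f g m := by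
  obtain ⟨x', y', H, N, hK, hy, hH, hN⟩ := h.exists_polynomial
  obtain ⟨h, f, g, rfl, hsq⟩ := exists_cube_mul_squarefree H hH
  have hh : h ≠ 0 := by rintro rfl; simp at hH
  have hf : f ≠ 0 := by rintro rfl; simp at hH
  have hg : g ≠ 0 := by rintro rfl; simp at hH
  have hhx := aeval_ne_zero_of_transcendental hK.trans hh
  refine ⟨x', y' * (aeval x' h)⁻¹, f, g, N - h.natDegree,
    hK.mul_of_mem (inv_mem (aeval_mem_adjoin_simple x' h)) (inv_ne_zero hhx), ?_, hsq, ?_⟩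
  · rw [mul_pow, hy, map_mul, map_mul, map_pow, map_pow]
    field_simp
  · rw [natDegree_mul (pow_ne_zero _ hh) (mul_ne_zero hf (pow_ne_zero _ hg)),
      natDegree_mul hf (pow_ne_zero _ hg), natDegree_pow, natDegree_pow] at hN
    omega

/-- A point over `ξ = 0` is determined by the residue of `z`, one of the finitely many cube roots of
`g(0)`. -/
theorem Kummer.finite_points [IsAlgClosed k] {ξ z : F} (h : Kummer σ ζ ξ z) {g : k[X]}
    (hg : g.eval 0 ≠ 0) (hz : z ^ 3 = aeval ξ g) :
    {P : Point k F | P.localRing.valuation ξ < 1}.Finite := by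
  classical
  have hfin : {c : k | c ^ 3 = g.eval 0}.Finite := by
    refine (nthRoots 3 (g.eval 0)).toFinset.finite_toSet.subset fun c hc => ?_
    simpa [mem_nthRoots] using hc
  refine (hfin.biUnion (t := fun c => {P : Point k F | P.localRing.valuation ξ < 1 ∧
    P.localRing.valuation (z - algebraMap k F c) < 1 ∧ c ^ 3 = g.eval 0}) fun c _ => ?_).subset ?_
  · refine Set.Subsingleton.finite ?_
    rintro P ⟨hP, hPc, hc⟩ Q ⟨hQ, hQc, -⟩
    refine h.point_unique ?_ hc hz hP hPc hQ hQc
    rintro rfl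
    exact hg (by rw [← hc]; norm_num)
  · intro P hP
    obtain ⟨c, hc, hPc⟩ := Kummer.exists_cubeRoot_residue h.prim P.algebraMap_mem hP hz
    exact Set.mem_biUnion (show c ∈ {c : k | c ^ 3 = g.eval 0} from hc) ⟨hP, hPc, hc⟩

end NormalForm

/-! ### Everywhere regular functions are constant -/

section Liouville

open KaehlerDifferential

variable {k : Type u} {F : Type v} [Field k] [Field F] [Algebra k F] [IsAlgClosed k]

/-- On a curve of positive genus a function without poles is constant. -/
theorem exists_algebraMap_eq_of_regular (hgenus : 0 < genus k F) {h : F}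
    (hh : ∀ P : Point k F, h ∈ P.localRing) : ∃ c : k, algebraMap k F c = h := by
  have hfin : FiniteDimensional k (holomorphicDifferentials k F) :=
    FiniteDimensional.of_finrank_pos hgenus
  have hne : holomorphicDifferentials k F ≠ ⊥ := by
    intro h0
    rw [genus, h0, finrank_bot] at hgenus
    exact lt_irrefl _ hgenus
  -- Multiplication by `h` preserves a nonzero finite-dimensional space, so `h` is integral over
  -- `k`, and `k` is algebraically closed. Positive genus supplies both properties of that space.
  have hmem : ∀ ω ∈ holomorphicDifferentials k F, h • ω ∈ holomorphicDifferentials k F := by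
    intro ω hω
    rw [holomorphicDifferentials, Submodule.mem_iInf] at hω ⊢
    intro P
    have h1 := hω P
    clear hω
    rw [Point.regularDifferentials] at h1
    induction h1 using Submodule.span_induction with
    | mem ω hω =>
      obtain ⟨a, ha, b, hb, rfl⟩ := hω
      exact Submodule.subset_span ⟨h * a, mul_mem (hh P) ha, b, hb, smul_smul _ _ _⟩
    | zero => rw [smul_zero]; exact zero_mem _
    | add a b _ _ ha hb => rw [smul_add]; exact add_mem ha hb
    | smul c a _ ha => rw [smul_comm]; exact Submodule.smul_mem _ _ ha
  have hint : IsIntegral k h := isIntegral_of_smul_mem_submodule (holomorphicDifferentials k F)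
    hne ((Submodule.fg_iff_finiteDimensional _).2 hfin) h hmem
  exact minpoly.mem_range_of_degree_eq_one k h
    (IsAlgClosed.degree_eq_one_of_irreducible k (minpoly.irreducible hint))

end Liouville


/-! ### Principal divisors of the form `2 (E - σE)` -/

section Divisors

variable {k : Type u} {F : Type v} [Field k] [Field F] [Algebra k F]

theorem Divisor.degree_mapDomain (j : Point k F → Point k F) (E : Divisor k F) :
    Divisor.degree k F (E.mapDomain j) = Divisor.degree k F E := by
  have : (Divisor.degree k F).comp (Finsupp.mapDomain.addMonoidHom j) = Divisor.degree k F := by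
    ext P
    simp [Divisor.degree]
  exact DFunLike.congr_fun this E

/-- A function all of whose orders are even, with even divisor of the form `2 (E - σE)`, is a
square up to a function without zeros and poles when the Jacobian has no 2-torsion. -/
theorem exists_ord_eq_two_mul (σ : F ≃ₐ[k] F) (h : HasPRank k F 2 0) (E : Divisor k F) {f : F}
    (hf : f ≠ 0) (hE : ∀ P : Point k F, P.ord f = 2 * (E P - E (P.comap σ))) :
    ∃ g : F, g ≠ 0 ∧ ∀ P : Point k F, P.ord f = 2 * P.ord g := by
  have hinj : Function.Injective fun P : Point k F => P.comap σ.symm := Point.comap_injective σ.symm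
  -- As a difference of a divisor and its translate, `D` has degree zero automatically; its class is
  -- killed by `2`.
  let D : Divisor k F := E - E.mapDomain fun P => P.comap σ.symm
  have hD : ∀ P, D P = E P - E (P.comap σ) := by
    intro P
    have h1 : (P.comap σ).comap σ.symm = P := P.comap_symm_comap σ.symm
    have h2 := Finsupp.mapDomain_apply hinj E (P.comap σ)
    simp only [h1] at h2
    rw [← h2]
    rfl
  have hdeg : D ∈ (Divisor.degree k F).ker := by
    rw [AddMonoidHom.mem_ker, map_sub, Divisor.degree_mapDomain, sub_self]
  rw [HasPRank, pow_zero, Nat.card_eq_one_iff_unique] at h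
  have hsub := h.1
  let c : Jacobian k F := QuotientAddGroup.mk (⟨D, hdeg⟩ : (Divisor.degree k F).ker)
  have hc : 2 • c = 0 := by
    rw [← QuotientAddGroup.mk_nsmul, QuotientAddGroup.eq_zero_iff, AddSubgroup.mem_addSubgroupOf]
    refine ⟨f, hf, fun P => ?_⟩
    rw [hE P, ← hD P]
    simp
  have hc0 : c = 0 := congrArg Subtype.val
    (Subsingleton.elim (⟨c, hc⟩ : {c : Jacobian k F // 2 • c = 0}) ⟨0, smul_zero _⟩)
  rw [QuotientAddGroup.eq_zero_iff, AddSubgroup.mem_addSubgroupOf] at hc0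
  obtain ⟨g, hg, hgD⟩ := hc0
  refine ⟨g, hg, fun P => ?_⟩
  rw [hE P, ← hD P, ← hgD P]

end Divisors

/-! ### A nontrivial 2-torsion class in characteristic two -/

section Torsion

open Polynomial KaehlerDifferential

variable {k : Type u} {F : Type v} [Field k] [Field F] [Algebra k F] {σ : F ≃ₐ[k] F} {ζ : k} {x y : F} {f g : k[X]} {m : ℕ}

theorem derivative_eq_C_of_natDegree_eq_two [CharP k 2] {f : k[X]} (hf : f.natDegree = 2) :
    derivative f = C (f.coeff 1) := by
  have h2 : (2 : k) = 0 := by exact_mod_cast CharP.cast_eq_zero k 2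
  rw [eq_quadratic_of_degree_le_two (natDegree_le_iff_degree_le.1 hf.le)]
  simp [show (1 : k) + 1 = 0 by rw [one_add_one_eq_two, h2]]

theorem coeff_one_ne_zero_of_squarefree [IsAlgClosed k] [CharP k 2] {f : k[X]} (hf : f.natDegree = 2)
    (hsq : Squarefree f) : f.coeff 1 ≠ 0 := by
  intro h0
  have h1 := (PerfectField.separable_iff_squarefree (K := k)).2 hsq
  rw [separable_def, derivative_eq_C_of_natDegree_eq_two hf, h0, C_0, isCoprime_zero_right] at h1
  have := natDegree_eq_zero_of_isUnit h1
  omega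

theorem Model.natDegree_eq_two [IsAlgClosed k] (p : ℕ) [Fact p.Prime] [CharP F p] (M : Model σ ζ x y f g m)
    (hgenus : genus k F = 2) : m = 2 ∧ f.natDegree = 2 ∧ g.natDegree = 2 := by
  rw [M.genus_eq p] at hgenus
  have := M.deg
  omega

/-- The linear terms cancel, and in characteristic two a polynomial `a X² + b` is the square of `√a
X + √b`. -/
theorem exists_sq_eq_sub_smul [IsAlgClosed k] [CharP k 2] (hf : f.natDegree = 2) (hg : g.natDegree = 2) {w : k}
    (hw : f.coeff 1 = w * g.coeff 1) : ∃ s : k[X], f - C w * g = s ^ 2 := by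
  have h2 : (2 : k[X]) = 0 := by
    rw [← map_ofNat C 2, show (2 : k) = 0 by exact_mod_cast CharP.cast_eq_zero k 2, C_0]
  obtain ⟨α, hα⟩ := IsAlgClosed.exists_pow_nat_eq (f.coeff 2 - w * g.coeff 2) (n := 2) (by norm_num)
  obtain ⟨β, hβ⟩ := IsAlgClosed.exists_pow_nat_eq (f.coeff 0 - w * g.coeff 0) (n := 2) (by norm_num)
  refine ⟨C α * X + C β, ?_⟩
  have h3 : (C α * X + C β) ^ 2 = C (α ^ 2) * X ^ 2 + C (β ^ 2) := by
    rw [C_pow, C_pow]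
    linear_combination (C α * X * C β) * h2
  rw [h3, hα, hβ]
  conv_lhs =>
    rw [eq_quadratic_of_degree_le_two (natDegree_le_iff_degree_le.1 hf.le),
      eq_quadratic_of_degree_le_two (natDegree_le_iff_degree_le.1 hg.le)]
  rw [hw]
  simp only [C_sub, C_mul]
  ring

/-- The setting for the 2-torsion of `y ^ 3 = f(x) g(x) ^ 2` in characteristic two, with
`u = y / g(x)`, so that `u ^ 3 = f(x) / g(x)`, and `f - w ^ 3 g = s ^ 2`. -/
structure TorsionData (σ : F ≃ₐ[k] F) (ζ : k) (x y : F) (f g s : k[X]) (w : k) : Prop extends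
    Model σ ζ x y f g 2 where
  deg_f : f.natDegree = 2
  deg_g : g.natDegree = 2
  w_ne_zero : w ≠ 0
  coeff_one : f.coeff 1 = w ^ 3 * g.coeff 1
  sq : f - C (w ^ 3) * g = s ^ 2

theorem Model.exists_torsionData [IsAlgClosed k] [CharP k 2] (M : Model σ ζ x y f g 2) (hf : f.natDegree = 2)
    (hg : g.natDegree = 2) : ∃ (s : k[X]) (w : k), TorsionData σ ζ x y f g s w := by
  have hb := coeff_one_ne_zero_of_squarefree hf (M.sqfree.squarefree_of_dvd (dvd_mul_right f g))
  have hb' := coeff_one_ne_zero_of_squarefree hg (M.sqfree.squarefree_of_dvd (dvd_mul_left g f))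
  obtain ⟨w, hw⟩ := IsAlgClosed.exists_pow_nat_eq (f.coeff 1 / g.coeff 1) (n := 3) (by norm_num)
  have h1 : f.coeff 1 = w ^ 3 * g.coeff 1 := by rw [hw, div_mul_cancel₀ _ hb']
  obtain ⟨s, hs⟩ := exists_sq_eq_sub_smul hf hg h1
  refine ⟨s, w, M, hf, hg, ?_, h1, hs⟩
  rintro rfl
  rw [zero_pow (by norm_num), zero_mul] at h1
  exact hb h1

namespace TorsionData

variable {s : k[X]} {w : k}

theorem s_ne_zero (T : TorsionData σ ζ x y f g s w) : s ≠ 0 := by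
  rintro rfl
  have h1 := T.sq
  rw [zero_pow (by norm_num), sub_eq_zero] at h1
  have h2 := T.sqfree g ⟨C (w ^ 3), by rw [h1]; ring⟩
  have := natDegree_eq_zero_of_isUnit h2
  have := T.deg_g
  omega

theorem act_u (T : TorsionData σ ζ x y f g s w) :
    σ (y / aeval x g) = algebraMap k F ζ * (y / aeval x g) := by
  rw [map_div₀, T.act, (T.fixed_iff _).2 (aeval_mem_adjoin_simple x g), mul_div_assoc]

theorem u_cubed (T : TorsionData σ ζ x y f g s w) :
    (y / aeval x g) ^ 3 * aeval x g = aeval x f := by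
  have := T.aeval_g_ne_zero
  rw [div_pow, T.eqn]
  field_simp

theorem act_q (T : TorsionData σ ζ x y f g s w) : σ (y / aeval x g - algebraMap k F w) =
    algebraMap k F ζ * (y / aeval x g) - algebraMap k F w := by
  rw [map_sub, T.act_u, AlgEquiv.commutes]

theorem act_act_q (T : TorsionData σ ζ x y f g s w) : σ (σ (y / aeval x g - algebraMap k F w)) =
    algebraMap k F (ζ ^ 2) * (y / aeval x g) - algebraMap k F w := by
  rw [T.act_q, map_sub, map_mul, T.act_u, AlgEquiv.commutes, AlgEquiv.commutes, ← mul_assoc,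
    ← map_mul, pow_two]

/-- The conjugates of `q = u - w` are `ζ ^ i u - w`, with product `u ^ 3 - w ^ 3 = (f - w ^ 3 g) /
g`. That the result is a square over `g` is the source of the even orders. -/
theorem prod_q (T : TorsionData σ ζ x y f g s w) :
    (y / aeval x g - algebraMap k F w) * σ (y / aeval x g - algebraMap k F w) *
      σ (σ (y / aeval x g - algebraMap k F w)) * aeval x g = aeval x s ^ 2 := by
  have h1 := congrArg (aeval x) T.sq
  have h2 := T.u_cubed
  have h3 := congrArg (algebraMap k F) T.prim.one_add_self_add_sq
  have h4 := congrArg (algebraMap k F) T.prim.pow_eq_one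
  rw [T.act_act_q, T.act_q]
  simp only [map_sub, map_mul, map_pow, aeval_C, map_add, map_one, map_zero] at h1 h3 h4 ⊢
  rw [← h1, ← h2]
  set u := y / aeval x g
  set z := algebraMap k F ζ
  set W := algebraMap k F w
  linear_combination aeval x g * (u ^ 3 * h4 + (u * W ^ 2 - u ^ 2 * W * z) * h3)

theorem q_ne_zero (T : TorsionData σ ζ x y f g s w) : y / aeval x g - algebraMap k F w ≠ 0 := by
  intro h0
  have h1 := T.prod_q
  rw [h0] at h1
  simp only [zero_mul] at h1
  exact pow_ne_zero 2 (aeval_ne_zero_of_transcendental T.trans T.s_ne_zero) h1.symm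

theorem const_ne_zero (T : TorsionData σ ζ x y f g s w) {i : ℕ} (hi : i ≠ 0) (hi3 : i < 3) :
    w * (ζ ^ i - 1) ≠ 0 :=
  mul_ne_zero T.w_ne_zero (sub_ne_zero.2 (T.prim.pow_ne_one_of_pos_of_lt hi hi3))

/-- Two of the three conjugates of `q` do not vanish simultaneously. -/
theorem not_pos_of_pos (T : TorsionData σ ζ x y f g s w) (P : Point k F)
    (h : 0 < P.ord (y / aeval x g - algebraMap k F w)) :
    ¬ 0 < P.ord (σ (y / aeval x g - algebraMap k F w)) ∧
      ¬ 0 < P.ord (σ (σ (y / aeval x g - algebraMap k F w))) := by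
  have hq := T.q_ne_zero
  have key : ∀ (r : F) (i : ℕ), i ≠ 0 → i < 3 →
      r = algebraMap k F (ζ ^ i) * (y / aeval x g) - algebraMap k F w → ¬ 0 < P.ord r := by
    intro r i hi hi3 hr hpos
    have hζi : ζ ^ i ≠ 0 := pow_ne_zero _ (T.prim.ne_zero (by norm_num))
    -- The combination `r - ζ ^ i q` is the nonzero constant `w (ζ ^ i - 1)`, so `q` and `r` have no
    -- common zero.
    have h1 : r + -(algebraMap k F (ζ ^ i) * (y / aeval x g - algebraMap k F w)) =
        algebraMap k F (w * (ζ ^ i - 1)) := by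
      rw [hr]
      simp only [map_mul, map_sub, map_one]
      ring
    have h2 : 1 ≤ P.ord (r + -(algebraMap k F (ζ ^ i) * (y / aeval x g - algebraMap k F w))) := by
      apply P.le_ord_add
      · rw [h1]
        exact (_root_.map_ne_zero _).2 (T.const_ne_zero hi hi3)
      · exact Or.inr hpos
      · right
        rw [P.ord_neg, ← Algebra.smul_def, P.ord_smul hζi]
        exact h
    rw [h1, P.ord_algebraMap] at h2
    omega
  exact ⟨key _ 1 (by norm_num) (by norm_num) (by rw [T.act_q, pow_one]),
    key _ 2 (by norm_num) (by norm_num) T.act_act_q⟩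

theorem ord_of_eval_g_eq_zero (T : TorsionData σ ζ x y f g s w) (P : Point k F) {a : k}
    (hP : P.localRing.valuation (x - algebraMap k F a) < 1) (ha : g.eval a = 0) :
    P.ord (y / aeval x g - algebraMap k F w) = -1 ∧
      P.ord (σ (y / aeval x g - algebraMap k F w)) = -1 := by
  obtain ⟨-, h1, h2⟩ := T.swap.ord_of_eval_f_eq_zero P hP ha
  rw [T.swap_swap] at h2
  have hu0 : y / aeval x g ≠ 0 := div_ne_zero T.ne_zero T.aeval_g_ne_zero
  have hu : P.ord (y / aeval x g) = -1 := by
    have h3 : y ^ 2 / aeval x g = y / aeval x g * y := by ring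
    rw [h3, P.ord_mul hu0 T.ne_zero] at h1
    omega
  have hζ0 : ζ ≠ 0 := T.prim.ne_zero (by norm_num)
  constructor
  · rw [sub_eq_add_neg]
    refine ((P.ord_add_eq_left hu0 (Or.inr ?_)).2).trans hu
    rw [P.ord_neg, P.ord_algebraMap, hu]
    norm_num
  · rw [T.act_q, sub_eq_add_neg, ← Algebra.smul_def]
    have hu' : P.ord (ζ • (y / aeval x g)) = -1 := by rw [P.ord_smul hζ0, hu]
    refine ((P.ord_add_eq_left (smul_ne_zero hζ0 hu0) (Or.inr ?_)).2).trans hu'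
    rw [P.ord_neg, P.ord_algebraMap, hu']
    norm_num

/-- Away from the zeros of `g`, the three conjugates of `q` are regular, and their orders have
even sum. -/
theorem ord_nonneg (T : TorsionData σ ζ x y f g s w) (P : Point k F) {j : ℤ}
    (hj : P.ord (aeval x g) = 2 * j) (hu : y / aeval x g ∈ P.localRing) :
    (0 ≤ P.ord (y / aeval x g - algebraMap k F w) ∧
      0 ≤ P.ord (σ (y / aeval x g - algebraMap k F w)) ∧
      0 ≤ P.ord (σ (σ (y / aeval x g - algebraMap k F w)))) ∧
    P.ord (y / aeval x g - algebraMap k F w) + P.ord (σ (y / aeval x g - algebraMap k F w)) +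
      P.ord (σ (σ (y / aeval x g - algebraMap k F w))) = 2 * (P.ord (aeval x s) - j) := by
  have hw := P.algebraMap_mem w
  refine ⟨⟨P.ord_nonneg (sub_mem hu hw), ?_, ?_⟩, ?_⟩
  · rw [T.act_q]
    exact P.ord_nonneg (sub_mem (mul_mem (P.algebraMap_mem _) hu) hw)
  · rw [T.act_act_q]
    exact P.ord_nonneg (sub_mem (mul_mem (P.algebraMap_mem _) hu) hw)
  · have h1 := congrArg P.ord T.prod_q
    have hq := T.q_ne_zero
    have hq' : σ (y / aeval x g - algebraMap k F w) ≠ 0 := (map_ne_zero_iff σ σ.injective).2 hq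
    have hq'' : σ (σ (y / aeval x g - algebraMap k F w)) ≠ 0 := (map_ne_zero_iff σ σ.injective).2 hq'
    rw [P.ord_mul (mul_ne_zero (mul_ne_zero hq hq') hq'') T.aeval_g_ne_zero,
      P.ord_mul (mul_ne_zero hq hq') hq'', P.ord_mul hq hq', P.ord_pow, hj] at h1
    push_cast at h1
    omega

variable [IsAlgClosed k]

/-- By the product formula the zeros of `q` lie over roots of `s` or over infinity. Roots of `s` are
not roots of `f` or `g`, so the cover is unramified there and the fibres are finite. -/
theorem finite_zeros (T : TorsionData σ ζ x y f g s w) :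
    {P : Point k F | 0 < P.ord (y / aeval x g - algebraMap k F w)}.Finite := by
  classical
  have hroots : {a : k | s.eval a = 0}.Finite := by
    refine s.roots.toFinset.finite_toSet.subset fun a ha => ?_
    simpa [T.s_ne_zero] using ha
  refine ((hroots.biUnion (t := fun a => {P : Point k F | P.localRing.valuation (x - algebraMap k F a) < 1})
    fun a ha => ?_).union (T.kummer_infinity.finite_points T.eval_infinity_ne_zero
      T.eqn_infinity)).subset ?_
  · have h1 := congrArg (eval a) T.sq
    rw [eval_pow, show s.eval a = 0 from ha, zero_pow (by norm_num), eval_sub, eval_mul, eval_C] at h1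
    have hf : f.eval a ≠ 0 := by
      intro hf
      rw [hf, zero_sub, neg_eq_zero] at h1
      exact T.eval_g_ne_zero hf ((mul_eq_zero.1 h1).resolve_left (pow_ne_zero _ T.w_ne_zero))
    have hg : g.eval a ≠ 0 := by
      intro hg
      rw [hg, mul_zero, sub_zero] at h1
      exact hf h1
    exact (T.toKummer.sub_algebraMap a).finite_points (by simp [hf, hg]) (T.eqn_unramified a)
  · intro P hP
    by_cases hx : x ∈ P.localRing
    · left
      obtain ⟨a, ha⟩ := P.exists_valuation_sub_lt_one T.toKummer hx
      refine Set.mem_biUnion (show a ∈ {a : k | s.eval a = 0} from ?_) ha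
      by_contra hs
      have h1 := T.ord_aeval_eq_zero P ha hs
      have h2 := T.prod_q
      have hP' : 0 < P.ord (y / aeval x g - algebraMap k F w) := hP
      by_cases hg : g.eval a = 0
      · have := (T.ord_of_eval_g_eq_zero P ha hg).1
        omega
      · have h3 := T.ord_aeval_eq_zero P ha hg
        have hu : y / aeval x g ∈ P.localRing := by
          have := add_mem (P.mem_of_ord_nonneg hP'.le) (P.algebraMap_mem w)
          rwa [sub_add_cancel] at this
        have h4 := T.ord_nonneg P (j := 0) (by rw [h3]; rfl) hu
        omega
    · exact Or.inr (Model.valuation_inv_lt_one P hx)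

variable [CharP k 2]

/-- Either `q` and `σ q` have equal order and neither vanishes, or both orders are nonnegative and
even. -/
theorem ord_cases (T : TorsionData σ ζ x y f g s w) (P : Point k F) :
    (P.ord (y / aeval x g - algebraMap k F w) = -1 ∧
      P.ord (σ (y / aeval x g - algebraMap k F w)) = -1) ∨
    ((0 ≤ P.ord (y / aeval x g - algebraMap k F w) ∧
      0 ≤ P.ord (σ (y / aeval x g - algebraMap k F w))) ∧
      (∃ n, P.ord (y / aeval x g - algebraMap k F w) = 2 * n) ∧
      ∃ n, P.ord (σ (y / aeval x g - algebraMap k F w)) = 2 * n) := by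
  have hF : CharP F 2 := charP_of_injective_algebraMap (algebraMap k F).injective 2
  have hgood : ∀ j : ℤ, P.ord (aeval x g) = 2 * j → y / aeval x g ∈ P.localRing →
      ((0 ≤ P.ord (y / aeval x g - algebraMap k F w) ∧
      0 ≤ P.ord (σ (y / aeval x g - algebraMap k F w))) ∧
      (∃ n, P.ord (y / aeval x g - algebraMap k F w) = 2 * n) ∧
      ∃ n, P.ord (σ (y / aeval x g - algebraMap k F w)) = 2 * n) := by
    intro j hj hu
    obtain ⟨⟨h1, h2, h3⟩, h4⟩ := T.ord_nonneg P hj hu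
    have h5 := T.not_pos_of_pos P
    -- At the translated point, the same disjointness says that a zero of `σ q` at `P` is not a zero
    -- of the other two conjugates.
    have h6 := T.not_pos_of_pos (P.comap σ)
    rw [Point.ord_comap, Point.ord_comap, Point.ord_comap, T.iterate_three] at h6
    set a := P.ord (y / aeval x g - algebraMap k F w)
    set b := P.ord (σ (y / aeval x g - algebraMap k F w))
    set c := P.ord (σ (σ (y / aeval x g - algebraMap k F w)))
    refine ⟨⟨h1, h2⟩, ?_, ?_⟩
    · by_cases ha : 0 < a
      · have := h5 ha
        exact ⟨P.ord (aeval x s) - j, by omega⟩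
      · exact ⟨0, by omega⟩
    · by_cases hb : 0 < b
      · have := h6 hb
        exact ⟨P.ord (aeval x s) - j, by omega⟩
      · exact ⟨0, by omega⟩
  have hy0 := T.ne_zero
  have hg0 := T.aeval_g_ne_zero
  by_cases hx : x ∈ P.localRing
  · obtain ⟨a, hP⟩ := P.exists_valuation_sub_lt_one T.toKummer hx
    by_cases hg : g.eval a = 0
    · exact Or.inl (T.ord_of_eval_g_eq_zero P hP hg)
    · right
      have h1 := T.ord_aeval_eq_zero P hP hg
      refine hgood 0 (by rw [h1]; rfl) (P.mem_of_ord_nonneg ?_)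
      rw [P.ord_div hy0 hg0, h1, sub_zero]
      have h2 := congrArg P.ord T.eqn
      rw [P.ord_pow, P.ord_mul T.aeval_f_ne_zero (pow_ne_zero _ hg0), P.ord_pow, h1] at h2
      have h3 := P.ord_nonneg (aeval_mem_valuationSubring _ P.algebraMap_mem hx f)
      push_cast at h2
      omega
  · right
    obtain ⟨-, h1, -, h2, -⟩ := T.local_infinity 2 P (Model.valuation_inv_lt_one P hx)
    have h3 := h2 g T.g_ne_zero
    rw [T.deg_g] at h3
    -- At infinity `g(x)` has order `-2`, still even, so the parity argument goes through with `j =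
    -- -1`.
    refine hgood (-1) (by rw [h3]; norm_num) (P.mem_of_ord_nonneg ?_)
    rw [P.ord_div hy0 hg0, h1, h3]
    norm_num

/-- In characteristic two `f'` and `g'` are constants with `f' = w ^ 3 g' ≠ 0`. If `du = 0`,
differentiating `u ^ 3 g = f` gives `u ^ 3 = w ^ 3`, hence `s ^ 2 = 0`. -/
theorem D_u_ne_zero (T : TorsionData σ ζ x y f g s w) : D k F (y / aeval x g) ≠ 0 := by
  have hF : CharP F 2 := charP_of_injective_algebraMap (algebraMap k F).injective 2
  intro h0
  have h1 := congrArg (D k F) T.u_cubed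
  rw [Derivation.leibniz, Derivation.leibniz_pow, h0, smul_zero, smul_zero, smul_zero, add_zero,
    Model.D_aeval, Model.D_aeval, smul_smul, derivative_eq_C_of_natDegree_eq_two T.deg_g,
    derivative_eq_C_of_natDegree_eq_two T.deg_f, aeval_C, aeval_C, T.coeff_one, map_mul] at h1
  have h2 := (T.toKummer.frobGen (p := 2)).smul_D_injective h1
  have hb' := coeff_one_ne_zero_of_squarefree T.deg_g
    (T.sqfree.squarefree_of_dvd (dvd_mul_left g f))
  have h3 := mul_right_cancel₀ ((_root_.map_ne_zero (algebraMap k F)).2 hb') h2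
  have h4 := T.u_cubed
  have h5 : aeval x (s ^ 2) = 0 := by
    rw [← T.sq, map_sub, map_mul, aeval_C, ← h4, h3, sub_self]
  exact aeval_ne_zero_of_transcendental T.trans (pow_ne_zero _ T.s_ne_zero) h5

/-- The divisor of `q / σ q` is twice `E - σE`, and the class of `E - σE` cannot vanish: otherwise
`q / σ q` would be a square, and differentiation would make `q` an eigenvector of `σ`, which its
constant term `-w` prevents. -/
theorem not_hasPRank_zero (T : TorsionData σ ζ x y f g s w) (hgenus : 0 < genus k F) :
    ¬ HasPRank k F 2 0 := by
  classical
  have hF : CharP F 2 := charP_of_injective_algebraMap (algebraMap k F).injective 2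
  intro hrank
  have hq := T.q_ne_zero
  have hq' : σ (y / aeval x g - algebraMap k F w) ≠ 0 := (map_ne_zero_iff σ σ.injective).2 hq
  -- Half the divisor of zeros of `q`. Poles are left out because `q` and `σ q` have the same ones,
  -- all simple.
  let E : Divisor k F := Finsupp.onFinset T.finite_zeros.toFinset
    (fun P => if 0 < P.ord (y / aeval x g - algebraMap k F w) then
      P.ord (y / aeval x g - algebraMap k F w) / 2 else 0) (by
        intro P hP
        rw [Set.Finite.mem_toFinset]
        by_contra hcon
        exact hP (if_neg hcon))
  have hE : ∀ P, E P = if 0 < P.ord (y / aeval x g - algebraMap k F w) then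
      P.ord (y / aeval x g - algebraMap k F w) / 2 else 0 := fun P => rfl
  obtain ⟨v, hv0, hv⟩ := exists_ord_eq_two_mul σ hrank E (div_ne_zero hq hq') (by
    intro P
    rw [hE, hE, Point.ord_comap, P.ord_div hq hq']
    rcases T.ord_cases P with ⟨h1, h2⟩ | ⟨⟨h1, h2⟩, ⟨n, hn⟩, ⟨n', hn'⟩⟩
    · rw [h1, h2]
      norm_num
    · split_ifs <;> omega)
  set q := y / aeval x g - algebraMap k F w with hqdef
  have hv2 : v ^ 2 ≠ 0 := pow_ne_zero _ hv0
  obtain ⟨c, hc⟩ := exists_algebraMap_eq_of_regular hgenus (h := q / σ q / v ^ 2) (fun P => by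
    apply P.mem_of_ord_nonneg
    rw [P.ord_div (div_ne_zero hq hq') hv2, hv P, P.ord_pow]
    norm_num)
  -- The constant is itself a square, so `q / σ q` is one too.
  obtain ⟨d, rfl⟩ := IsAlgClosed.exists_pow_nat_eq c (n := 2) (by norm_num)
  have h1 : q = (algebraMap k F d * v) ^ 2 * σ q := by
    rw [mul_pow, ← map_pow, hc]
    field_simp
  have hDq : D k F q = D k F (y / aeval x g) := by
    rw [hqdef, map_sub, Derivation.map_algebraMap, sub_zero]
  have hDq' : D k F (σ q) = algebraMap k F ζ • D k F (y / aeval x g) := by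
    rw [T.act_q, map_sub, Derivation.map_algebraMap, sub_zero, ← Algebra.smul_def,
      Derivation.map_smul, algebraMap_smul]
  -- The square factor has zero differential in characteristic two, while `dq = du` and `d(σ q) = ζ
  -- du`; comparing coefficients of `du ≠ 0` identifies the square factor as `ζ⁻¹`.
  have h2 := congrArg (D k F) h1
  rw [Derivation.leibniz, D_pow_char, smul_zero, add_zero, hDq, hDq', smul_smul] at h2
  have h3 : (1 - (algebraMap k F d * v) ^ 2 * algebraMap k F ζ) • D k F (y / aeval x g) = 0 := by
    rw [sub_smul, one_smul, ← h2, sub_self]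
  have h4 := (smul_eq_zero.1 h3).resolve_right T.D_u_ne_zero
  have h5 : σ q = algebraMap k F ζ * q := by
    conv_rhs => rw [h1]
    linear_combination σ q * h4
  rw [T.act_q] at h5
  have h6 : algebraMap k F (w * (ζ ^ 1 - 1)) = 0 := by
    rw [pow_one, map_mul, map_sub, map_one]
    linear_combination h5 + algebraMap k F ζ * hqdef
  exact T.const_ne_zero one_ne_zero (by norm_num) ((map_eq_zero _).1 h6)

end TorsionData

/-- In characteristic two no trielliptic curve of genus two has 2-rank zero. -/
theorem IsTrielliptic.not_hasPRank_zero [IsAlgClosed k] [CharP k 2] (h : IsTrielliptic k F) (hgenus : genus k F = 2) :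
    ¬ HasPRank k F 2 0 := by
  have hF : CharP F 2 := charP_of_injective_algebraMap (algebraMap k F).injective 2
  have h3 : NeZero ((3 : ℕ) : k) := ⟨fun h => by
    have := (CharP.cast_eq_zero_iff k 2 3).1 h
    omega⟩
  obtain ⟨ζ, hζ⟩ := HasEnoughRootsOfUnity.exists_primitiveRoot k 3
  obtain ⟨-, σ, x, hσ⟩ := h
  obtain ⟨y, hy⟩ := hσ.exists_kummer hζ
  obtain ⟨x', y', f, g, m, M⟩ := hy.exists_model
  obtain ⟨rfl, hf, hg⟩ := M.natDegree_eq_two 2 hgenus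
  obtain ⟨s, w, T⟩ := M.exists_torsionData hf hg
  exact T.not_hasPRank_zero (by omega)

end Torsion

end TriCurve

theorem mainTheorem6 :
    (∀ (p : ℕ) [Fact p.Prime], p ≠ 2 → p % 3 = 2 →
      ∀ (k : Type u) [Field k] [IsAlgClosed k] [CharP k p],
        ∃ (F : Type u) (_ : Field F) (_ : Algebra k F) (x y : F) (σ : F ≃ₐ[k] F),
          Transcendental k x ∧ y ^ 3 = (x ^ 2 - 1) * (x ^ 2 + 1) ^ 2 ∧
          IntermediateField.adjoin k {x, y} = ⊤ ∧
          TriCurve.IsCurve k F ∧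
          TriCurve.IsTriellipticCover σ x ∧
          TriCurve.genus k F = 2 ∧
          (∀ ζ : k, IsPrimitiveRoot ζ 3 → TriCurve.HasSignature σ ζ 1 1) ∧
          TriCurve.IsSuperspecial k F p ∧
          TriCurve.HasPRank k F p 0) ∧
    (∀ (k : Type u) [Field k] [IsAlgClosed k] [CharP k 2]
      (F : Type v) [Field F] [Algebra k F],
        TriCurve.IsTrielliptic k F → TriCurve.genus k F = 2 →
          ¬ TriCurve.HasPRank k F 2 0) :=
  ⟨fun p _ hp2 hp3 k _ _ _ => TriCurve.exists_superspecial p hp2 hp3 k,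
    fun k _ _ _ F _ _ h hgenus => TriCurve.IsTrielliptic.not_hasPRank_zero (k := k) (F := F) h hgenus⟩
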